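/- Let $\mathbb F$ be a field of characteristic $0$, $I=\{1,\dots,\ell\}$ with $\ell$ finite, and let $\mathcal V$ be an algebra of differential functions extending $R_\ell=\mathbb F[u_i^{(n)}\mid i\in I,n\ge 0]$: a unital commutative associative $\mathbb F$-algebra containing $R_\ell$, with a derivation $\partial$ and commuting derivations $\partial/\partial u_i^{(n)}$ extending those of $R_\ell$, such that each $f\in\mathcal V$ satisfies $\partial f/\partial u_i^{(n)}=0$ for all but finitely many $(i,n)$, and $[\partial/\partial u_i^{(n)},\partial]=\partial/\partial u_i^{(n-1)}$ (read as $0$ if $n=0$). **Cochains.** For $k\ge -1$ let $\tilde W^\partial_k$ be the space of linear maps $X:\mathcal V^{\otimes(k+1)}\to\mathbb F[\lambda_0,\dots,\lambda_k]\otimes\mathcal V$ which are sesquilinear, $X_{\lambda_0,\dots,\lambda_k}(\dots,\partial f_i,\dots)=-\lambda_iX_{\lambda_0,\dots,\lambda_k}(\dots,f_i,\dots)$, and skewsymmetric under simultaneous permutations of the $\lambda_i$ and the $f_i$. Let $W^\partial_k$ be the space of maps with the same properties and values in $\mathbb F_-[\lambda_0,\dots,\lambda_k]\otimes_{\mathbb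 F[\partial]}\mathcal V=(\mathbb F[\lambda_0,\dots,\lambda_k]\otimes\mathcal V)/(\lambda_0+\dots+\lambda_k+\partial)(\mathbb F[\lambda_0,\dots,\lambda_k]\otimes\mathcal V)$. Put $\tilde W^\partial=\bigoplus_k\tilde W^\partial_k$, $W^\partial=\bigoplus_kW^\partial_k$; elements of degree $k$ have parity $\bar p=k\bmod 2$. Let $(\partial X)_{\lambda_0,\dots,\lambda_k}=(\lambda_0+\dots+\lambda_k+\partial)X_{\lambda_0,\dots,\lambda_k}$, and let $\int:\tilde W^\partial\to W^\partial$ be induced by the quotient map. Below $X$ has degree $h$, $Y$ has degree $k-h$, $\partial$ in a subscript is moved to the left, and $$S_\theta(X,Y)_{\lambda_0,\dots,\lambda_k}(f_0,\dots,f_k)=\sum_{\substack{i_0<\dots<i_{k-h}\\ i_{k-h+1}<\dots<i_k}}\mathrm{sign}(i_0,\dots,i_k)\,X_{\theta,\lambda_{i_{k-h+1}},\dots,\lambda_{i_k}}\big(Y_{\lambda_{i_0},\dots,\lambda_{i_{k-h}}}(f_{i_0},\dots,f_{i_{k-h}}),f_{i_{k-h+1}},\dots,f_{i_k}\big)$$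 (zero if $h=-1$). - The $\lambda$-bracket on $\tilde W^\partial$ is $[X_\lambda Y]=X\Box_\lambda Y-(-1)^{\bar p(X)\bar p(Y)}Y\Box_{-\lambda-\partial}X$, where $\Box_\lambda=S_\theta$ with $\theta=-\lambda-\lambda_{i_{k-h+1}}-\dots-\lambda_{i_k}-\partial$, and $Y\Box_{-\lambda-\partial}X$ is obtained from $Y\Box_\mu X$ by setting $\mu=-\lambda-\lambda_0-\dots-\lambda_k-\partial$. In general it is a formal power series in $\lambda$ with coefficients in $\tilde W^\partial$, polynomial on each collection of arguments. - The bracket on $W^\partial$ is $[X,Y]=X\Box Y-(-1)^{\bar p(X)\bar p(Y)}Y\Box X$, where $\Box=S_\theta$ with $\theta=\lambda_{i_0}+\dots+\lambda_{i_{k-h}}$. - The action of $X\in W^\partial$ on $\tilde Y\in\tilde W^\partial$ is $[X,\tilde Y]=X\Box^L\tilde Y-(-1)^{\bar p(X)\bar p(\tilde Y)}\tilde Y\Box^RX$, where $\Box^L=S_\theta$ with $\theta=-\lambda_{i_{k-h+1}}-\dots-\lambda_{i_k}-\partial$ and $\Box^R$ is given by the same formula as $\Box$. - The concatenation product of $X$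 with $h$ arguments and $Y$ with $k-h$ arguments is $$(X\wedge Y)_{\lambda_1,\dots,\lambda_k}(f_1,\dots,f_k)=(-1)^{h(k-h)}\sum_{\substack{i_1<\dots<i_h\\ i_{h+1}<\dots<i_k}}\mathrm{sign}(i_1,\dots,i_k)\,X_{\lambda_{i_1},\dots,\lambda_{i_h}}(f_{i_1},\dots,f_{i_h})\,Y_{\lambda_{i_{h+1}},\dots,\lambda_{i_k}}(f_{i_{h+1}},\dots,f_{i_k}).$$ **Polyvector fields.** $W^{\rm var}=\bigoplus_kW^{\rm var}_k$, where $W^{\rm var}_k$ consists of the $X\in W^\partial_k$ satisfying the master equation $$X_{\lambda_0,\dots,\lambda_k}(f_0,\dots,f_k)=\sum_{i_s\in I,\,m_s\ge0}\Big(e^{\partial\partial_{\lambda_0}}\tfrac{\partial f_0}{\partial u_{i_0}^{(m_0)}}\Big)\cdots\Big(e^{\partial\partial_{\lambda_k}}\tfrac{\partial f_k}{\partial u_{i_k}^{(m_k)}}\Big)(-\lambda_0)^{m_0}\cdots(-\lambda_k)^{m_k}X_{\lambda_0,\dots,\lambda_k}(u_{i_0},\dots,u_{i_k}),$$ with $(e^{\partial\partial_\lambda}f)P(\lambda)=\sum_n\frac1{n!}(\partial^nf)\,\partial_\lambda^nP(\lambda)$.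 A conformal vector field is a map $f\mapsto\sum_{i,n}P_i(\lambda+\partial)(-\lambda-\partial)^n\frac{\partial f}{\partial u_i^{(n)}}$ with $P_i\in\mathbb F[\lambda]\otimes\mathcal V$. The full prolongation $\tilde W^{\rm var}=\bigoplus_{k\ge-1}\tilde W^{\rm var}_k\subset\tilde W^\partial$ is defined by: $\tilde W^{\rm var}_{-1}=\mathcal V$; $\tilde W^{\rm var}_0$ is the space of conformal vector fields; and, for $k\ge1$, $\tilde W^{\rm var}_k$ consists of the $X\in\tilde W^\partial_k$ such that for all $f\in\mathcal V$ all coefficients of $[X_\lambda f]$ lie in $\tilde W^{\rm var}_{k-1}$. **Proposition.** (a) For $X,Y\in\tilde W^{\rm var}$, $[X_\lambda Y]$ is a polynomial in $\lambda$ with coefficients in $\tilde W^{\rm var}$, and $X\wedge Y\in\tilde W^{\rm var}$. (b) $\Pi\tilde W^{\rm var}$ (parity $p=\bar p+1$), with $\partial$, the $\lambda$-bracket and $\wedge$, is a $\mathbb Z_+$-graded odd Poisson vertex algebra (elements with $n$ arguments have degree $n$): it is a unital commutative associative superalgebra with even derivation $\partial$, the $\lambda$-bracket makes $\tilde W^{\rm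 var}$ a Lie conformal superalgebra, and $[X_\lambda\,Y\wedge Z]=[X_\lambda Y]\wedge Z+(-1)^{(p(X)+1)p(Y)}Y\wedge[X_\lambda Z]$. (c) $W^{\rm var}$ is a Lie superalgebra under the bracket of $W^\partial$, and the action of $W^\partial$ restricts to a representation of $W^{\rm var}$ on $\tilde W^{\rm var}$, which commutes with $\partial$ and is by derivations of both the concatenation product and the $\lambda$-bracket. (d) $\int$ restricts to a map $\int:\tilde W^{\rm var}\to W^{\rm var}$, which is a homomorphism of representations of $W^{\rm var}$, and it induces an isomorphism of Lie superalgebras $\tilde W^{\rm var}/\partial\tilde W^{\rm var}\to W^{\rm var}$, where the bracket on the left is $[\int X,\int Y]=\int[X_\lambda Y]|_{\lambda=0}$. -/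

import Mathlib

open scoped DirectSum

noncomputable section

/-! ## Superalgebras, Lie conformal superalgebras, odd Poisson vertex algebras -/

/-- The sign `(-1)^{ij}` for parities `i, j ∈ ℤ/2`. -/
def superSign (i j : ZMod 2) : ℤ := if i = 1 ∧ j = 1 then -1 else 1

/-- A Lie superalgebra structure on a vector space `L`
(`parity 0` and `parity 1` are the even and the odd subspace). -/
structure LieSuperalgebra (F L : Type*) [Field F] [AddCommGroup L] [Module F L] where
  parity : ZMod 2 → Submodule F L
  isInternal : DirectSum.IsInternal parity
  bracket : L →ₗ[F] L →ₗ[F] L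
  bracket_mem : ∀ i j, ∀ a ∈ parity i, ∀ b ∈ parity j, bracket a b ∈ parity (i + j)
  skew : ∀ i j, ∀ a ∈ parity i, ∀ b ∈ parity j,
    bracket b a = -(superSign i j • bracket a b)
  jacobi : ∀ i j, ∀ a ∈ parity i, ∀ b ∈ parity j, ∀ c,
    bracket a (bracket b c) - superSign i j • bracket b (bracket a c) = bracket (bracket a b) c

/-- Multiplication by `λ` on `F[λ] ⊗ R`; an element `∑ λⁿ rₙ` of `F[λ] ⊗ R` is represented by the
finitely supported family of its coefficients `n ↦ rₙ`. -/
def lamMul (F R : Type*) [Field F] [AddCommGroup R] [Module F R] :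
    (ℕ →₀ R) →ₗ[F] (ℕ →₀ R) :=
  Finsupp.lmapDomain R F Nat.succ

/-- An endomorphism `D` of `R` acting on the coefficients of elements of `F[λ] ⊗ R`. -/
def lamMap {F R : Type*} [Field F] [AddCommGroup R] [Module F R] (D : R →ₗ[F] R) :
    (ℕ →₀ R) →ₗ[F] (ℕ →₀ R) :=
  Finsupp.mapRange.linearMap D

/-- The axioms of a Lie conformal superalgebra for the superspace `R` with parity `parity`,
the `F[∂]`-module structure given by `D` and the polynomial `λ`-bracket `lbr`. -/
structure IsLieConformalSuperalgebra {F R : Type*} [Field F] [AddCommGroup R] [Module F R]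
    (parity : ZMod 2 → Submodule F R) (D : R →ₗ[F] R)
    (lbr : R →ₗ[F] R →ₗ[F] (ℕ →₀ R)) : Prop where
  isInternal : DirectSum.IsInternal parity
  D_mem : ∀ i, ∀ a ∈ parity i, D a ∈ parity i
  lbr_mem : ∀ i j, ∀ a ∈ parity i, ∀ b ∈ parity j, ∀ n, lbr a b n ∈ parity (i + j)
  /-- `[∂a _λ b] = -λ [a _λ b]` -/
  sesq_left : ∀ a b, lbr (D a) b = -lamMul F R (lbr a b)
  /-- `[a _λ ∂b] = (λ + ∂) [a _λ b]` -/
  sesq_right : ∀ a b, lbr a (D b) = lamMul F R (lbr a b) + lamMap D (lbr a b)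
  /-- `[b _λ a] = -(-1)^{p(a)p(b)} [a _{-λ-∂} b]`, with `∂` moved to the left. -/
  skew : ∀ i j, ∀ a ∈ parity i, ∀ b ∈ parity j,
    lbr b a = -(superSign i j • (lbr a b).sum fun n c =>
      ((-(lamMul F R + lamMap D) : Module.End F (ℕ →₀ R)) ^ n) (Finsupp.single 0 c))
  /-- The coefficient of `λ^m μ^n` in the Jacobi identity
  `[a _λ [b _μ c]] - (-1)^{p(a)p(b)} [b _μ [a _λ c]] = [[a _λ b] _{λ+μ} c]`. -/
  jacobi : ∀ i j, ∀ a ∈ parity i, ∀ b ∈ parity j, ∀ c m n,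
    lbr a (lbr b c n) m - superSign i j • lbr b (lbr a c m) n
      = ∑ q ∈ Finset.HasAntidiagonal.antidiagonal m, ((q.2 + n).choose n) • lbr (lbr a b q.1) c (q.2 + n)

/-- An odd Poisson vertex (super)algebra with underlying vector space `R` and parity `parity`. -/
structure OddPVA (F R : Type*) [Field F] [AddCommGroup R] [Module F R] where
  parity : ZMod 2 → Submodule F R
  one : R
  mul : R →ₗ[F] R →ₗ[F] R
  D : R →ₗ[F] R
  lbr : R →ₗ[F] R →ₗ[F] (ℕ →₀ R)
  one_mem : one ∈ parity 0
  mul_mem : ∀ i j, ∀ a ∈ parity i, ∀ b ∈ parity j, mul a b ∈ parity (i + j)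
  one_mul : ∀ a, mul one a = a
  mul_assoc : ∀ a b c, mul (mul a b) c = mul a (mul b c)
  mul_comm : ∀ i j, ∀ a ∈ parity i, ∀ b ∈ parity j, mul b a = superSign i j • mul a b
  D_mul : ∀ a b, D (mul a b) = mul (D a) b + mul a (D b)
  /-- `ΠR`, i.e. `R` with reversed parity, is a Lie conformal superalgebra. -/
  lieConformal : IsLieConformalSuperalgebra (fun i => parity (i + 1)) D lbr
  /-- The odd Leibniz rule
  `[a _λ bc] = [a _λ b] c + (-1)^{(p(a)+1)p(b)} b [a _λ c]`. -/
  leibniz : ∀ i j, ∀ a ∈ parity i, ∀ b ∈ parity j, ∀ c n,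
    lbr a (mul b c) n = mul (lbr a b n) c + superSign (i + 1) j • mul b (lbr a c n)

/-- The odd PVA is `ℤ₊`-graded by the subspaces `G 0, G 1, …`: the product has degree `0`,
`∂` has degree `0`, and the `λ`-bracket has degree `-1`. -/
structure OddPVA.IsGraded {F R : Type*} [Field F] [AddCommGroup R] [Module F R]
    (P : OddPVA F R) (G : ℕ → Submodule F R) : Prop where
  isInternal : DirectSum.IsInternal G
  one_mem : P.one ∈ G 0
  mul_mem : ∀ m n, ∀ a ∈ G m, ∀ b ∈ G n, P.mul a b ∈ G (m + n)
  D_mem : ∀ n, ∀ a ∈ G n, P.D a ∈ G n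
  lbr_mem : ∀ m n k, m + n = k + 1 → ∀ a ∈ G m, ∀ b ∈ G n, ∀ j, P.lbr a b j ∈ G k
  lbr_zero : ∀ a ∈ G 0, ∀ b ∈ G 0, P.lbr a b = 0

/-- `ρ` is a representation of the Lie superalgebra `L` on the odd PVA `P`, commuting with `∂` and
acting by derivations of both the product and the `λ`-bracket. -/
structure IsRepByDerivations {F L R : Type*} [Field F] [AddCommGroup L] [Module F L]
    [AddCommGroup R] [Module F R] (S : LieSuperalgebra F L) (P : OddPVA F R)
    (ρ : L →ₗ[F] R →ₗ[F] R) : Prop where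
  parity_mem : ∀ i j, ∀ x ∈ S.parity i, ∀ a ∈ P.parity j, ρ x a ∈ P.parity (i + j)
  map_bracket : ∀ i j, ∀ x ∈ S.parity i, ∀ y ∈ S.parity j, ∀ a,
    ρ (S.bracket x y) a = ρ x (ρ y a) - superSign i j • ρ y (ρ x a)
  comm_D : ∀ x a, ρ x (P.D a) = P.D (ρ x a)
  der_mul : ∀ i j, ∀ x ∈ S.parity i, ∀ a ∈ P.parity j, ∀ b,
    ρ x (P.mul a b) = P.mul (ρ x a) b + superSign i j • P.mul a (ρ x b)
  der_lbr : ∀ i j, ∀ x ∈ S.parity i, ∀ a ∈ P.parity j, ∀ b n,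
    ρ x (P.lbr a b n) = P.lbr (ρ x a) b n + superSign i (j + 1) • P.lbr a (ρ x b) n

/-- `Q` is the Lie superalgebra structure induced on `R / ∂R` by the Lie conformal superalgebra
`ΠR`: the bracket is `[∫a, ∫b] = ∫ [a _λ b] |_{λ=0}`. -/
def IsReducedLieSuperalgebra {F R : Type*} [Field F] [AddCommGroup R] [Module F R]
    (P : OddPVA F R) (Q : LieSuperalgebra F (R ⧸ LinearMap.range P.D)) : Prop :=
  (∀ i, Q.parity i = (P.parity (i + 1)).map (LinearMap.range P.D).mkQ) ∧
  ∀ a b : R, Q.bracket (Submodule.Quotient.mk a) (Submodule.Quotient.mk b)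
    = Submodule.Quotient.mk (P.lbr a b 0)

/-- An isomorphism of Lie superalgebras. -/
structure IsLieSuperIso {F L L' : Type*} [Field F] [AddCommGroup L] [Module F L]
    [AddCommGroup L'] [Module F L'] (S : LieSuperalgebra F L) (S' : LieSuperalgebra F L')
    (e : L ≃ₗ[F] L') : Prop where
  map_parity : ∀ i, (S.parity i).map e.toLinearMap = S'.parity i
  map_bracket : ∀ a b, e (S.bracket a b) = S'.bracket (e a) (e b)

/-- The elements of a direct sum `⨁ₙ Mₙ` all of whose components lie in degrees `n` with
`n + c = i` modulo `2`. -/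
def degreeParity (F : Type*) [Field F] (M : ℕ → Type*) [∀ n, AddCommGroup (M n)]
    [∀ n, Module F (M n)] (c i : ZMod 2) : Submodule F (⨁ n, M n) where
  carrier := {x | ∀ n : ℕ, (n : ZMod 2) + c ≠ i → x n = 0}
  add_mem' := fun {x y} hx hy n hn => by rw [DirectSum.add_apply, hx n hn, hy n hn, add_zero]
  zero_mem' := fun n _ => rfl
  smul_mem' := fun r x hx n hn => by rw [DirectSum.smul_apply, hx n hn, smul_zero]

/-! ## Algebras of differential functions -/

/-- An algebra of differential functions `V` over `F` in the variables `u i`, `i ∈ I`, which is an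
extension of the algebra of differential polynomials `R_ℓ = F[u_i^{(n)}]`:
a differential algebra with commuting derivations `pd i n = ∂/∂u_i^{(n)}`, such that the
`u_i^{(n)} = ∂ⁿ u_i` are algebraically independent and `pd` extends the partial derivatives
of `R_ℓ`. -/
structure DiffFunctionAlgebra (F V I : Type*) [Field F] [CommRing V] [Algebra F V] where
  d : Derivation F V V
  pd : I → ℕ → Derivation F V V
  pd_comm : ∀ i m j n f, pd i m (pd j n f) = pd j n (pd i m f)
  pd_finite : ∀ f, {q : I × ℕ | pd q.1 q.2 f ≠ 0}.Finite
  pd_d_zero : ∀ i f, pd i 0 (d f) = d (pd i 0 f)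
  pd_d_succ : ∀ i n f, pd i (n + 1) (d f) = d (pd i (n + 1) f) + pd i n f
  u : I → V
  algebraicIndependent : AlgebraicIndependent F (fun q : I × ℕ => d^[q.2] (u q.1))
  pd_u_self : ∀ i n, pd i n (d^[n] (u i)) = 1
  pd_u_ne : ∀ i n j m, (j, m) ≠ (i, n) → pd j m (d^[n] (u i)) = 0

namespace DiffFunctionAlgebra

open MvPolynomial

variable {F V I : Type*} [Field F] [CommRing V] [Algebra F V] (A : DiffFunctionAlgebra F V I)

/-- The finitely many `(i, n)` with `∂f/∂u_i^{(n)} ≠ 0`. -/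
def supp (f : V) : Finset (I × ℕ) := (A.pd_finite f).toFinset

/-! ### Polynomials in `λ`'s with coefficients in `V`

`F[λ_s | s ∈ τ] ⊗ V` is `MvPolynomial τ V`. Expressions involving also `∂` are written as
polynomials in an auxiliary variable (`Polynomial.X`) which is then replaced by `∂`, acting either
on the coefficients standing to its right (`moveLeft`) or on a given `f` (`insertAt`). -/

/-- `∂` acting on the coefficients. -/
def coeffD (τ : Type*) : MvPolynomial τ V →ₗ[F] MvPolynomial τ V :=
  (Finsupp.lsum F fun β : τ →₀ ℕ =>
      ((monomial β : V →ₗ[V] MvPolynomial τ V).restrictScalars F) ∘ₗ (A.d : V →ₗ[F] V))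
    ∘ₗ (AddMonoidAlgebra.coeffLinearEquiv F).toLinearMap

/-- `∑ₙ εⁿ cₙ ↦ ∑ₙ ∂ⁿ cₙ`: the variable `ε` is replaced by `∂`, moved to the left. -/
def moveLeft (τ : Type*) : Polynomial (MvPolynomial τ V) →ₗ[F] MvPolynomial τ V :=
  Polynomial.lsum fun n => (A.coeffD τ : Module.End F (MvPolynomial τ V)) ^ n

/-- The operator `P ↦ (e^{∂ ∂_{λ_s}} f) P = P(…, λ_s + ∂, …)_→ f`, where `∂` acts on `f`. -/
def insertAt {τ : Type*} [DecidableEq τ] (s : τ) (f : V) :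
    MvPolynomial τ V →ₗ[F] MvPolynomial τ V :=
  (Polynomial.lsum fun n => (LinearMap.mulRight F (C (A.d^[n] f) : MvPolynomial τ V))) ∘ₗ
    (aeval (R := V) (fun t : τ => if t = s then Polynomial.C (X t) + Polynomial.X
      else Polynomial.C (X t) : τ → Polynomial (MvPolynomial τ V))).toLinearMap.restrictScalars F

/-- The operator `λ_0 + ⋯ + λ_{n-1} + ∂` on `F[λ_0, …, λ_{n-1}] ⊗ V`. -/
def totalD (n : ℕ) : MvPolynomial (Fin n) V →ₗ[F] MvPolynomial (Fin n) V :=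
  LinearMap.mulLeft F (∑ i, X i) + A.coeffD (Fin n)

/-- `F₋[λ_0, …, λ_{n-1}] ⊗_{F[∂]} V`. Since `∂` acts on the first factor as
`-(λ_0 + ⋯ + λ_{n-1})`, this is the quotient of `F[λ_0, …, λ_{n-1}] ⊗ V` by the image of
`λ_0 + ⋯ + λ_{n-1} + ∂`. -/
abbrev QPoly (n : ℕ) : Type _ := MvPolynomial (Fin n) V ⧸ LinearMap.range (A.totalD n)

/-- The quotient map `∫`. -/
abbrev toQ (n : ℕ) : MvPolynomial (Fin n) V →ₗ[F] A.QPoly n :=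
  (LinearMap.range (A.totalD n)).mkQ

theorem coeffD_monomial {τ : Type*} (β : τ →₀ ℕ) (c : V) :
    A.coeffD τ (monomial β c) = monomial β (A.d c) := by
  have : (AddMonoidAlgebra.coeffLinearEquiv F) (monomial β c : MvPolynomial τ V)
      = Finsupp.single β c := rfl
  simp [coeffD, this]

theorem coeffD_C {τ : Type*} (c : V) :
    A.coeffD τ (C c) = C (A.d c) := A.coeffD_monomial 0 c

theorem coeffD_mul_X {τ : Type*} (t : τ) (P : MvPolynomial τ V) :
    A.coeffD τ (P * X t) = A.coeffD τ P * X t := by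
  induction P using MvPolynomial.induction_on' with
  | monomial β c =>
    rw [coeffD_monomial, X, monomial_mul, monomial_mul, coeffD_monomial, mul_one, mul_one]
  | add p q hp hq => rw [add_mul, map_add, hp, hq, map_add, add_mul]

theorem coeffD_rename {τ τ' : Type*} (g : τ → τ') (P : MvPolynomial τ V) :
    A.coeffD τ' (rename g P) = rename g (A.coeffD τ P) := by
  induction P using MvPolynomial.induction_on' with
  | monomial β c => rw [rename_monomial, coeffD_monomial, coeffD_monomial, rename_monomial]
  | add p q hp hq => simp only [map_add, hp, hq]

theorem insertAt_C {τ : Type*} [DecidableEq τ] (s : τ) (f c : V) :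
    A.insertAt s f (C c) = C (c * f) := by
  simp [insertAt, Polynomial.lsum_apply, MvPolynomial.algebraMap_eq]

theorem insertAt_mul_X {τ : Type*} [DecidableEq τ] (s t : τ) (f : V) (P : MvPolynomial τ V) :
    A.insertAt s f (P * X t)
      = A.insertAt s f P * X t + if t = s then A.insertAt s (A.d f) P else 0 := by
  have h1 : ∀ (f : V) (p : Polynomial (MvPolynomial τ V)) (a : MvPolynomial τ V),
      (Polynomial.lsum fun n => (LinearMap.mulRight F (C (A.d^[n] f) : MvPolynomial τ V)))
        (p * Polynomial.C a)
      = (Polynomial.lsum fun n => (LinearMap.mulRight F (C (A.d^[n] f) : MvPolynomial τ V))) p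
        * a := by
    intro f p a
    induction p using Polynomial.induction_on' with
    | add p q hp hq => rw [add_mul, map_add, hp, hq, map_add, add_mul]
    | monomial n c =>
      rw [Polynomial.monomial_mul_C]
      simp only [Polynomial.lsum_apply]
      rw [Polynomial.sum_monomial_index _ _ (by simp), Polynomial.sum_monomial_index _ _ (by simp)]
      simp only [LinearMap.mulRight_apply]; ring
  have h2 : ∀ p : Polynomial (MvPolynomial τ V),
      (Polynomial.lsum fun n => (LinearMap.mulRight F (C (A.d^[n] f) : MvPolynomial τ V)))
        (p * Polynomial.X)
      = (Polynomial.lsum fun n =>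
          (LinearMap.mulRight F (C (A.d^[n] (A.d f)) : MvPolynomial τ V))) p := by
    intro p
    induction p using Polynomial.induction_on' with
    | add p q hp hq => rw [add_mul, map_add, hp, hq, map_add]
    | monomial n c =>
      rw [Polynomial.monomial_mul_X]
      simp only [Polynomial.lsum_apply]
      rw [Polynomial.sum_monomial_index _ _ (by simp), Polynomial.sum_monomial_index _ _ (by simp)]
      rfl
  simp only [insertAt, LinearMap.comp_apply, LinearMap.restrictScalars_apply,
    AlgHom.toLinearMap_apply, map_mul, aeval_X]
  split_ifs with h
  · rw [mul_add, map_add, h1, h2]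
  · rw [h1, add_zero]

theorem insertAt_coeffD {τ : Type*} [DecidableEq τ] (s : τ) (P : MvPolynomial τ V) :
    ∀ f, A.coeffD τ (A.insertAt s f P)
      = A.insertAt s f (A.coeffD τ P) + A.insertAt s (A.d f) P := by
  induction P using MvPolynomial.induction_on with
  | C c =>
    intro f
    simp only [coeffD_C, insertAt_C, Derivation.leibniz, smul_eq_mul, ← map_add]
    congr 1; ring
  | add p q hp hq => intro f; simp only [map_add, hp, hq]; ring
  | mul_X p t hp =>
    intro f
    simp only [coeffD_mul_X, insertAt_mul_X, map_add, hp]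
    split_ifs with h
    · simp only [hp]; ring
    · simp only [map_zero]; ring

/-- An operator commuting with `λ_0 + ⋯ + λ_{n-1} + ∂` descends to the quotient. -/
def descend {n : ℕ} (T : MvPolynomial (Fin n) V →ₗ[F] MvPolynomial (Fin n) V)
    (hT : ∀ P, T (A.totalD n P) = A.totalD n (T P)) : A.QPoly n →ₗ[F] A.QPoly n :=
  Submodule.mapQ _ _ T (by rintro _ ⟨P, rfl⟩; exact ⟨T P, (hT P).symm⟩)

/-- Multiplication by `λ_i` on the quotient. -/
def mulLamQ {n : ℕ} (i : Fin n) : A.QPoly n →ₗ[F] A.QPoly n :=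
  A.descend (LinearMap.mulLeft F (X i)) fun P => by
    simp only [totalD, LinearMap.add_apply, LinearMap.mulLeft_apply, mul_add]
    rw [mul_comm (X i) P, coeffD_mul_X]; ring

/-- The substitution `λ_i ↦ λ_{σ i}` on the quotient. -/
def renameQ {n : ℕ} (σ : Equiv.Perm (Fin n)) : A.QPoly n →ₗ[F] A.QPoly n :=
  A.descend ((rename (R := V) σ).toLinearMap.restrictScalars F) fun P => by
    simp only [totalD, LinearMap.add_apply, LinearMap.mulLeft_apply,
      LinearMap.restrictScalars_apply, AlgHom.toLinearMap_apply, map_add, map_mul, map_sum,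
      rename_X, coeffD_rename]
    rw [Equiv.sum_comp σ (fun i => (X i : MvPolynomial (Fin n) V))]

/-- The operator `P ↦ P(…, λ_s + ∂, …)_→ f` on the quotient. -/
def insertAtQ {n : ℕ} (s : Fin n) (f : V) : A.QPoly n →ₗ[F] A.QPoly n :=
  A.descend (A.insertAt s f) fun P => by
    have h : ∀ t : Fin n, A.insertAt s f (X t * P) = X t * A.insertAt s f P
        + if t = s then A.insertAt s (A.d f) P else 0 := fun t => by
      rw [mul_comm, insertAt_mul_X, mul_comm]
    simp only [totalD, LinearMap.add_apply, LinearMap.mulLeft_apply, map_add, insertAt_coeffD,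
      Finset.sum_mul, map_sum, h, Finset.sum_add_distrib, Finset.sum_ite_eq', Finset.mem_univ,
      if_true]
    ring

/-! ### Cochains -/

/-- Maps `V^n → F[λ_0, …, λ_{n-1}] ⊗ V`. Such a map has degree `k = n - 1`. -/
abbrev Coch (_A : DiffFunctionAlgebra F V I) (n : ℕ) : Type _ :=
  (Fin n → V) → MvPolynomial (Fin n) V

/-- Maps `V^n → F₋[λ_0, …, λ_{n-1}] ⊗_{F[∂]} V`. Such a map has degree `k = n - 1`. -/
abbrev QCoch (n : ℕ) : Type _ := (Fin n → V) → A.QPoly n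

/-- The space `W̃^∂_{n-1}(ΠV)`: multilinear maps satisfying sesquilinearity
`X_λ(…, ∂v_i, …) = -λ_i X_λ(…, v_i, …)` and skewsymmetry. -/
def tildeWd (n : ℕ) : Submodule F (A.Coch n) where
  carrier := {X | (∃ T : MultilinearMap F (fun _ : Fin n => V) (MvPolynomial (Fin n) V),
      ∀ v, X v = T v) ∧
    (∀ v i, X (Function.update v i (A.d (v i))) = -(MvPolynomial.X i * X v)) ∧
    (∀ (σ : Equiv.Perm (Fin n)) v, rename σ (X (v ∘ σ)) = (Equiv.Perm.sign σ : ℤ) • X v)}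
  add_mem' := by
    rintro X Y ⟨⟨T, hT⟩, h1, h2⟩ ⟨⟨T', hT'⟩, h1', h2'⟩
    refine ⟨⟨T + T', fun v => by simp [hT, hT']⟩, fun v i => ?_, fun σ v => ?_⟩
    · simp only [Pi.add_apply, h1, h1']; ring
    · simp only [Pi.add_apply, map_add, h2, h2', smul_add]
  zero_mem' := ⟨⟨0, fun v => rfl⟩, fun v i => by simp, fun σ v => by simp⟩
  smul_mem' := by
    rintro r X ⟨⟨T, hT⟩, h1, h2⟩
    refine ⟨⟨r • T, fun v => by simp [hT]⟩, fun v i => ?_, fun σ v => ?_⟩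
    · simp only [Pi.smul_apply, h1, mul_smul_comm, smul_neg]
    · simp only [Pi.smul_apply]
      rw [← AlgHom.coe_toLinearMap, ← LinearMap.restrictScalars_apply F, map_smul,
        LinearMap.restrictScalars_apply, AlgHom.coe_toLinearMap, h2, smul_comm]

/-- The space `W^∂_{n-1}(ΠV)`: multilinear maps with values in
`F₋[λ_0, …, λ_{n-1}] ⊗_{F[∂]} V` satisfying sesquilinearity and skewsymmetry. -/
def Wd (n : ℕ) : Submodule F (A.QCoch n) where
  carrier := {X | (∃ T : MultilinearMap F (fun _ : Fin n => V) (A.QPoly n), ∀ v, X v = T v) ∧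
    (∀ v i, X (Function.update v i (A.d (v i))) = -(A.mulLamQ i (X v))) ∧
    (∀ (σ : Equiv.Perm (Fin n)) v, A.renameQ σ (X (v ∘ σ)) = (Equiv.Perm.sign σ : ℤ) • X v)}
  add_mem' := by
    rintro X Y ⟨⟨T, hT⟩, h1, h2⟩ ⟨⟨T', hT'⟩, h1', h2'⟩
    refine ⟨⟨T + T', fun v => by simp [hT, hT']⟩, fun v i => ?_, fun σ v => ?_⟩
    · simp only [Pi.add_apply, h1, h1', map_add, neg_add]
    · simp only [Pi.add_apply, map_add, h2, h2', smul_add]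
  zero_mem' := ⟨⟨0, fun v => rfl⟩, fun v i => by simp, fun σ v => by simp⟩
  smul_mem' := by
    rintro r X ⟨⟨T, hT⟩, h1, h2⟩
    refine ⟨⟨r • T, fun v => by simp [hT]⟩, fun v i => ?_, fun σ v => ?_⟩
    · simp only [Pi.smul_apply, h1, map_smul, smul_neg]
    · simp only [Pi.smul_apply, map_smul, h2]
      rw [smul_comm]

/-! ### Variational polyvector fields -/

/-- The right-hand side of the master equation,
`∑ (e^{∂∂_{λ_0}} ∂f_0/∂u_{i_0}^{(m_0)}) ⋯ (e^{∂∂_{λ_k}} ∂f_k/∂u_{i_k}^{(m_k)})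
(-λ_0)^{m_0} ⋯ (-λ_k)^{m_k} X_{λ_0, …, λ_k}(u_{i_0}, …, u_{i_k})`,
where the sum is over all `i_s ∈ I`, `m_s ∈ ℤ₊` with nonvanishing derivatives. -/
def masterRHS {n : ℕ} (X : A.QCoch n) (f : Fin n → V) : A.QPoly n :=
  ∑ q ∈ Fintype.piFinset fun s => A.supp (f s),
    ((List.ofFn fun s => (A.insertAtQ s (A.pd (q s).1 (q s).2 (f s)) :
        Module.End F (A.QPoly n))).prod)
      (((List.ofFn fun s => (-(A.mulLamQ s) : Module.End F (A.QPoly n)) ^ (q s).2).prod)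
        (X fun s => A.u (q s).1))

/-- The space `W^var_{n-1}` of variational polyvector fields: elements of `W^∂_{n-1}(ΠV)`
satisfying the master equation. -/
def wvarSubmodule (n : ℕ) : Submodule F (A.QCoch n) where
  carrier := {X | X ∈ A.Wd n ∧ ∀ f, X f = A.masterRHS X f}
  add_mem' := by
    rintro X Y ⟨hX, h⟩ ⟨hY, h'⟩
    refine ⟨add_mem hX hY, fun f => ?_⟩
    rw [Pi.add_apply, h, h']
    simp only [masterRHS, Pi.add_apply, map_add, Finset.sum_add_distrib]
  zero_mem' := ⟨zero_mem _, fun f => by simp [masterRHS]⟩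
  smul_mem' := by
    rintro r X ⟨hX, h⟩
    refine ⟨Submodule.smul_mem _ r hX, fun f => ?_⟩
    rw [Pi.smul_apply, h]
    simp only [masterRHS, Pi.smul_apply, map_smul, Finset.smul_sum]

/-! ### Box products

A shuffle `i_1 < ⋯ < i_a`, `i_{a+1} < ⋯ < i_k` is a permutation `σ` of `Fin k`, increasing on the
first `a` and on the last `b` elements; `e` is the equation `a + b = k`. Since `ΠV` is purely odd,
the sign attached to the shuffle is the sign of `σ`. -/

/-- The indices `i_1, …, i_a`. -/
def fst {a b k : ℕ} (e : a + b = k) (σ : Equiv.Perm (Fin k)) : Fin a → Fin k :=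
  fun j => σ (Fin.cast e (Fin.castAdd b j))

/-- The indices `i_{a+1}, …, i_k`. -/
def snd {a b k : ℕ} (e : a + b = k) (σ : Equiv.Perm (Fin k)) : Fin b → Fin k :=
  fun j => σ (Fin.cast e (Fin.natAdd a j))

open Classical in
/-- The set of shuffles. -/
def shuffles {a b k : ℕ} (e : a + b = k) : Finset (Equiv.Perm (Fin k)) :=
  Finset.univ.filter fun σ => StrictMono (fst e σ) ∧ StrictMono (snd e σ)

/-- The sum over shuffles
`∑_σ sign(σ) X_{θ(σ), λ_{i_{m+1}}, …, λ_{i_k}}(Y_{λ_{i_1}, …, λ_{i_m}}(v_{i_1}, …, v_{i_m}),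
v_{i_{m+1}}, …, v_{i_k})`
for `X` with `h + 1` and `Y` with `m` arguments, `m + h = k`. Here `X` is applied to the
coefficients of the polynomial `Y_{λ_{i_1}, …}(…)`, the variable `λ_j` is
`MvPolynomial.X (ν j)`, and the expression `θ(σ)` substituted for the first variable of `X` may
involve `∂` (written `Polynomial.X`), which is moved to the left. -/
def shuffleBox {h m k : ℕ} (e : m + h = k) {τ : Type*} (ν : Fin k → τ)
    (θ : Equiv.Perm (Fin k) → Polynomial (MvPolynomial τ V))
    (X : A.Coch (h + 1)) (Y : A.Coch m) (v : Fin k → V) : MvPolynomial τ V :=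
  ∑ σ ∈ shuffles e, (Equiv.Perm.sign σ : ℤ) •
    ∑ β ∈ (Y (v ∘ fst e σ)).support,
      rename (ν ∘ fst e σ) (monomial β (1 : V)) *
        A.moveLeft τ (aeval
          (Fin.cons (θ σ) (fun j => Polynomial.C (MvPolynomial.X (ν (snd e σ j)))) :
            Fin (h + 1) → Polynomial (MvPolynomial τ V))
          (X (Fin.cons ((Y (v ∘ fst e σ)).coeff β) (v ∘ snd e σ) : Fin (h + 1) → V)))

/-- The `λ`-product `X □_λ Y` on `W̃^∂(ΠV)`, where `λ` is the variable `none`: the first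
variable of `X` is replaced by `-λ - λ_{i_{m+1}} - ⋯ - λ_{i_k} - ∂`. -/
def boxLam {h m k : ℕ} (e : m + h = k) (X : A.Coch (h + 1)) (Y : A.Coch m) (v : Fin k → V) :
    MvPolynomial (Option (Fin k)) V :=
  A.shuffleBox e some
    (fun σ => -Polynomial.C (MvPolynomial.X none : MvPolynomial (Option (Fin k)) V)
      - Polynomial.C (∑ j, MvPolynomial.X (some (snd e σ j))) - Polynomial.X) X Y v

/-- The left box product `X □^L Y`, for a representative `X` of an element of `W^∂(ΠV)` and
`Y ∈ W̃^∂(ΠV)`: the first variable of `X` is replaced by `-λ_{i_{m+1}} - ⋯ - λ_{i_k} - ∂`. -/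
def boxL {h m k : ℕ} (e : m + h = k) (X : A.Coch (h + 1)) (Y : A.Coch m) (v : Fin k → V) :
    MvPolynomial (Fin k) V :=
  A.shuffleBox e id
    (fun σ => -Polynomial.C (∑ j, MvPolynomial.X (snd e σ j) : MvPolynomial (Fin k) V)
      - Polynomial.X) X Y v

/-- The box product in which the first variable of `X` is replaced by
`λ_{i_1} + ⋯ + λ_{i_m}`. On representatives this is both the box product of `W^∂(ΠV)` and the
right box product `X □^R Y` of `X ∈ W̃^∂(ΠV)` and `Y ∈ W^∂(ΠV)`. -/
def box {h m k : ℕ} (e : m + h = k) (X : A.Coch (h + 1)) (Y : A.Coch m) (v : Fin k → V) :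
    MvPolynomial (Fin k) V :=
  A.shuffleBox e id
    (fun σ => Polynomial.C (∑ j, MvPolynomial.X (fst e σ j))) X Y v

/-- The coefficient of `λ^j`. -/
def lamCoeff {k : ℕ} (j : ℕ) (P : MvPolynomial (Option (Fin k)) V) : MvPolynomial (Fin k) V :=
  (optionEquivLeft V (Fin k) P).coeff j

/-- The substitution of `-λ - λ_0 - ⋯ - λ_{k-1} - ∂` for `λ`, with `∂` moved to the left. -/
def skewSub {k : ℕ} (P : MvPolynomial (Option (Fin k)) V) : MvPolynomial (Option (Fin k)) V :=
  A.moveLeft _ (aeval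
    (fun t => Option.elim t
      (-Polynomial.C (MvPolynomial.X none : MvPolynomial (Option (Fin k)) V)
        - Polynomial.C (∑ j : Fin k, MvPolynomial.X (some j)) - Polynomial.X)
      (fun j => Polynomial.C (MvPolynomial.X (some j))) :
      Option (Fin k) → Polynomial (MvPolynomial (Option (Fin k)) V)) P)

/-! ### Operations on families of cochains

The following formulas give the component with `k` arguments of the various operations on
direct sums. An element with `n` arguments has degree `n - 1`, parity `n - 1` in `W̃^∂(ΠV)` or
`W^∂(ΠV)`, and parity `n` in `Π W̃^∂(ΠV)`. -/

/-- The `λ`-bracket `[X _λ Y] = X □_λ Y - (-1)^{p(X)p(Y)} Y □_{-λ-∂} X` on `W̃^∂(ΠV)`. -/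
def lamBracket (X Y : ∀ n, A.Coch n) (k : ℕ) (v : Fin k → V) : MvPolynomial (Option (Fin k)) V :=
  ∑ h : Fin (k + 1),
    (A.boxLam (Nat.sub_add_cancel (Nat.le_of_lt_succ h.isLt)) (X (h + 1)) (Y (k - h)) v
      - (-1 : ℤ) ^ ((h : ℕ) * (k - h + 1)) •
        A.skewSub
          (A.boxLam (Nat.sub_add_cancel (Nat.le_of_lt_succ h.isLt)) (Y (h + 1)) (X (k - h)) v))

/-- The concatenation product
`(X ∧ Y)_{λ_1, …, λ_k}(a_1, …, a_k) = ∑ sign(σ) (-1)^{(k-h)h}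
X_{λ_{i_1}, …, λ_{i_h}}(a_{i_1}, …, a_{i_h}) Y_{λ_{i_{h+1}}, …, λ_{i_k}}(a_{i_{h+1}}, …, a_{i_k})`
of `X` with `h` and `Y` with `k - h` arguments. -/
def wedge (X Y : ∀ n, A.Coch n) (k : ℕ) (v : Fin k → V) : MvPolynomial (Fin k) V :=
  ∑ h : Fin (k + 1), (-1 : ℤ) ^ ((k - h) * (h : ℕ)) •
    ∑ σ ∈ shuffles (Nat.add_sub_cancel' (Nat.le_of_lt_succ h.isLt)),
      (Equiv.Perm.sign σ : ℤ) •
        (rename (fst (Nat.add_sub_cancel' (Nat.le_of_lt_succ h.isLt)) σ)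
            (X h (v ∘ fst (Nat.add_sub_cancel' (Nat.le_of_lt_succ h.isLt)) σ)) *
          rename (snd (Nat.add_sub_cancel' (Nat.le_of_lt_succ h.isLt)) σ)
            (Y (k - h) (v ∘ snd (Nat.add_sub_cancel' (Nat.le_of_lt_succ h.isLt)) σ)))

/-- Chosen representatives in `F[λ_0, …, λ_{n-1}] ⊗ V` of the values of a cochain with values in
`F₋[λ_0, …, λ_{n-1}] ⊗_{F[∂]} V`. The operations below do not depend on this choice, for
sesquilinear cochains. -/
def rep (X : ∀ n, A.QCoch n) : ∀ n, A.Coch n :=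
  fun n v => Function.surjInv (Submodule.mkQ_surjective (LinearMap.range (A.totalD n))) (X n v)

/-- The Lie bracket `[X, Y] = X □ Y - (-1)^{p(X)p(Y)} Y □ X` on `W^∂(ΠV)`. -/
def lieBracket (X Y : ∀ n, A.QCoch n) (k : ℕ) (v : Fin k → V) : A.QPoly k :=
  A.toQ k (∑ h : Fin (k + 1),
    (A.box (Nat.sub_add_cancel (Nat.le_of_lt_succ h.isLt)) (A.rep X (h + 1)) (A.rep Y (k - h)) v
      - (-1 : ℤ) ^ ((h : ℕ) * (k - h + 1)) •
        A.box (Nat.sub_add_cancel (Nat.le_of_lt_succ h.isLt))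
          (A.rep Y (h + 1)) (A.rep X (k - h)) v))

/-- The action `[X, Y] = X □^L Y - (-1)^{p(X)p(Y)} Y □^R X` of `X ∈ W^∂(ΠV)` on
`Y ∈ W̃^∂(ΠV)`. -/
def action (X : ∀ n, A.QCoch n) (Y : ∀ n, A.Coch n) (k : ℕ) (v : Fin k → V) :
    MvPolynomial (Fin k) V :=
  ∑ h : Fin (k + 1),
    (A.boxL (Nat.sub_add_cancel (Nat.le_of_lt_succ h.isLt)) (A.rep X (h + 1)) (Y (k - h)) v
      - (-1 : ℤ) ^ ((h : ℕ) * (k - h + 1)) •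
        A.box (Nat.sub_add_cancel (Nat.le_of_lt_succ h.isLt)) (Y (h + 1)) (A.rep X (k - h)) v)

/-! ### Conformal vector fields and their full prolongation -/

/-- The operator `E^i_λ = ∑ₙ (-λ-∂)ⁿ ∂/∂u_i^{(n)} : V → F[λ] ⊗ V`. -/
def euler (i : I) (f : V) : MvPolynomial (Fin 1) V :=
  ∑ n ∈ (A.supp f).image Prod.snd,
    ((-A.totalD 1 : Module.End F (MvPolynomial (Fin 1) V)) ^ n) (C (A.pd i n f))

/-- The conformal vector field `X̃^P_λ(f) = ∑ᵢ Pᵢ(λ+∂) E^i_λ(f)` with characteristic `P`. -/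
def confVF [Fintype I] (P : I → Polynomial V) : A.Coch 1 := fun v =>
  ∑ i, (P i).sum fun m c =>
    C c * ((A.totalD 1 : Module.End F (MvPolynomial (Fin 1) V)) ^ m) (A.euler i (v 0))

/-- The space `CVect(V)` of conformal vector fields. -/
def CVect [Fintype I] : Submodule F (A.Coch 1) where
  carrier := Set.range A.confVF
  add_mem' := by
    rintro _ _ ⟨P, rfl⟩ ⟨Q, rfl⟩
    refine ⟨P + Q, funext fun v => ?_⟩
    simp only [confVF, Pi.add_apply, ← Finset.sum_add_distrib]
    refine Finset.sum_congr rfl fun i _ => ?_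
    exact Polynomial.sum_add_index _ _ _ (fun m => by simp) (fun m a b => by simp [add_mul])
  zero_mem' := ⟨0, funext fun v => by simp [confVF]⟩
  smul_mem' := by
    rintro r _ ⟨P, rfl⟩
    refine ⟨r • P, funext fun v => ?_⟩
    simp only [confVF, Pi.smul_apply, Finset.smul_sum]
    refine Finset.sum_congr rfl fun i _ => ?_
    rw [Polynomial.sum_smul_index' _ _ _ (fun m => by simp), Polynomial.sum, Polynomial.sum,
      Finset.smul_sum]
    refine Finset.sum_congr rfl fun m _ => ?_
    rw [← smul_mul_assoc]; congr 1
    simp only [C_apply, smul_monomial]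

theorem boxLam_add {h m k : ℕ} (e : m + h = k) (X X' : A.Coch (h + 1)) (Y : A.Coch m)
    (v : Fin k → V) : A.boxLam e (X + X') Y v = A.boxLam e X Y v + A.boxLam e X' Y v := by
  simp only [boxLam, shuffleBox, Pi.add_apply, map_add, mul_add, Finset.sum_add_distrib, smul_add]

theorem boxLam_smul {h m k : ℕ} (e : m + h = k) (r : F) (X : A.Coch (h + 1)) (Y : A.Coch m)
    (v : Fin k → V) : A.boxLam e (r • X) Y v = r • A.boxLam e X Y v := by
  have hr : ∀ (g : Fin (h + 1) → Polynomial (MvPolynomial (Option (Fin k)) V))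
      (P : MvPolynomial (Fin (h + 1)) V), aeval g (r • P) = r • aeval g P := fun g P =>
    map_smul ((aeval g).toLinearMap.restrictScalars F) r P
  simp only [boxLam, shuffleBox, Pi.smul_apply, hr, map_smul, mul_smul_comm, Finset.smul_sum]
  simp only [smul_comm r]

/-- The full prolongation of `R₀ ⊆ W̃^∂_0(ΠV)`; the index `n` corresponds to degree `k = n - 1`.
In degree `-1` it is `V`, in degree `0` it is `R₀`, and for `k ≥ 1` it consists of the elements
`X` of `W̃^∂_k(ΠV)` such that, for all `f ∈ V = W̃^∂_{-1}(ΠV)`, all coefficients of the formal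
power series `[X _λ f]` belong to the prolongation in degree `k - 1`. Note that
`[X _λ f] = X □_λ f`, since `f □_λ X = 0` for `f` without arguments. -/
def fullProlongation (R₀ : Submodule F (A.Coch 1)) : (n : ℕ) → Submodule F (A.Coch n)
  | 0 => ⊤
  | 1 => R₀
  | n + 2 =>
    { carrier := {X | X ∈ A.tildeWd (n + 2) ∧ ∀ (f : V) (j : ℕ),
        (fun v => lamCoeff j (A.boxLam (Nat.zero_add (n + 1)) X (fun _ => C f) v))
          ∈ fullProlongation R₀ (n + 1)}
      add_mem' := by
        rintro X Y ⟨hX, h⟩ ⟨hY, h'⟩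
        refine ⟨add_mem hX hY, fun f j => ?_⟩
        convert add_mem (h f j) (h' f j) using 1
        funext v
        simp only [boxLam_add, lamCoeff, map_add, Polynomial.coeff_add, Pi.add_apply]
      zero_mem' := by
        refine ⟨zero_mem _, fun f j => ?_⟩
        convert zero_mem (fullProlongation R₀ (n + 1)) using 1
        funext v
        simp [boxLam, shuffleBox, lamCoeff]
      smul_mem' := by
        rintro r X ⟨hX, h⟩
        refine ⟨Submodule.smul_mem _ r hX, fun f j => ?_⟩
        convert Submodule.smul_mem _ r (h f j) using 1
        funext v
        have hr : ∀ P : MvPolynomial (Option (Fin (n + 1))) V,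
            optionEquivLeft V (Fin (n + 1)) (r • P) = r • optionEquivLeft V (Fin (n + 1)) P :=
          fun P => map_smul
            ((optionEquivLeft V (Fin (n + 1))).toLinearMap.restrictScalars F) r P
        simp only [boxLam_smul, lamCoeff, hr, Polynomial.coeff_smul, Pi.smul_apply] }

/-- The space `W̃^var_{n-1}`, the full prolongation of `CVect(V)` in degree `n - 1`. -/
def TildeWvar [Fintype I] (n : ℕ) : Type _ := ↥(A.fullProlongation A.CVect n)

instance [Fintype I] (n : ℕ) : AddCommGroup (A.TildeWvar n) :=
  inferInstanceAs (AddCommGroup ↥(A.fullProlongation A.CVect n))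

instance [Fintype I] (n : ℕ) : Module F (A.TildeWvar n) :=
  inferInstanceAs (Module F ↥(A.fullProlongation A.CVect n))

/-- The underlying map of an element of `W̃^var_{n-1}`. -/
def TildeWvar.toCoch [Fintype I] {A : DiffFunctionAlgebra F V I} {n : ℕ} (X : A.TildeWvar n) :
    A.Coch n := Subtype.val X

/-- The space `W^var_{n-1}`. -/
def Wvar (n : ℕ) : Type _ := ↥(A.wvarSubmodule n)

instance (n : ℕ) : AddCommGroup (A.Wvar n) :=
  inferInstanceAs (AddCommGroup ↥(A.wvarSubmodule n))

instance (n : ℕ) : Module F (A.Wvar n) :=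
  inferInstanceAs (Module F ↥(A.wvarSubmodule n))

/-- The underlying map of an element of `W^var_{n-1}`. -/
def Wvar.toQCoch {A : DiffFunctionAlgebra F V I} {n : ℕ} (X : A.Wvar n) : A.QCoch n :=
  Subtype.val X

/-- `W̃^var(ΠV) = ⨁_{k ≥ -1} W̃^var_k`. -/
abbrev TildeWvarTotal [Fintype I] : Type _ := ⨁ n, A.TildeWvar n

/-- `W^var(ΠV) = ⨁_{k ≥ -1} W^var_k`. -/
abbrev WvarTotal : Type _ := ⨁ n, A.Wvar n

/-- The components of an element of `W̃^var(ΠV)`. -/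
def coch [Fintype I] (X : A.TildeWvarTotal) (n : ℕ) : A.Coch n := (X n).toCoch

/-- The components of an element of `W^var(ΠV)`. -/
def qcoch (X : A.WvarTotal) (n : ℕ) : A.QCoch n := (X n).toQCoch

end DiffFunctionAlgebra

/-! A field of characteristic 0 is infinite, so a polynomial in the λ's with coefficients in V is
determined by its values at scalars. A family of cochains is therefore recorded as a single function
on lists of pairs (f_i, t_i), where t_i in F is the value of λ_i (`toList`). On such functions the
concatenation product `cat` and the λ-bracket `br s` at λ = s are governed by contraction with the
first argument, which acts as an odd derivation of both, up to a shift of λ in the bracket. The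
identities are proved by induction on the length of the list: the inductive step is bookkeeping of
signs, and the content sits at the empty list.

At the empty list everything is about vector fields. `opEval` makes sense of φ(c - ∂) with ∂ moved
to the left. A sesquilinear map φ with polynomial values is a conformal vector field exactly when,
for every s, the map g ↦ φ(g)(-s - ∂) is an ordinary vector field ∑ w_q ∂/∂u_q (`IsConf.isVect`,
`isConf_of_isVect`). The passage is integration by parts together with the inversion
`opEval_opEval`. Vector fields are derivations and are closed under commutators; this yields the
Leibniz rule, the Jacobi identity and the closure of the bracket (`adj_br`, `br_jacobi_nil`,
`isConf_br`).

The recursively defined full prolongation coincides with the space of admissible functions, those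
that are alternating and conformal in the first argument (`mem_fullProlongation_iff`). The formulas
with sums over shuffles agree with the recursions because the first index either opens the first
block or opens the second one (`sum_blockSum`).

An admissible function is determined by its values on the generators u_i, and every skewsymmetric
array of values extends through the master formula (`Admissible.eq_masterPoly`,
`IsSkew.admissible`). This has two uses. Since I is finite, finitely many tuples of generators bound
the degree of [X_λ Y] in λ (`exists_lbr_apply`). And since skewsymmetric arrays can be lifted by
averaging over permutations, ∫ is onto W^var and its kernel is the image of ∂ (`exists_toQ_eq`,
`exists_totalD_eq`).

Thus W^var is the quotient of W̃^var by ∂, and its Lie bracket, its representation and the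
derivation properties follow formally from the axioms of the odd Poisson vertex algebra at λ = 0
(`OddPVA.exists_reduced`). It remains to see that the box products of arbitrary representatives
compute the same operations (`action_eq`, `lieBracket_eq`). -/

set_option linter.unusedSectionVars false
set_option linter.unusedSimpArgs false

/-! ## Polynomial functions on the ground field with values in an algebra -/

namespace PolyFun

variable (F V : Type*) [Field F] [CommRing V] [Algebra F V]

/-- A polynomial with coefficients in `V` as a function on the ground field `F`. -/
def polyEval : Polynomial V →ₗ[F] (F → V) where
  toFun p t := p.eval (algebraMap F V t)
  map_add' p q := by funext t; simp
  map_smul' r p := by funext t; simp [Polynomial.eval_smul]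

/-- The polynomial functions `F → V`. -/
def polyFun : Submodule F (F → V) := LinearMap.range (polyEval F V)

variable {F V}

theorem polyEval_apply (p : Polynomial V) (t : F) :
    polyEval F V p t = p.eval (algebraMap F V t) := rfl

theorem polyEval_C (v : V) : polyEval F V (Polynomial.C v) = fun _ => v := by
  funext t; simp [polyEval]

theorem polyEval_X_mul (p : Polynomial V) :
    polyEval F V (p * Polynomial.X) = fun t => t • polyEval F V p t := by
  funext t; simp [polyEval, Algebra.smul_def, mul_comm]

theorem polyEval_eq_sum (p : Polynomial V) (t : F) :
    polyEval F V p t = p.sum fun n v => t ^ n • v := by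
  rw [polyEval_apply, Polynomial.eval_eq_sum]
  refine Finset.sum_congr rfl fun n _ => ?_
  simp only [Algebra.smul_def, map_pow, mul_comm]

/-- V need not be a domain, so roots cannot be counted directly. Applying an F-linear functional to
the coefficients reduces to polynomials over the infinite field F. -/
theorem polyEval_injective [Infinite F] : Function.Injective (polyEval F V) := by
  rw [← LinearMap.ker_eq_bot, LinearMap.ker_eq_bot']
  intro p hp
  ext n
  rw [Polynomial.coeff_zero, ← Module.forall_dual_apply_eq_zero_iff F]
  intro φ
  set q : Polynomial F := p.sum fun n v => Polynomial.monomial n (φ v) with hq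
  have hq0 : q = 0 := by
    apply Polynomial.funext
    intro t
    have := congrArg φ (congrFun hp t)
    rw [polyEval_eq_sum] at this
    simp only [hq, Polynomial.sum, Polynomial.eval_finsetSum, Polynomial.eval_monomial,
      Polynomial.eval_zero, map_sum, map_smul, smul_eq_mul, Pi.zero_apply, map_zero] at this ⊢
    rw [← this]
    exact Finset.sum_congr rfl fun _ _ => mul_comm _ _
  have : q.coeff n = φ (p.coeff n) := by
    simp only [hq, Polynomial.sum, Polynomial.finsetSum_coeff, Polynomial.coeff_monomial,
      Finset.sum_ite_eq']
    split_ifs with h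
    · rfl
    · rw [Polynomial.notMem_support_iff.mp h, map_zero]
  rw [← this, hq0, Polynomial.coeff_zero]

theorem const_mem (v : V) : (fun _ => v) ∈ polyFun F V := ⟨_, polyEval_C v⟩

theorem smul_mem' {φ : F → V} (h : φ ∈ polyFun F V) : (fun t => t • φ t) ∈ polyFun F V := by
  obtain ⟨p, rfl⟩ := h
  exact ⟨_, polyEval_X_mul p⟩

theorem add_mem' {φ ψ : F → V} (h : φ ∈ polyFun F V) (h' : ψ ∈ polyFun F V) :
    (fun t => φ t + ψ t) ∈ polyFun F V := add_mem h h'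

theorem neg_mem' {φ : F → V} (h : φ ∈ polyFun F V) :
    (fun t => -φ t) ∈ polyFun F V := neg_mem h

-- Most later identities about `opEval` are checked this way: only the behaviour under
-- multiplication by the variable has content.
@[elab_as_elim]
theorem induction {motive : (φ : F → V) → φ ∈ polyFun F V → Prop}
    (const : ∀ v, motive (fun _ => v) (const_mem v))
    (add : ∀ φ (h : φ ∈ polyFun F V) ψ (h' : ψ ∈ polyFun F V), motive φ h → motive ψ h' →
      motive (fun t => φ t + ψ t) (add_mem' h h'))
    (smul : ∀ φ (h : φ ∈ polyFun F V), motive φ h → motive (fun t => t • φ t) (smul_mem' h))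
    {φ : F → V} (h : φ ∈ polyFun F V) : motive φ h := by
  suffices key : ∀ (p : Polynomial V) (φ : F → V) (h : φ ∈ polyFun F V), φ = polyEval F V p →
      motive φ h by
    obtain ⟨p, hp⟩ := id h
    exact key p φ h hp.symm
  intro p
  induction p using Polynomial.induction_on' with
  | add p q h1 h2 =>
    intro φ h hp
    have e : φ = fun t => polyEval F V p t + polyEval F V q t := by rw [hp, map_add]; rfl
    subst e
    exact add _ ⟨p, rfl⟩ _ ⟨q, rfl⟩ (h1 _ _ rfl) (h2 _ _ rfl)
  | monomial n v =>
    induction n with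
    | zero =>
      intro φ h hp
      rw [Polynomial.monomial_zero_left, polyEval_C] at hp
      subst hp
      exact const v
    | succ n ih =>
      intro φ h hp
      rw [← Polynomial.monomial_mul_X, polyEval_X_mul] at hp
      subst hp
      exact smul _ ⟨_, rfl⟩ (ih _ _ rfl)

theorem sub_mem' {φ ψ : F → V} (h : φ ∈ polyFun F V) (h' : ψ ∈ polyFun F V) :
    (fun t => φ t - ψ t) ∈ polyFun F V := sub_mem h h'

theorem const_smul_mem {φ : F → V} (r : F) (h : φ ∈ polyFun F V) :
    (fun t => r • φ t) ∈ polyFun F V := Submodule.smul_mem _ r h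

theorem linear_mem (T : V →ₗ[F] V) {φ : F → V} (h : φ ∈ polyFun F V) :
    (fun t => T (φ t)) ∈ polyFun F V := by
  induction h using induction with
  | const v => exact const_mem _
  | add φ hφ ψ hψ h1 h2 => simpa only [map_add] using add_mem' h1 h2
  | smul φ hφ h => simpa only [map_smul] using smul_mem' h

theorem shift_mem {φ : F → V} (r : F) (h : φ ∈ polyFun F V) :
    (fun t => φ (t + r)) ∈ polyFun F V := by
  induction h using induction with
  | const v => exact const_mem _
  | add φ hφ ψ hψ h1 h2 => exact add_mem' h1 h2
  | smul φ hφ h =>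
    simpa only [add_smul] using add_mem' (smul_mem' h) (const_smul_mem r h)

theorem mul_mem {φ : F → V} (h : φ ∈ polyFun F V) (v : V) :
    (fun t => φ t * v) ∈ polyFun F V :=
  linear_mem (LinearMap.mulRight F v) h

theorem sum_mem' {ι : Type*} (s : Finset ι) {φ : ι → F → V} (h : ∀ i ∈ s, φ i ∈ polyFun F V) :
    (fun t => ∑ i ∈ s, φ i t) ∈ polyFun F V := by
  have := Submodule.sum_mem _ h
  convert this using 1
  funext t; simp

theorem neg_arg_mem {φ : F → V} (h : φ ∈ polyFun F V) :
    (fun t => φ (-t)) ∈ polyFun F V := by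
  induction h using induction with
  | const v => exact const_mem _
  | add φ hφ ψ hψ h1 h2 => exact add_mem' h1 h2
  | smul φ hφ h =>
    simpa only [neg_smul] using neg_mem' (smul_mem' h)

/-- The coefficients of a polynomial function, extended linearly to all functions. -/
def coeffs [Infinite F] : (F → V) →ₗ[F] Polynomial V :=
  Classical.choose (LinearMap.exists_leftInverse_of_injective (polyEval F V)
    (LinearMap.ker_eq_bot.mpr polyEval_injective))

theorem coeffs_polyEval [Infinite F] (p : Polynomial V) : coeffs (polyEval F V p) = p :=
  LinearMap.congr_fun (Classical.choose_spec
    (LinearMap.exists_leftInverse_of_injective (polyEval F V)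
      (LinearMap.ker_eq_bot.mpr polyEval_injective))) p

/-- `φ(c - ∂)` with `∂` moved to the left, for a polynomial function `φ`. -/
def opEval [Infinite F] (d : V →ₗ[F] V) (c : F) : (F → V) →ₗ[F] V :=
  (Polynomial.lsum fun n => ((c • 1 - d : Module.End F V) ^ n)) ∘ₗ coeffs

section opEval

variable [Infinite F] (d : V →ₗ[F] V)

theorem opEval_polyEval (c : F) (p : Polynomial V) :
    opEval d c (polyEval F V p) = p.sum fun n v => ((c • 1 - d : Module.End F V) ^ n) v := by
  simp [opEval, coeffs_polyEval, Polynomial.lsum_apply]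

theorem opEval_const (c : F) (v : V) : opEval d c (fun _ => v) = v := by
  have := opEval_polyEval d c (Polynomial.C v)
  rwa [polyEval_C, Polynomial.sum_C_index (by simp), pow_zero] at this

theorem opEval_add (c : F) (φ ψ : F → V) :
    opEval d c (fun t => φ t + ψ t) = opEval d c φ + opEval d c ψ := map_add _ _ _

theorem opEval_neg (c : F) (φ : F → V) :
    opEval d c (fun t => -φ t) = -opEval d c φ := map_neg _ _

theorem opEval_sub (c : F) (φ ψ : F → V) :
    opEval d c (fun t => φ t - ψ t) = opEval d c φ - opEval d c ψ := map_sub _ _ _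

theorem opEval_const_smul (c r : F) (φ : F → V) :
    opEval d c (fun t => r • φ t) = r • opEval d c φ := map_smul (opEval d c) r φ

theorem opEval_sum {ι : Type*} (s : Finset ι) (c : F) (φ : ι → F → V) :
    opEval d c (fun t => ∑ i ∈ s, φ i t) = ∑ i ∈ s, opEval d c (φ i) := by
  rw [← map_sum]; congr 1; funext t; simp

theorem opEval_zero (c : F) : opEval d c (fun _ => 0) = 0 := map_zero _

/-- Since ∂ stands to the left of the coefficients, one factor t comes out as the operator c - ∂
applied last. Together with linearity and `opEval_const` this rule determines `opEval` on polynomial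
functions. -/
theorem opEval_smul (c : F) {φ : F → V} (h : φ ∈ polyFun F V) :
    opEval d c (fun t => t • φ t) = c • opEval d c φ - d (opEval d c φ) := by
  obtain ⟨p, rfl⟩ := h
  rw [← polyEval_X_mul]
  induction p using Polynomial.induction_on' with
  | add p q hp hq => rw [add_mul, map_add, map_add, hp, hq, map_add, map_add, map_add, smul_add]; abel
  | monomial n v =>
    rw [Polynomial.monomial_mul_X, opEval_polyEval, opEval_polyEval,
      Polynomial.sum_monomial_index _ _ (by simp), Polynomial.sum_monomial_index _ _ (by simp),
      pow_succ']
    rfl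

theorem opEval_map (c : F) {φ : F → V} (h : φ ∈ polyFun F V) :
    opEval d c (fun t => d (φ t)) = d (opEval d c φ) := by
  induction h using induction with
  | const v => rw [opEval_const, opEval_const]
  | add φ hφ ψ hψ h1 h2 => simp only [map_add, opEval_add, h1, h2]
  | smul φ hφ h => simp only [map_smul, opEval_smul d c hφ, opEval_smul d c (linear_mem d hφ), h,
      map_sub]

theorem opEval_shift (c r : F) {φ : F → V} (h : φ ∈ polyFun F V) :
    opEval d c (fun t => φ (t + r)) = opEval d (c + r) φ := by
  induction h using induction with
  | const v => rw [opEval_const, opEval_const]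
  | add φ hφ ψ hψ h1 h2 => simp only [opEval_add, h1, h2]
  | smul φ hφ h =>
    simp only [add_smul, opEval_add, opEval_smul d _ hφ, opEval_smul d c (shift_mem r hφ), h,
      opEval_const_smul]
    abel

theorem opEval_mem {φ : F → V} (h : φ ∈ polyFun F V) :
    (fun c => opEval d c φ) ∈ polyFun F V := by
  induction h using induction with
  | const v => simpa only [opEval_const] using const_mem v
  | add φ hφ ψ hψ h1 h2 => simpa only [opEval_add] using add_mem' h1 h2
  | smul φ hφ h =>
    simp only [opEval_smul d _ hφ]
    exact sub_mem' (smul_mem' h) (linear_mem d h)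

/-- Replacing t by c - ∂ in φ(r - t - ∂) makes the two ∂'s cancel. With r = 0 this says that λ ↦ -λ
- ∂ is an involution. -/
theorem opEval_opEval (c r : F) {φ : F → V} (h : φ ∈ polyFun F V) :
    opEval d c (fun t => opEval d (r - t) φ) = φ (r - c) := by
  induction h using induction with
  | const v => simp only [opEval_const]
  | add φ hφ ψ hψ h1 h2 => simp only [opEval_add, h1, h2]
  | smul φ hφ h =>
    have h3 : (fun t => opEval d (r - t) φ) ∈ polyFun F V := by
      have := neg_arg_mem (shift_mem r (opEval_mem d hφ))
      simpa only [neg_add_eq_sub] using this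
    simp only [opEval_smul d _ hφ, opEval_sub, sub_smul, opEval_const_smul, opEval_smul d _ h3,
      opEval_map d _ h3, h]
    abel

end opEval

end PolyFun

namespace DiffFunctionAlgebra

open PolyFun

variable {F V I : Type*} [Field F] [CommRing V] [Algebra F V] (A : DiffFunctionAlgebra F V I)

/-! ## Vector fields on `V` -/

/-- `∂` as a linear map. -/
abbrev dl : V →ₗ[F] V := A.d

/-- The variable `u_i^{(n)}`. -/
def uvar (q : I × ℕ) : V := A.d^[q.2] (A.u q.1)

theorem uvar_zero (i : I) : A.uvar (i, 0) = A.u i := rfl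

theorem uvar_succ (i : I) (n : ℕ) : A.uvar (i, n + 1) = A.d (A.uvar (i, n)) :=
  Function.iterate_succ_apply' _ _ _

theorem mem_supp {f : V} {q : I × ℕ} : q ∈ A.supp f ↔ A.pd q.1 q.2 f ≠ 0 := by
  simp [supp]

theorem pd_eq_zero {f : V} {q : I × ℕ} (h : q ∉ A.supp f) : A.pd q.1 q.2 f = 0 := by
  rwa [mem_supp, not_not] at h

/-- The vector field `∑ w_q ∂/∂u_q`. -/
def vf (w : I × ℕ → V) (g : V) : V := ∑ q ∈ A.supp g, A.pd q.1 q.2 g * w q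

theorem vf_eq_sum (w : I × ℕ → V) (g : V) {S : Finset (I × ℕ)} (h : A.supp g ⊆ S) :
    A.vf w g = ∑ q ∈ S, A.pd q.1 q.2 g * w q :=
  Finset.sum_subset h fun q _ hq => by rw [A.pd_eq_zero hq, zero_mul]

theorem vf_add (w : I × ℕ → V) (g h : V) : A.vf w (g + h) = A.vf w g + A.vf w h := by
  classical
  rw [A.vf_eq_sum w (g + h) (Finset.subset_union_right (s₁ := A.supp g ∪ A.supp h)),
    A.vf_eq_sum w g (S := (A.supp g ∪ A.supp h) ∪ A.supp (g + h)) (by grind),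
    A.vf_eq_sum w h (S := (A.supp g ∪ A.supp h) ∪ A.supp (g + h)) (by grind),
    ← Finset.sum_add_distrib]
  simp only [map_add, add_mul]

theorem vf_mul (w : I × ℕ → V) (g h : V) : A.vf w (g * h) = A.vf w g * h + g * A.vf w h := by
  classical
  rw [A.vf_eq_sum w (g * h) (Finset.subset_union_right (s₁ := A.supp g ∪ A.supp h)),
    A.vf_eq_sum w g (S := (A.supp g ∪ A.supp h) ∪ A.supp (g * h)) (by grind),
    A.vf_eq_sum w h (S := (A.supp g ∪ A.supp h) ∪ A.supp (g * h)) (by grind),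
    Finset.sum_mul, Finset.mul_sum, ← Finset.sum_add_distrib]
  refine Finset.sum_congr rfl fun q _ => ?_
  rw [Derivation.leibniz, smul_eq_mul, smul_eq_mul]
  ring

theorem vf_smul (w : I × ℕ → V) (r : F) (g : V) : A.vf w (r • g) = r • A.vf w g := by
  classical
  rw [A.vf_eq_sum w (r • g) (Finset.subset_union_right (s₁ := A.supp g)),
    A.vf_eq_sum w g (S := A.supp g ∪ A.supp (r • g)) (by grind), Finset.smul_sum]
  simp only [Derivation.map_smul, smul_mul_assoc]

theorem vf_uvar (w : I × ℕ → V) (q : I × ℕ) : A.vf w (A.uvar q) = w q := by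
  classical
  rw [A.vf_eq_sum w _ (Finset.subset_union_left (s₂ := {q})), Finset.sum_eq_single q]
  · rw [uvar, A.pd_u_self, one_mul]
  · rintro p _ hp
    rw [uvar, A.pd_u_ne _ _ _ _ hp, zero_mul]
  · intro h; simp at h

/-- `δ` is a vector field `∑ w_q ∂/∂u_q`, where necessarily `w_q = δ(u_q)`. -/
def IsVect (δ : V → V) : Prop := ∀ g, δ g = A.vf (fun q => δ (A.uvar q)) g

theorem isVect_vf (w : I × ℕ → V) : A.IsVect (A.vf w) := fun g => by
  simp only [vf_uvar]

variable {A}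

theorem IsVect.map_add {δ : V → V} (h : A.IsVect δ) (f g : V) : δ (f + g) = δ f + δ g := by
  rw [h (f + g), vf_add, ← h, ← h]

theorem IsVect.map_mul {δ : V → V} (h : A.IsVect δ) (f g : V) : δ (f * g) = δ f * g + f * δ g := by
  rw [h (f * g), vf_mul, ← h, ← h]

theorem IsVect.map_smul {δ : V → V} (h : A.IsVect δ) (r : F) (g : V) : δ (r • g) = r • δ g := by
  rw [h (r • g), vf_smul, ← h]

theorem IsVect.map_zero {δ : V → V} (h : A.IsVect δ) : δ 0 = 0 := by
  have := h.map_smul 0 0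
  rwa [zero_smul, zero_smul] at this

theorem IsVect.map_sum {δ : V → V} (h : A.IsVect δ) {ι : Type*} (s : Finset ι) (f : ι → V) :
    δ (∑ i ∈ s, f i) = ∑ i ∈ s, δ (f i) := by
  classical
  induction s using Finset.induction_on with
  | empty => simp [h.map_zero]
  | insert a s ha ih => rw [Finset.sum_insert ha, Finset.sum_insert ha, h.map_add, ih]

theorem IsVect.add {δ δ' : V → V} (h : A.IsVect δ) (h' : A.IsVect δ') :
    A.IsVect fun g => δ g + δ' g := fun g => by
  beta_reduce
  rw [h g, h' g]
  simp only [vf, mul_add, Finset.sum_add_distrib]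

theorem IsVect.const_smul {δ : V → V} (h : A.IsVect δ) (r : F) :
    A.IsVect fun g => r • δ g := fun g => by
  beta_reduce
  rw [h g]
  simp only [vf, mul_smul_comm, Finset.smul_sum]

theorem IsVect.neg {δ : V → V} (h : A.IsVect δ) : A.IsVect fun g => -δ g := by
  simpa using h.const_smul (-1)

/-- The second-order part is isolated because it is symmetric in the two fields, the partial
derivatives commuting, and so it drops out of the commutator. -/
theorem IsVect.comp_eq {δ δ' : V → V} (h : A.IsVect δ) (h' : A.IsVect δ') (g : V) :
    δ (δ' g) = (∑ q ∈ A.supp g, ∑ p ∈ A.supp g,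
      A.pd p.1 p.2 (A.pd q.1 q.2 g) * δ (A.uvar p) * δ' (A.uvar q))
      + A.vf (fun q => δ (δ' (A.uvar q))) g := by
  conv_lhs => rw [h' g]
  rw [vf, h.map_sum, vf, ← Finset.sum_add_distrib]
  refine Finset.sum_congr rfl fun q _ => ?_
  rw [h.map_mul, ← Finset.sum_mul, h (A.pd q.1 q.2 g), A.vf_eq_sum _ _ (S := A.supp g)]
  -- A partial derivative of g involves no variable that g does not involve, again because partial
  -- derivatives commute.
  intro p hp
  rw [mem_supp, A.pd_comm] at hp
  rw [mem_supp]
  intro h0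
  rw [h0, _root_.map_zero] at hp
  exact hp rfl

/-- The commutator of vector fields is a vector field. -/
theorem IsVect.commutator {δ δ' : V → V} (h : A.IsVect δ) (h' : A.IsVect δ') :
    A.IsVect fun g => δ (δ' g) - δ' (δ g) := fun g => by
  beta_reduce
  rw [h.comp_eq h', h'.comp_eq h, Finset.sum_comm]
  have : ∀ p q : I × ℕ, A.pd p.1 p.2 (A.pd q.1 q.2 g) * δ (A.uvar p) * δ' (A.uvar q)
      = A.pd q.1 q.2 (A.pd p.1 p.2 g) * δ' (A.uvar q) * δ (A.uvar p) := fun p q => by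
    rw [A.pd_comm]; ring
  simp only [this, add_sub_add_left_eq_sub, vf, mul_sub, Finset.sum_sub_distrib]

variable (A)

/-! ## Conformal vector fields on scalars -/

/-- The operator `t + ∂`. -/
def opd (t : F) : Module.End F V := t • 1 + A.dl

theorem opd_apply (t : F) (v : V) : A.opd t v = t • v + A.d v := rfl

theorem opd_mem {φ : F → V} (h : φ ∈ polyFun F V) : (fun t => A.opd t (φ t)) ∈ polyFun F V := by
  simp only [opd_apply]
  exact add_mem' (smul_mem' h) (linear_mem A.dl h)

theorem opd_pow_mem {φ : F → V} (h : φ ∈ polyFun F V) (n : ℕ) :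
    (fun t => (A.opd t ^ n) (φ t)) ∈ polyFun F V := by
  induction n with
  | zero => simpa using h
  | succ n ih =>
    simp only [pow_succ', Module.End.mul_apply]
    exact A.opd_mem ih

theorem neg_opd_pow (t : F) (n : ℕ) (v : V) :
    ((-A.opd t) ^ n) v = (-1 : F) ^ n • (A.opd t ^ n) v := by
  have : -A.opd t = (-1 : F) • A.opd t := (neg_one_smul F _).symm
  rw [this, smul_pow, LinearMap.smul_apply]

/-- `E^i_t(g) = ∑ₙ (-t-∂)ⁿ ∂g/∂u_i^{(n)}` -/
def eulerAt (i : I) (t : F) (g : V) : V :=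
  ∑ n ∈ (A.supp g).image Prod.snd, ((-A.opd t) ^ n) (A.pd i n g)

theorem eulerAt_eq_sum (i : I) (t : F) (g : V) {S : Finset ℕ}
    (h : (A.supp g).image Prod.snd ⊆ S) :
    A.eulerAt i t g = ∑ n ∈ S, ((-A.opd t) ^ n) (A.pd i n g) :=
  Finset.sum_subset h fun n _ hn => by
    rw [A.pd_eq_zero (q := (i, n)), map_zero]
    exact fun h => hn (Finset.mem_image_of_mem Prod.snd h)

theorem exists_eulerAt_eq (g : V) : ∃ N, ∀ M, N ≤ M → ∀ i t,
    A.eulerAt i t g = ∑ n ∈ Finset.range M, ((-A.opd t) ^ n) (A.pd i n g) := by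
  obtain ⟨N, hN⟩ := ((A.supp g).image Prod.snd).exists_nat_subset_range
  refine ⟨N, fun M hM i t => A.eulerAt_eq_sum i t g (hN.trans ?_)⟩
  exact Finset.range_subset_range.mpr hM

theorem eulerAt_add (i : I) (t : F) (g h : V) :
    A.eulerAt i t (g + h) = A.eulerAt i t g + A.eulerAt i t h := by
  obtain ⟨N, hN⟩ := A.exists_eulerAt_eq g
  obtain ⟨N', hN'⟩ := A.exists_eulerAt_eq h
  obtain ⟨N'', hN''⟩ := A.exists_eulerAt_eq (g + h)
  rw [hN (N + N' + N'') (by omega), hN' (N + N' + N'') (by omega), hN'' (N + N' + N'') (by omega)]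
  simp only [map_add, Finset.sum_add_distrib]

theorem eulerAt_smul (i : I) (t r : F) (g : V) :
    A.eulerAt i t (r • g) = r • A.eulerAt i t g := by
  obtain ⟨N, hN⟩ := A.exists_eulerAt_eq g
  obtain ⟨N'', hN''⟩ := A.exists_eulerAt_eq (r • g)
  rw [hN (N + N'') (by omega), hN'' (N + N'') (by omega)]
  simp only [Derivation.map_smul, LinearMap.map_smul, Finset.smul_sum]

/-- The relation [∂/∂u^(n+1), ∂] = ∂/∂u^(n) shifts the index by one, and the shifted sum combines
with the term containing ∂ into the common factor -t. -/
theorem eulerAt_d (i : I) (t : F) (g : V) :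
    A.eulerAt i t (A.d g) = -(t • A.eulerAt i t g) := by
  obtain ⟨N, hN⟩ := A.exists_eulerAt_eq g
  obtain ⟨N', hN'⟩ := A.exists_eulerAt_eq (A.d g)
  have hM := hN (N + N' + 1) (by omega) i t
  have hM0 := hN (N + N') (by omega) i t
  rw [hM0, Finset.sum_range_succ] at hM
  -- Both truncations compute the same sum, so the last term of the longer one vanishes. This
  -- absorbs the off-by-one in the index shift below.
  have h0 : ((-A.opd t) ^ (N + N')) (A.pd i (N + N') g) = 0 := by
    rwa [left_eq_add] at hM
  rw [hN' (N + N' + 1) (by omega), hN (N + N' + 1) (by omega), Finset.sum_range_succ']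
  simp only [A.pd_d_succ, A.pd_d_zero, map_add, Finset.sum_add_distrib]
  have e1 : ∑ n ∈ Finset.range (N + N'), ((-A.opd t) ^ (n + 1)) (A.pd i n g)
      = ∑ n ∈ Finset.range (N + N' + 1), ((-A.opd t) ^ (n + 1)) (A.pd i n g) := by
    rw [Finset.sum_range_succ, pow_succ', Module.End.mul_apply, h0, map_zero, add_zero]
  have e2 := Finset.sum_range_succ' (fun n => ((-A.opd t) ^ n) (A.d (A.pd i n g))) (N + N')
  rw [add_right_comm, ← e2, e1, ← Finset.sum_add_distrib, Finset.smul_sum,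
    ← Finset.sum_neg_distrib]
  refine Finset.sum_congr rfl fun n _ => ?_
  rw [pow_succ, Module.End.mul_apply, ← map_add, ← map_smul, ← map_neg]
  congr 1
  rw [LinearMap.neg_apply, opd_apply]; abel

theorem eulerAt_u [DecidableEq I] (i j : I) (t : F) :
    A.eulerAt i t (A.u j) = if i = j then 1 else 0 := by
  obtain ⟨N, hN⟩ := A.exists_eulerAt_eq (A.u j)
  rw [hN (N + 1) (by omega), Finset.sum_range_succ', Finset.sum_eq_zero, zero_add, pow_zero,
    Module.End.one_apply]
  · split_ifs with h
    · subst h; exact A.pd_u_self i 0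
    · exact A.pd_u_ne j 0 i 0 fun e => h (Prod.ext_iff.mp e).1
  · intro n _
    have := A.pd_u_ne j 0 i (n + 1) fun e => by simpa using (Prod.ext_iff.mp e).2
    rw [Function.iterate_zero, id] at this
    rw [this, map_zero]

/-- The differential operator with symbol `P`: `∑ P_m Tᵐ h`. -/
def diffOp (P : Polynomial V) (T : Module.End F V) (h : V) : V := P.sum fun m c => c * (T ^ m) h

variable {A}

theorem diffOp_add_left (P Q : Polynomial V) (T : Module.End F V) (h : V) :
    diffOp (P + Q) T h = diffOp P T h + diffOp Q T h :=
  Polynomial.sum_add_index _ _ _ (fun m => by simp) fun m a b => by simp [add_mul]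

theorem diffOp_C (v : V) (T : Module.End F V) (h : V) :
    diffOp (Polynomial.C v) T h = v * h := by
  rw [diffOp, Polynomial.sum_C_index (by simp)]; simp

theorem diffOp_monomial (n : ℕ) (v : V) (T : Module.End F V) (h : V) :
    diffOp (Polynomial.monomial n v) T h = v * (T ^ n) h :=
  Polynomial.sum_monomial_index _ _ (by simp)

theorem diffOp_mul_X (P : Polynomial V) (T : Module.End F V) (h : V) :
    diffOp (P * Polynomial.X) T h = diffOp P T (T h) := by
  induction P using Polynomial.induction_on' with
  | add p q hp hq => rw [add_mul, diffOp_add_left, hp, hq, diffOp_add_left]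
  | monomial n v =>
    rw [Polynomial.monomial_mul_X, diffOp_monomial, diffOp_monomial, pow_succ,
      Module.End.mul_apply]

theorem diffOp_C_mul (v : V) (P : Polynomial V) (T : Module.End F V) (h : V) :
    diffOp (Polynomial.C v * P) T h = v * diffOp P T h := by
  induction P using Polynomial.induction_on' with
  | add p q hp hq => rw [mul_add, diffOp_add_left, hp, hq, diffOp_add_left, mul_add]
  | monomial n c =>
    rw [Polynomial.C_mul_monomial, diffOp_monomial, diffOp_monomial, mul_assoc]

theorem diffOp_neg_left (P : Polynomial V) (T : Module.End F V) (h : V) :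
    diffOp (-P) T h = -diffOp P T h := by
  have := diffOp_C_mul (-1) P T h
  simpa using this

theorem diffOp_add_right (P : Polynomial V) (T : Module.End F V) (g h : V) :
    diffOp P T (g + h) = diffOp P T g + diffOp P T h := by
  simp [diffOp, Polynomial.sum, mul_add, Finset.sum_add_distrib]

theorem diffOp_smul_right (P : Polynomial V) (T : Module.End F V) (r : F) (h : V) :
    diffOp P T (r • h) = r • diffOp P T h := by
  simp [diffOp, Polynomial.sum, Finset.smul_sum]

theorem diffOp_smul_left (r : F) (P : Polynomial V) (T : Module.End F V) (h : V) :
    diffOp (r • P) T h = r • diffOp P T h := by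
  have := diffOp_C_mul (algebraMap F V r) P T h
  rwa [← Algebra.smul_def, ← Polynomial.smul_eq_C_mul, algebraMap_smul] at this

theorem diffOp_zero_left (T : Module.End F V) (h : V) : diffOp 0 T h = 0 := by
  simp [diffOp]

theorem diffOp_zero_right (P : Polynomial V) (T : Module.End F V) : diffOp P T 0 = 0 := by
  simp [diffOp, Polynomial.sum]

theorem diffOp_sum_right {ι : Type*} (P : Polynomial V) (T : Module.End F V) (s : Finset ι)
    (h : ι → V) : diffOp P T (∑ i ∈ s, h i) = ∑ i ∈ s, diffOp P T (h i) :=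
  map_sum (⟨⟨diffOp P T, diffOp_zero_right P T⟩, diffOp_add_right P T⟩ : V →+ V) h s

theorem diffOp_mem (P : Polynomial V) {φ : F → V} (h : φ ∈ polyFun F V) :
    (fun t => diffOp P (A.opd t) (φ t)) ∈ polyFun F V := by
  induction P using Polynomial.induction_on' generalizing φ with
  | add p q hp hq => simp only [diffOp_add_left]; exact add_mem' (hp h) (hq h)
  | monomial n v =>
    simp only [diffOp_monomial, mul_comm v]
    exact mul_mem (A.opd_pow_mem h n) v

variable (A)

/-- The value at `λ = t` of the conformal vector field with characteristic `P`. -/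
def confAt [Fintype I] (P : I → Polynomial V) (g : V) (t : F) : V :=
  ∑ i, diffOp (P i) (A.opd t) (A.eulerAt i t g)

/-- The functions on `V × F` arising from conformal vector fields. -/
def IsConf [Fintype I] (φ : V → F → V) : Prop := ∃ P, ∀ g t, φ g t = A.confAt P g t

section transform

variable [Infinite F]

/-- Integration by parts. Under s ↦ c - ∂ the operator s + ∂ applied to the whole product h ψ(s)
becomes the scalar c, so moving it from ψ to h leaves c h - ∂h. -/
theorem opEval_mul_opd (c : F) (h : V) {ψ : F → V} (hψ : ψ ∈ polyFun F V) :
    opEval A.dl c (fun s => h * A.opd s (ψ s)) =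
      opEval A.dl c (fun s => (-A.opd (-c)) h * ψ s) := by
  have e : ∀ s, h * A.opd s (ψ s) = s • (h * ψ s) + A.dl (h * ψ s) - A.d h * ψ s := fun s => by
    rw [opd_apply, mul_add, mul_smul_comm]
    have : A.dl (h * ψ s) = h * A.d (ψ s) + ψ s * A.d h := A.d.leibniz _ _
    rw [this]; ring
  have hm : ∀ v, (fun s => v * ψ s) ∈ polyFun F V := fun v => by
    simpa only [mul_comm] using mul_mem hψ v
  have e2 : ∀ s, (-A.opd (-c)) h * ψ s = c • (h * ψ s) - A.d h * ψ s := fun s => by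
    rw [LinearMap.neg_apply, opd_apply, neg_smul, neg_add, neg_neg, add_mul, smul_mul_assoc]; ring
  simp only [e, e2, opEval_sub, opEval_add, opEval_smul A.dl c (hm h), opEval_map A.dl c (hm h),
    opEval_const_smul]
  abel

theorem opEval_mul_opd_pow (c : F) (n : ℕ) (h : V) {ψ : F → V} (hψ : ψ ∈ polyFun F V) :
    opEval A.dl c (fun s => h * (A.opd s ^ n) (ψ s)) =
      opEval A.dl c (fun s => ((-A.opd (-c)) ^ n) h * ψ s) := by
  induction n generalizing h with
  | zero => simp
  | succ n ih =>
    simp only [pow_succ' (A.opd _), Module.End.mul_apply]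
    rw [A.opEval_mul_opd c h (A.opd_pow_mem hψ n), ih]
    simp only [pow_succ, Module.End.mul_apply]

/-- Expanding (-t - ∂)^n (h v) by the Leibniz rule leaves powers of t + ∂ on h with coefficients
that are derivatives of v. This produces the characteristic of a conformal vector field from its
transform. -/
theorem exists_diffOp_eq {ψ : F → V} (hψ : ψ ∈ polyFun F V) :
    ∃ P : Polynomial V, ∀ h t, opEval A.dl (-t) (fun s => h * ψ s) = diffOp P (A.opd t) h := by
  -- Multiplication by s also differentiates ψ, so the induction has to treat all derivatives of ψ
  -- at once.
  suffices H : ∀ k, ∃ P : Polynomial V, ∀ h t,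
      opEval A.dl (-t) (fun s => h * (A.dl ^ k) (ψ s)) = diffOp P (A.opd t) h by
    simpa using H 0
  induction hψ using induction with
  | const v =>
    exact fun k => ⟨Polynomial.C ((A.dl ^ k) v), fun h t => by
      rw [opEval_const, diffOp_C, mul_comm]⟩
  | add φ hφ ψ hψ h1 h2 =>
    intro k
    obtain ⟨P, hP⟩ := h1 k
    obtain ⟨Q, hQ⟩ := h2 k
    exact ⟨P + Q, fun h t => by
      simp only [map_add, mul_add, opEval_add, hP, hQ, diffOp_add_left]⟩
  | smul ψ hψ ih =>
    intro k
    obtain ⟨P, hP⟩ := ih k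
    obtain ⟨Q, hQ⟩ := ih (k + 1)
    refine ⟨-(P * Polynomial.X + Q), fun h t => ?_⟩
    have h1 := A.opEval_mul_opd (-t) h (linear_mem (A.dl ^ k) hψ)
    have h2 := hQ h t
    simp only [pow_succ', Module.End.mul_apply] at h2
    simp only [opd_apply, mul_add, opEval_add, neg_neg, hP] at h1
    change _ + opEval A.dl (-t) (fun s => h * A.dl ((A.dl ^ k) (ψ s))) = _ at h1
    rw [h2, ← eq_sub_iff_add_eq] at h1
    simp only [map_smul, h1, diffOp_neg_left, diffOp_add_left, diffOp_mul_X]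
    have h3 : -(t • h) - A.d h = -(A.opd t h) := by rw [opd_apply]; abel
    rw [LinearMap.neg_apply, ← neg_one_smul F (A.opd t h), diffOp_smul_right, neg_one_smul]
    abel

end transform

variable {A}

theorem eulerAt_mem (i : I) (g : V) : (fun t => A.eulerAt i t g) ∈ polyFun F V := by
  refine sum_mem' _ fun n _ => ?_
  simp only [neg_opd_pow]
  exact const_smul_mem _ (A.opd_pow_mem (const_mem _) n)

variable [Fintype I] {φ ψ : V → F → V}

theorem IsConf.map_add (h : A.IsConf φ) (f g : V) (t : F) : φ (f + g) t = φ f t + φ g t := by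
  obtain ⟨P, h⟩ := h
  simp only [h, confAt, eulerAt_add, diffOp_add_right, Finset.sum_add_distrib]

theorem IsConf.map_smul (h : A.IsConf φ) (r : F) (g : V) (t : F) : φ (r • g) t = r • φ g t := by
  obtain ⟨P, h⟩ := h
  simp only [h, confAt, eulerAt_smul, diffOp_smul_right, Finset.smul_sum]

theorem IsConf.map_d (h : A.IsConf φ) (g : V) (t : F) : φ (A.d g) t = -(t • φ g t) := by
  obtain ⟨P, h⟩ := h
  simp only [h, confAt, eulerAt_d, Finset.smul_sum, ← Finset.sum_neg_distrib, ← neg_smul,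
    diffOp_smul_right]

theorem IsConf.mem (h : A.IsConf φ) (g : V) : φ g ∈ polyFun F V := by
  obtain ⟨P, h⟩ := h
  have : φ g = fun t => ∑ i, diffOp (P i) (A.opd t) (A.eulerAt i t g) := funext fun t => h g t
  rw [this]
  exact sum_mem' _ fun i _ => diffOp_mem _ (eulerAt_mem i g)

theorem IsConf.zero : A.IsConf fun _ _ => 0 := ⟨0, fun g t => by simp [confAt, diffOp_zero_left]⟩

theorem IsConf.add (h : A.IsConf φ) (h' : A.IsConf ψ) : A.IsConf fun g t => φ g t + ψ g t := by
  obtain ⟨P, h⟩ := h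
  obtain ⟨Q, h'⟩ := h'
  exact ⟨P + Q, fun g t => by
    simp only [h, h', confAt, Pi.add_apply, diffOp_add_left, Finset.sum_add_distrib]⟩

theorem IsConf.const_smul (r : F) (h : A.IsConf φ) : A.IsConf fun g t => r • φ g t := by
  obtain ⟨P, h⟩ := h
  exact ⟨r • P, fun g t => by
    simp only [h, confAt, Pi.smul_apply, diffOp_smul_left, Finset.smul_sum]⟩

theorem IsConf.neg (h : A.IsConf φ) : A.IsConf fun g t => -φ g t := by
  simpa using h.const_smul (-1)

theorem IsConf.mul_left (v : V) (h : A.IsConf φ) : A.IsConf fun g t => v * φ g t := by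
  obtain ⟨P, h⟩ := h
  exact ⟨fun i => Polynomial.C v * P i, fun g t => by
    simp only [h, confAt, diffOp_C_mul, Finset.mul_sum]⟩

/-- This keeps λ_0 + ⋯ + λ_k + ∂ within conformal vector fields in the first argument; r is the sum
of the remaining variables. -/
theorem IsConf.opd (h : A.IsConf φ) (r : F) :
    A.IsConf fun g t => A.opd (t + r) (φ g t) := by
  obtain ⟨P, h⟩ := h
  have key : ∀ P : Polynomial V, ∃ Q : Polynomial V, ∀ t h,
      A.opd (t + r) (diffOp P (A.opd t) h) = diffOp Q (A.opd t) h := by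
    intro P
    induction P using Polynomial.induction_on' with
    | add p q hp hq =>
      obtain ⟨P, hP⟩ := hp
      obtain ⟨Q, hQ⟩ := hq
      exact ⟨P + Q, fun t h => by simp only [diffOp_add_left, _root_.map_add, hP, hQ]⟩
    | monomial n v =>
      refine ⟨Polynomial.monomial n (r • v + A.d v) + Polynomial.monomial (n + 1) v,
        fun t h => ?_⟩
      simp only [diffOp_add_left, diffOp_monomial, pow_succ', Module.End.mul_apply,
        opd_apply, Derivation.leibniz, smul_eq_mul, add_smul, add_mul, mul_add, smul_mul_assoc,
        mul_smul_comm]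
      ring
  choose Q hQ using key
  exact ⟨fun i => Q (P i), fun g t => by
    simp only [h, confAt, _root_.map_sum, hQ]⟩

variable [Infinite F]

/-- Under t ↦ -s - ∂ integration by parts moves every power of t + ∂ off ∂g/∂u_i^(n), which is then
merely multiplied by a coefficient independent of g. -/
theorem IsConf.isVect (h : A.IsConf φ) (s : F) :
    A.IsVect fun g => opEval A.dl (-s) (φ g) := by
  classical
  obtain ⟨P, h⟩ := h
  have key : ∀ (P : Polynomial V) (n : ℕ) (h : V), opEval A.dl (-s) (fun t =>
      diffOp P (A.opd t) (((-A.opd t) ^ n) h)) =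
      h * (-1 : F) ^ n • P.sum fun m c => ((-A.opd s) ^ (m + n)) c := by
    intro P n h
    simp only [neg_opd_pow A _ n, diffOp_smul_right, opEval_const_smul, mul_smul_comm]
    congr 1
    simp only [diffOp, Polynomial.sum, opEval_sum, ← Module.End.mul_apply, ← pow_add,
      Finset.mul_sum]
    refine Finset.sum_congr rfl fun m _ => ?_
    rw [A.opEval_mul_opd_pow _ _ _ (const_mem h), neg_neg, opEval_const, mul_comm]
  have hw : (fun g => opEval A.dl (-s) (φ g)) = A.vf fun q => (-1 : F) ^ q.2 •
      (P q.1).sum fun m c => ((-A.opd s) ^ (m + q.2)) c := by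
    funext g
    have : φ g = fun t => ∑ i, diffOp (P i) (A.opd t) (A.eulerAt i t g) := funext fun t => h g t
    rw [this]
    simp only [eulerAt, opEval_sum, diffOp_sum_right, key]
    rw [← Finset.sum_product', A.vf_eq_sum (S := Finset.univ ×ˢ (A.supp g).image Prod.snd)]
    intro q hq
    simp only [Finset.mem_product, Finset.mem_univ, true_and]
    exact Finset.mem_image_of_mem _ hq
  rw [hw]
  exact A.isVect_vf _

/-- The transform is a vector field whose coefficients are fixed by those at u_i through
sesquilinearity. Transforming back, integration by parts returns the powers of t + ∂ to ∂g/∂u_i^(n)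
and rebuilds the Euler operators. -/
theorem isConf_of_isVect (h1 : ∀ g, φ g ∈ polyFun F V) (h2 : ∀ g t, φ (A.d g) t = -(t • φ g t))
    (h3 : ∀ s, A.IsVect fun g => opEval A.dl (-s) (φ g)) : A.IsConf φ := by
  classical
  have hq : ∀ i, (fun s => opEval A.dl (-s) (φ (A.u i))) ∈ polyFun F V := fun i =>
    neg_arg_mem (opEval_mem A.dl (h1 _))
  choose P hP using fun i => A.exists_diffOp_eq (hq i)
  -- Sesquilinearity becomes δ_s ∘ ∂ = (s + ∂) ∘ δ_s for the transformed fields δ_s.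
  have hu : ∀ i n s, opEval A.dl (-s) (φ (A.uvar (i, n)))
      = (A.opd s ^ n) (opEval A.dl (-s) (φ (A.u i))) := by
    intro i n s
    induction n with
    | zero => simp [uvar_zero]
    | succ n ih =>
      have : φ (A.uvar (i, n + 1)) = fun t => -(t • φ (A.uvar (i, n)) t) := by
        funext t; rw [uvar_succ, h2]
      rw [this, opEval_neg, opEval_smul _ _ (h1 _), ih, pow_succ', Module.End.mul_apply, opd_apply,
        neg_smul]
      change -(-_ - A.d _) = _
      abel
  refine ⟨P, fun g t => ?_⟩
  -- The transform s ↦ -s - ∂ is an involution, so φ is recovered from its transform.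
  have e1 := opEval_opEval A.dl (-t) 0 (h1 g)
  simp only [zero_sub, neg_neg] at e1
  rw [← e1]
  have e2 : (fun s => opEval A.dl (-s) (φ g)) = fun s => ∑ q ∈ A.supp g,
      A.pd q.1 q.2 g * (A.opd s ^ q.2) (opEval A.dl (-s) (φ (A.u q.1))) := by
    funext s
    have := h3 s g
    beta_reduce at this
    rw [this, vf]
    exact Finset.sum_congr rfl fun q _ => by rw [← hu q.1 q.2]
  rw [e2, opEval_sum, confAt]
  simp only [eulerAt, diffOp_sum_right]
  rw [← Finset.sum_product']
  have e3 : ∀ q : I × ℕ, opEval A.dl (-t) (fun s => A.pd q.1 q.2 g *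
      (A.opd s ^ q.2) (opEval A.dl (-s) (φ (A.u q.1))))
      = diffOp (P q.1) (A.opd t) (((-A.opd t) ^ q.2) (A.pd q.1 q.2 g)) := fun q => by
    rw [A.opEval_mul_opd_pow _ _ _ (hq q.1), hP, neg_neg]
  simp only [e3]
  refine Finset.sum_subset (fun q hq => ?_) fun q _ hq => ?_
  · simp only [Finset.mem_product, Finset.mem_univ, true_and]
    exact Finset.mem_image_of_mem _ hq
  · rw [A.pd_eq_zero hq, _root_.map_zero, diffOp_zero_right]

end DiffFunctionAlgebra

namespace DiffFunctionAlgebra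

open PolyFun MvPolynomial

variable {F V I : Type*} [Field F] [CommRing V] [Algebra F V]

/-! ## Families of cochains as functions on lists

A list `(f_0, t_0), …, (f_k, t_k)` stands for the arguments `f_i` and the values `t_i ∈ F` of the
variables `λ_i`. -/

/-- Contraction with the first argument. -/
def contr (a : V × F) (X : List (V × F) → V) : List (V × F) → V := fun l => X (a :: l)

/-- The sign operator of the number of arguments. -/
def sgn (X : List (V × F) → V) : List (V × F) → V := fun l => (-1 : F) ^ l.length • X l

/-- The sum of the values of the variables. -/
def lamSum (l : List (V × F)) : F := (l.map Prod.snd).sum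

theorem lamSum_nil : lamSum ([] : List (V × F)) = 0 := rfl

theorem lamSum_cons (a : V × F) (l : List (V × F)) : lamSum (a :: l) = a.2 + lamSum l := rfl

theorem contr_apply (a : V × F) (X : List (V × F) → V) (l : List (V × F)) :
    contr a X l = X (a :: l) := rfl

theorem sgn_nil (X : List (V × F) → V) : sgn X [] = X [] := by simp [sgn]

theorem sgn_singleton (X : List (V × F) → V) (a : V × F) : sgn X [a] = -X [a] := by simp [sgn]

theorem contr_sgn (a : V × F) (X : List (V × F) → V) : contr a (sgn X) = -sgn (contr a X) := by
  funext l; simp [contr, sgn, pow_succ]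

theorem contr_add (a : V × F) (X Y : List (V × F) → V) :
    contr a (X + Y) = contr a X + contr a Y := rfl

theorem contr_smul (a : V × F) (r : F) (X : List (V × F) → V) :
    contr a (r • X) = r • contr a X := rfl

theorem sgn_add (X Y : List (V × F) → V) : sgn (X + Y) = sgn X + sgn Y := by
  funext l; simp [sgn]

theorem sgn_smul (r : F) (X : List (V × F) → V) : sgn (r • X) = r • sgn X := by
  funext l; simp [sgn, smul_comm r]

theorem sgn_neg (X : List (V × F) → V) : sgn (-X) = -sgn X := by
  funext l; simp [sgn]

theorem sgn_sgn (X : List (V × F) → V) : sgn (sgn X) = X := by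
  funext l; simp [sgn, smul_smul, ← mul_pow]

/-- All components of `X` have a number of arguments of the same parity as `n`. -/
def HasParity (n : ℕ) (X : List (V × F) → V) : Prop := sgn X = (-1 : F) ^ n • X

theorem HasParity.contr {n : ℕ} {X : List (V × F) → V} (h : HasParity n X) (a : V × F) :
    HasParity (n + 1) (contr a X) := by
  have := contr_sgn a X
  rw [h, contr_smul] at this
  rw [HasParity, pow_succ, mul_neg_one, neg_smul, this, neg_neg]

/-- Multiplication by `λ_0 + ⋯ + λ_k + ∂`. -/
def totalOp (A : DiffFunctionAlgebra F V I) (X : List (V × F) → V) : List (V × F) → V :=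
  fun l => A.opd (lamSum l) (X l)

/-- The concatenation product. -/
def catProd : List (V × F) → (List (V × F) → V) → (List (V × F) → V) → V
  | [], X, Y => X [] * Y []
  | a :: l, X, Y => catProd l (contr a X) (sgn Y) + catProd l X (contr a Y)

/-- The concatenation product as a function on lists. -/
def cat (X Y : List (V × F) → V) : List (V × F) → V := fun l => catProd l X Y

theorem cat_nil (X Y : List (V × F) → V) : cat X Y [] = X [] * Y [] := rfl

/-- Contraction is an odd derivation acting from the right: it passes Y, with a sign, to reach X.
The inductions on the product rest on this identity. -/
theorem contr_cat (a : V × F) (X Y : List (V × F) → V) :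
    contr a (cat X Y) = cat (contr a X) (sgn Y) + cat X (contr a Y) := rfl

theorem cat_cons (a : V × F) (l : List (V × F)) (X Y : List (V × F) → V) :
    cat X Y (a :: l) = cat (contr a X) (sgn Y) l + cat X (contr a Y) l := rfl

theorem cat_add_left (X X' Y : List (V × F) → V) : cat (X + X') Y = cat X Y + cat X' Y := by
  funext l
  induction l generalizing X X' Y with
  | nil => simp [cat_nil, add_mul]
  | cons a l ih => simp only [cat_cons, contr_add, ih, Pi.add_apply]; abel

theorem cat_add_right (X Y Y' : List (V × F) → V) : cat X (Y + Y') = cat X Y + cat X Y' := by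
  funext l
  induction l generalizing X Y Y' with
  | nil => simp [cat_nil, mul_add]
  | cons a l ih => simp only [cat_cons, contr_add, sgn_add, ih, Pi.add_apply]; abel

theorem cat_smul_left (r : F) (X Y : List (V × F) → V) : cat (r • X) Y = r • cat X Y := by
  funext l
  induction l generalizing X Y with
  | nil => simp [cat_nil]
  | cons a l ih => simp only [cat_cons, contr_smul, ih, Pi.smul_apply, smul_add]

theorem cat_smul_right (r : F) (X Y : List (V × F) → V) : cat X (r • Y) = r • cat X Y := by
  funext l
  induction l generalizing X Y with
  | nil => simp [cat_nil]
  | cons a l ih => simp only [cat_cons, contr_smul, sgn_smul, ih, Pi.smul_apply, smul_add]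

theorem cat_neg_left (X Y : List (V × F) → V) : cat (-X) Y = -cat X Y := by
  simpa using cat_smul_left (-1) X Y

theorem cat_neg_right (X Y : List (V × F) → V) : cat X (-Y) = -cat X Y := by
  simpa using cat_smul_right (-1) X Y

theorem sgn_cat (X Y : List (V × F) → V) : sgn (cat X Y) = cat (sgn X) (sgn Y) := by
  funext l
  induction l generalizing X Y with
  | nil => simp [cat_nil, sgn_nil]
  | cons a l ih =>
    have h := congrFun (contr_sgn a (cat X Y)) l
    rw [contr_apply] at h
    rw [h, contr_cat, sgn_add, Pi.neg_apply, Pi.add_apply, ih, ih, cat_cons, contr_sgn, contr_sgn,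
      cat_neg_left, cat_neg_right, Pi.neg_apply, Pi.neg_apply]
    abel

theorem cat_assoc (X Y Z : List (V × F) → V) : cat (cat X Y) Z = cat X (cat Y Z) := by
  funext l
  induction l generalizing X Y Z with
  | nil => simp [cat_nil, mul_assoc]
  | cons a l ih =>
    simp only [cat_cons, contr_cat, sgn_cat, cat_add_left, cat_add_right, Pi.add_apply, ih]
    abel

theorem cat_comm {m n : ℕ} {X Y : List (V × F) → V} (hX : HasParity m X) (hY : HasParity n Y) :
    cat Y X = (-1 : F) ^ (m * n) • cat X Y := by
  funext l
  induction l generalizing m n X Y with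
  | nil =>
    have h1 := congrFun hX []
    have h2 := congrFun hY []
    simp only [sgn_nil, Pi.smul_apply] at h1 h2
    simp only [cat_nil, Pi.smul_apply]
    -- For odd m the parity of X says X [] = -X [], so the sign can be inserted without dividing by
    -- 2.
    have h3 : X [] * Y [] = (-1 : F) ^ (m * n) • (X [] * Y []) := by
      rcases Nat.even_or_odd m with hm | hm
      · rw [(hm.mul_right n).neg_one_pow, one_smul]
      rcases Nat.even_or_odd n with hn | hn
      · rw [(hn.mul_left m).neg_one_pow, one_smul]
      · rw [(hm.mul hn).neg_one_pow, ← smul_mul_assoc]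
        rw [hm.neg_one_pow] at h1
        rw [← h1]
    rw [mul_comm, ← h3]
  | cons a l ih =>
    have h1 : cat (contr a Y) (sgn X) l = (-1 : F) ^ (m * n) • cat X (contr a Y) l := by
      rw [hX, cat_smul_right, Pi.smul_apply, ih hX (hY.contr a), Pi.smul_apply, smul_smul, mul_add,
        pow_add, mul_one, mul_left_comm, ← mul_pow]
      simp
    have h2 : cat Y (contr a X) l = (-1 : F) ^ (m * n) • cat (contr a X) (sgn Y) l := by
      rw [hY, cat_smul_right, Pi.smul_apply, ih (hX.contr a) hY, Pi.smul_apply, smul_smul, add_mul,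
        pow_add, one_mul]
    rw [cat_cons, h1, h2, Pi.smul_apply, cat_cons, smul_add, add_comm]

/-- Elements of `V` as functions on lists. -/
def scalarFun (v : V) : List (V × F) → V
  | [] => v
  | _ :: _ => 0

theorem contr_scalarFun (a : V × F) (v : V) : contr a (scalarFun v) = 0 := rfl

theorem cat_zero_left (Y : List (V × F) → V) : cat 0 Y = 0 := by
  simpa using cat_smul_left (0 : F) 0 Y

theorem one_cat (X : List (V × F) → V) : cat (scalarFun 1) X = X := by
  funext l
  induction l generalizing X with
  | nil => simp [cat_nil, scalarFun]
  | cons a l ih =>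
    rw [cat_cons, contr_scalarFun, cat_zero_left, ih]
    simp [contr]

section totalOp

variable (A : DiffFunctionAlgebra F V I)

theorem contr_totalOp (a : V × F) (X : List (V × F) → V) :
    contr a (A.totalOp X) = a.2 • contr a X + A.totalOp (contr a X) := by
  funext l
  simp only [contr, totalOp, lamSum_cons, opd_apply, add_smul, Pi.add_apply, Pi.smul_apply]
  abel

theorem sgn_totalOp (X : List (V × F) → V) : sgn (A.totalOp X) = A.totalOp (sgn X) := by
  funext l; simp [sgn, totalOp]

theorem totalOp_nil (X : List (V × F) → V) : A.totalOp X [] = A.d (X []) := by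
  simp [totalOp, opd_apply, lamSum]

theorem totalOp_cat (X Y : List (V × F) → V) :
    A.totalOp (cat X Y) = cat (A.totalOp X) Y + cat X (A.totalOp Y) := by
  funext l
  induction l generalizing X Y with
  | nil =>
    simp only [totalOp_nil, cat_nil, Derivation.leibniz, smul_eq_mul, Pi.add_apply]; ring
  | cons a l ih =>
    have h := congrFun (contr_totalOp A a (cat X Y)) l
    rw [contr_apply] at h
    have hadd : ∀ X Y : List (V × F) → V, A.totalOp (X + Y) = A.totalOp X + A.totalOp Y :=
      fun X Y => by funext l; simp [totalOp]
    simp only [h, contr_cat, hadd, Pi.add_apply, ih, Pi.smul_apply, cat_cons, contr_totalOp,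
      sgn_totalOp, cat_add_left, cat_add_right, cat_smul_left, cat_smul_right]
    module

end totalOp

/-! ## Admissible functions -/

/-- Evaluation of polynomials in `λ`'s at scalars. -/
def evalAt {τ : Type*} (t : τ → F) : MvPolynomial τ V →ₐ[V] V :=
  aeval fun i => algebraMap F V (t i)

theorem evalAt_C {τ : Type*} (t : τ → F) (v : V) : evalAt t (C v) = v := by simp [evalAt]

theorem evalAt_X {τ : Type*} (t : τ → F) (i : τ) :
    evalAt t (X i) = algebraMap F V (t i) := by simp [evalAt]

theorem evalAt_mul_X {τ : Type*} (t : τ → F) (P : MvPolynomial τ V) (i : τ) :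
    evalAt t (P * X i) = t i • evalAt t P := by
  rw [map_mul, evalAt_X, Algebra.smul_def, mul_comm]

theorem evalAt_smul {τ : Type*} (t : τ → F) (r : F) (P : MvPolynomial τ V) :
    evalAt t (r • P) = r • evalAt t P :=
  _root_.map_smul ((evalAt t).toLinearMap.restrictScalars F) r P

/-- A family of cochains as a function on lists. -/
def toList {A : DiffFunctionAlgebra F V I} (Z : ∀ n, A.Coch n) : List (V × F) → V := fun l =>
  evalAt (fun i => (l.get i).2) (Z l.length fun i => (l.get i).1)

theorem toList_eq {A : DiffFunctionAlgebra F V I} (Z : ∀ n, A.Coch n) {n : ℕ} (l : List (V × F))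
    (h : n = l.length) : toList Z l = evalAt (fun i => (l.get (i.cast h)).2)
      (Z n fun i => (l.get (i.cast h)).1) := by
  subst h; rfl

theorem toList_ofFn {A : DiffFunctionAlgebra F V I} (Z : ∀ n, A.Coch n) {n : ℕ}
    (a : Fin n → V × F) :
    toList Z (List.ofFn a) = evalAt (fun i => (a i).2) (Z n fun i => (a i).1) := by
  rw [toList_eq Z _ (List.length_ofFn).symm]
  simp

/-- Polynomial functions of two variables. -/
inductive PolyFun₂ : (F → F → V) → Prop
  | const (v : V) : PolyFun₂ fun _ _ => v
  | add (φ ψ : F → F → V) : PolyFun₂ φ → PolyFun₂ ψ → PolyFun₂ fun s t => φ s t + ψ s t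
  | smul_left (φ : F → F → V) : PolyFun₂ φ → PolyFun₂ fun s t => s • φ s t
  | smul_right (φ : F → F → V) : PolyFun₂ φ → PolyFun₂ fun s t => t • φ s t

theorem PolyFun₂.mem_right {φ : F → F → V} (h : PolyFun₂ φ) (s : F) : φ s ∈ polyFun F V := by
  induction h with
  | const v => exact const_mem v
  | add φ ψ _ _ h1 h2 => exact PolyFun.add_mem' h1 h2
  | smul_left φ _ h => exact const_smul_mem s h
  | smul_right φ _ h => exact PolyFun.smul_mem' h

/-- After τ ↦ -(s + r) - ∂ and then r ↦ c - ∂, the two ∂'s in the first slot cancel and it becomes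
the scalar -(s + c). Polynomiality is carried along because the induction needs `opEval_smul` for
the inner expression. -/
theorem PolyFun₂.opEval_opEval [Infinite F] (d : V →ₗ[F] V) {φ : F → F → V} (h : PolyFun₂ φ)
    (s c : F) :
    (fun r => opEval d (-(s + r)) fun τ => φ τ r) ∈ polyFun F V ∧
    opEval d c (fun r => opEval d (-(s + r)) fun τ => φ τ r) = opEval d c (φ (-(s + c))) ∧
    ∀ r, (fun τ => φ τ r) ∈ polyFun F V := by
  induction h with
  | const v => simp only [opEval_const]; exact ⟨const_mem v, trivial, fun _ => const_mem v⟩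
  | add φ ψ _ _ h1 h2 =>
    simp only [opEval_add, h1, h2]
    exact ⟨PolyFun.add_mem' h1.1 h2.1, trivial, fun r => PolyFun.add_mem' (h1.2.2 r) (h2.2.2 r)⟩
  | smul_left φ _ h =>
    obtain ⟨h1, h2, h3⟩ := h
    have e : (fun r => opEval d (-(s + r)) fun τ => τ • φ τ r) = fun r =>
        (-s) • opEval d (-(s + r)) (fun τ => φ τ r) -
          r • opEval d (-(s + r)) (fun τ => φ τ r) - d (opEval d (-(s + r)) fun τ => φ τ r) := by
      funext r
      rw [opEval_smul d _ (h3 r), neg_add, ← sub_eq_add_neg, sub_smul]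
    rw [e]
    refine ⟨PolyFun.sub_mem' (PolyFun.sub_mem' (const_smul_mem _ h1) (PolyFun.smul_mem' h1))
      (linear_mem d h1), ?_, fun r => PolyFun.smul_mem' (h3 r)⟩
    simp only [opEval_sub, opEval_const_smul, opEval_smul d _ h1, opEval_map d _ h1, h2]
    module
  | smul_right φ hφ h =>
    obtain ⟨h1, h2, h3⟩ := h
    simp only [opEval_const_smul]
    refine ⟨PolyFun.smul_mem' h1, ?_, fun r => const_smul_mem r (h3 r)⟩
    rw [opEval_smul d _ h1, h2, opEval_smul d _ (hφ.mem_right _)]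

/-- A function on lists is admissible if it comes from a family of cochains, is alternating, and
is a conformal vector field in the first argument. -/
structure Admissible (A : DiffFunctionAlgebra F V I) [Fintype I] (X : List (V × F) → V) :
    Prop where
  poly : ∃ Z : ∀ n, A.Coch n, toList Z = X
  alt : ∀ l₁ a b l₂, X (l₁ ++ a :: b :: l₂) = -X (l₁ ++ b :: a :: l₂)
  conf : ∀ l, A.IsConf fun g t => X ((g, t) :: l)

namespace Admissible

variable {A : DiffFunctionAlgebra F V I} [Fintype I] {X Y : List (V × F) → V}

theorem swap (h : A.Admissible X) (a b : V × F) (l : List (V × F)) :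
    X (a :: b :: l) = -X (b :: a :: l) := h.alt [] a b l

theorem contr (h : A.Admissible X) (a : V × F) : A.Admissible (contr a X) where
  poly := by
    obtain ⟨Z, rfl⟩ := h.poly
    refine ⟨fun n v => aeval (Fin.cons (C (algebraMap F V a.2)) MvPolynomial.X)
      (Z (n + 1) (Fin.cons a.1 v)), funext fun l => ?_⟩
    rw [contr_apply, toList_eq Z (a :: l) (n := l.length + 1) rfl, toList]
    have e : (Fin.cons a.1 fun i => (l.get i).1 : Fin (l.length + 1) → V)
        = fun i => ((a :: l).get (i.cast rfl)).1 := by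
      funext i; refine Fin.cases ?_ (fun i => ?_) i <;> simp
    rw [e]
    generalize Z (l.length + 1) (fun i => ((a :: l).get (i.cast rfl)).1) = P
    change ((evalAt _).comp (aeval _)) P = _
    congr 1
    apply MvPolynomial.algHom_ext
    intro i
    rw [AlgHom.comp_apply, aeval_X, evalAt_X]
    refine Fin.cases ?_ (fun i => ?_) i
    · simp [evalAt]
    · simp [evalAt]
  alt l₁ b c l₂ := h.alt (a :: l₁) b c l₂
  conf l := by
    have e : (fun (g : V) (t : F) => X (a :: (g, t) :: l)) = fun g t => -X ((g, t) :: a :: l) := by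
      funext g t; exact h.swap _ _ _
    change A.IsConf fun (g : V) (t : F) => X (a :: (g, t) :: l)
    rw [e]
    exact (h.conf _).neg

theorem add (h : A.Admissible X) (h' : A.Admissible Y) : A.Admissible (X + Y) where
  poly := by
    obtain ⟨Z, rfl⟩ := h.poly
    obtain ⟨Z', rfl⟩ := h'.poly
    exact ⟨Z + Z', funext fun l => by simp [toList]⟩
  alt l₁ a b l₂ := by simp only [Pi.add_apply, h.alt l₁ a, h'.alt l₁ a]; abel
  conf l := (h.conf l).add (h'.conf l)

theorem smul (r : F) (h : A.Admissible X) : A.Admissible (r • X) where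
  poly := by
    obtain ⟨Z, rfl⟩ := h.poly
    exact ⟨r • Z, funext fun l => by simp [toList, evalAt_smul]⟩
  alt l₁ a b l₂ := by simp only [Pi.smul_apply, h.alt l₁ a, smul_neg]
  conf l := (h.conf l).const_smul r

theorem neg (h : A.Admissible X) : A.Admissible (-X) := by simpa using h.smul (-1)

theorem sgn (h : A.Admissible X) : A.Admissible (sgn X) where
  poly := by
    obtain ⟨Z, rfl⟩ := h.poly
    exact ⟨fun n v => (-1 : F) ^ n • Z n v, funext fun l => by
      simp [toList, evalAt_smul, DiffFunctionAlgebra.sgn]⟩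
  alt l₁ a b l₂ := by
    simp only [DiffFunctionAlgebra.sgn, h.alt l₁ a, smul_neg, List.length_append,
      List.length_cons]
  conf l := (h.conf l).const_smul ((-1) ^ (l.length + 1))

theorem contr_d (h : A.Admissible X) (g : V) (t : F) :
    DiffFunctionAlgebra.contr (A.d g, t) X = (-t) • DiffFunctionAlgebra.contr (g, t) X :=
  funext fun l => by
    rw [Pi.smul_apply, neg_smul]
    exact (h.conf l).map_d g t

theorem polyFun₂ (h : A.Admissible X) (f g : V) : PolyFun₂ fun s t => X [(f, s), (g, t)] := by
  obtain ⟨Z, rfl⟩ := h.poly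
  have e : (fun s t : F => toList Z [(f, s), (g, t)])
      = fun s t => evalAt ![s, t] (Z 2 ![f, g]) := by
    funext s t
    have := toList_ofFn Z ![(f, s), (g, t)]
    rw [show List.ofFn ![(f, s), (g, t)] = [(f, s), (g, t)] from rfl] at this
    rw [this]
    congr 2
    · funext i; fin_cases i <;> rfl
    · funext i; fin_cases i <;> rfl
  rw [e]
  induction Z 2 ![f, g] using MvPolynomial.induction_on with
  | C v => simp only [evalAt_C]; exact .const v
  | add p q hp hq => simp only [map_add]; exact .add _ _ hp hq
  | mul_X p i hp =>
    simp only [evalAt_mul_X]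
    fin_cases i
    · exact .smul_left _ hp
    · exact .smul_right _ hp

end Admissible

end DiffFunctionAlgebra

namespace DiffFunctionAlgebra

open PolyFun MvPolynomial

variable {F V I : Type*} [Field F] [CommRing V] [Algebra F V] [Infinite F]
  (A : DiffFunctionAlgebra F V I)

/-! ## The `λ`-bracket at a scalar -/

/-- The operator `g ↦ [X _s g]` in degree zero. -/
def adj (X : List (V × F) → V) (s : F) (g : V) : V := opEval A.dl (-s) fun t => X [(g, t)]

/-- The recursive form of the `λ`-bracket at `λ = s`. -/
def brAux : List (V × F) → F → (List (V × F) → V) → (List (V × F) → V) → V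
  | [], s, X, Y => A.adj X s (Y []) - Y [(X [], s)]
  | a :: l, s, X, Y => -brAux l (s + a.2) (contr a X) (sgn Y) + brAux l s X (contr a Y)

/-- The `λ`-bracket at `λ = s` as a function on lists. -/
def br (s : F) (X Y : List (V × F) → V) : List (V × F) → V := fun l => A.brAux l s X Y

theorem br_nil (s : F) (X Y : List (V × F) → V) :
    A.br s X Y [] = A.adj X s (Y []) - Y [(X [], s)] := rfl

/-- The argument removed from X carried the variable `a.2`, which the remaining bracket absorbs into
λ. Apart from this shift, contraction is an odd derivation of the bracket. -/
theorem contr_br (a : V × F) (s : F) (X Y : List (V × F) → V) :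
    contr a (A.br s X Y) = -A.br (s + a.2) (contr a X) (sgn Y) + A.br s X (contr a Y) := rfl

theorem br_cons (a : V × F) (l : List (V × F)) (s : F) (X Y : List (V × F) → V) :
    A.br s X Y (a :: l) = -A.br (s + a.2) (contr a X) (sgn Y) l + A.br s X (contr a Y) l := rfl

theorem adj_add (X X' : List (V × F) → V) (s : F) (g : V) :
    A.adj (X + X') s g = A.adj X s g + A.adj X' s g := opEval_add _ _ _ _

theorem adj_smul (r : F) (X : List (V × F) → V) (s : F) (g : V) :
    A.adj (r • X) s g = r • A.adj X s g := opEval_const_smul _ _ _ _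

theorem adj_sgn (X : List (V × F) → V) (s : F) (g : V) :
    A.adj (sgn X) s g = -A.adj X s g := by
  simp only [adj, sgn_singleton, opEval_neg]

namespace Admissible

variable {A} [Fintype I] {X Y Z : List (V × F) → V}

theorem isVect (h : A.Admissible X) (s : F) : A.IsVect (A.adj X s) := (h.conf []).isVect s

theorem adj_d (h : A.Admissible X) (s : F) (g : V) :
    A.adj X s (A.d g) = A.opd s (A.adj X s g) := by
  have e : (fun t => X [(A.d g, t)]) = fun t => -(t • X [(g, t)]) := by
    funext t; exact (h.conf []).map_d g t
  rw [adj, e, opEval_neg, opEval_smul _ _ ((h.conf []).mem g), opd_apply, neg_smul]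
  change -(-_ - A.d _) = _
  rw [adj]; abel

theorem adj_sub_d (h : A.Admissible X) (s c : F) (g : V) :
    A.adj X s (c • g - A.dl g) = (c - s) • A.adj X s g - A.dl (A.adj X s g) := by
  have e : c • g - A.dl g = c • g + (-1 : F) • A.d g := by
    rw [neg_smul, one_smul, sub_eq_add_neg]; rfl
  rw [e, (h.isVect s).map_add, (h.isVect s).map_smul, (h.isVect s).map_smul, h.adj_d, opd_apply]
  change _ = _ - A.d _
  module

theorem br_add_left (h : A.Admissible Y) (s : F) (X X' : List (V × F) → V) :
    A.br s (X + X') Y = A.br s X Y + A.br s X' Y := by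
  funext l
  induction l generalizing X X' Y s with
  | nil =>
    simp only [br_nil, Pi.add_apply, adj_add]
    rw [(h.conf []).map_add]; abel
  | cons a l ih =>
    simp only [br_cons, DiffFunctionAlgebra.contr_add, ih h.sgn, ih (h.contr a), Pi.add_apply]
    abel

theorem br_smul_left (h : A.Admissible Y) (s r : F) (X : List (V × F) → V) :
    A.br s (r • X) Y = r • A.br s X Y := by
  funext l
  induction l generalizing X Y s with
  | nil =>
    simp only [br_nil, Pi.smul_apply, adj_smul]
    rw [(h.conf []).map_smul, smul_sub]
  | cons a l ih =>
    simp only [br_cons, DiffFunctionAlgebra.contr_smul, ih h.sgn, ih (h.contr a), Pi.smul_apply]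
    module

theorem br_neg_left (h : A.Admissible Y) (s : F) (X : List (V × F) → V) :
    A.br s (-X) Y = -A.br s X Y := by simpa using h.br_smul_left s (-1) X

theorem br_add_right (h : A.Admissible X) (s : F) (Y Y' : List (V × F) → V) :
    A.br s X (Y + Y') = A.br s X Y + A.br s X Y' := by
  funext l
  induction l generalizing X Y Y' s with
  | nil =>
    simp only [br_nil, Pi.add_apply, (h.isVect s).map_add]; abel
  | cons a l ih =>
    simp only [br_cons, DiffFunctionAlgebra.contr_add, sgn_add, ih h, ih (h.contr a), Pi.add_apply]
    abel

theorem br_smul_right (h : A.Admissible X) (s r : F) (Y : List (V × F) → V) :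
    A.br s X (r • Y) = r • A.br s X Y := by
  funext l
  induction l generalizing X Y s with
  | nil =>
    simp only [br_nil, Pi.smul_apply, (h.isVect s).map_smul, smul_sub]
  | cons a l ih =>
    simp only [br_cons, DiffFunctionAlgebra.contr_smul, sgn_smul, ih h, ih (h.contr a),
      Pi.smul_apply]
    module

theorem br_neg_right (h : A.Admissible X) (s : F) (Y : List (V × F) → V) :
    A.br s X (-Y) = -A.br s X Y := by simpa using h.br_smul_right s (-1) Y

theorem sgn_br (hX : A.Admissible X) (hY : A.Admissible Y) (s : F) :
    DiffFunctionAlgebra.sgn (A.br s X Y) =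
      -A.br s (DiffFunctionAlgebra.sgn X) (DiffFunctionAlgebra.sgn Y) := by
  funext l
  induction l generalizing X Y s with
  | nil =>
    simp only [sgn_nil, br_nil, adj_sgn, Pi.neg_apply, sgn_singleton]; abel
  | cons a l ih =>
    have h := congrFun (contr_sgn a (A.br s X Y)) l
    rw [contr_apply] at h
    simp only [h, contr_br, sgn_add, sgn_neg, Pi.neg_apply, Pi.add_apply,
      ih (hX.contr a) hY.sgn, ih hX (hY.contr a), br_cons, contr_sgn,
      hY.sgn.sgn.br_neg_left, hX.sgn.br_neg_right]

/-- Two contractions of X, or of Y, anticommute. The two mixed terms are exchanged with opposite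
signs because contraction anticommutes with `sgn`. -/
theorem br_alt (hX : A.Admissible X) (hY : A.Admissible Y) (s : F) (l₁ : List (V × F))
    (a b : V × F) (l₂ : List (V × F)) :
    A.br s X Y (l₁ ++ a :: b :: l₂) = -A.br s X Y (l₁ ++ b :: a :: l₂) := by
  induction l₁ generalizing X Y s with
  | nil =>
    have e1 : DiffFunctionAlgebra.contr a (DiffFunctionAlgebra.contr b X)
        = -DiffFunctionAlgebra.contr b (DiffFunctionAlgebra.contr a X) := by
      funext l; exact hX.swap b a l
    have e2 : DiffFunctionAlgebra.contr a (DiffFunctionAlgebra.contr b Y)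
        = -DiffFunctionAlgebra.contr b (DiffFunctionAlgebra.contr a Y) := by
      funext l; exact hY.swap b a l
    simp only [List.nil_append, br_cons, contr_sgn, sgn_sgn, e1, e2,
      hY.br_neg_left, hX.br_neg_right, (hX.contr a).br_neg_right,
      (hX.contr b).br_neg_right, Pi.neg_apply, add_right_comm s b.2 a.2]
    abel
  | cons c l ih =>
    simp only [List.cons_append, br_cons, ih (hX.contr c) hY.sgn, ih hX (hY.contr c)]
    abel

theorem br_mem (hX : A.Admissible X) (hY : A.Admissible Y) (l : List (V × F)) :
    (fun s => A.br s X Y l) ∈ polyFun F V := by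
  induction l generalizing X Y with
  | nil =>
    exact PolyFun.sub_mem' (neg_arg_mem (opEval_mem _ ((hX.conf []).mem _))) ((hY.conf []).mem _)
  | cons a l ih =>
    exact PolyFun.add_mem' (PolyFun.neg_mem' (shift_mem a.2 (ih (hX.contr a) hY.sgn)))
      (ih hX (hY.contr a))

theorem adj_mem (h : A.Admissible X) {χ : F → V} (hχ : χ ∈ polyFun F V) (s : F) :
    (fun r => A.adj X s (χ r)) ∈ polyFun F V := by
  induction hχ using induction with
  | const v => exact const_mem _
  | add φ hφ ψ hψ h1 h2 => simpa only [(h.isVect s).map_add] using PolyFun.add_mem' h1 h2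
  | smul φ hφ h1 => simpa only [(h.isVect s).map_smul] using PolyFun.smul_mem' h1

/-- By `adj_d` the operator c - ∂ outside `adj X s` equals c + s - ∂ inside it. -/
theorem opEval_adj (h : A.Admissible X) {χ : F → V} (hχ : χ ∈ polyFun F V) (s c : F) :
    opEval A.dl c (fun r => A.adj X s (χ r)) = A.adj X s (opEval A.dl (c + s) χ) := by
  induction hχ using induction with
  | const v => simp only [opEval_const]
  | add φ hφ ψ hψ h1 h2 => simp only [(h.isVect s).map_add, opEval_add, h1, h2]
  | smul φ hφ h1 =>
    simp only [(h.isVect s).map_smul, opEval_smul _ _ (h.adj_mem hφ s), opEval_smul _ _ hφ, h1,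
      h.adj_sub_d, add_sub_cancel_right]

/-- Under r ↦ -(s + t) - ∂ the variable s + r of X becomes -t - ∂, which is what defines `adj X t`;
by `adj_d` the same r inside χ becomes -s - ∂. -/
theorem opEval_insert (h : A.Admissible X) {χ : F → V} (hχ : χ ∈ polyFun F V) (s t : F) :
    (fun r => X [(χ r, s + r)]) ∈ polyFun F V ∧
    opEval A.dl (-(s + t)) (fun r => X [(χ r, s + r)]) = A.adj X t (opEval A.dl (-s) χ) := by
  induction hχ using induction with
  | const v =>
    have h1 := (h.conf []).mem v
    have h2 := opEval_shift A.dl (-(s + t)) s h1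
    simp only [add_comm _ s] at h2
    simp only [opEval_const]
    refine ⟨by simpa only [add_comm] using shift_mem s h1, h2.trans ?_⟩
    rw [adj]; congr 1; ring_nf
  | add φ hφ ψ hψ h1 h2 =>
    have e : ∀ r, X [(φ r + ψ r, s + r)] = X [(φ r, s + r)] + X [(ψ r, s + r)] :=
      fun r => (h.conf []).map_add _ _ _
    simp only [e, opEval_add, (h.isVect t).map_add, h1, h2]
    exact ⟨PolyFun.add_mem' h1.1 h2.1, trivial⟩
  | smul φ hφ h1 =>
    have e : ∀ r, X [(r • φ r, s + r)] = r • X [(φ r, s + r)] :=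
      fun r => (h.conf []).map_smul _ _ _
    simp only [e]
    refine ⟨PolyFun.smul_mem' h1.1, ?_⟩
    rw [opEval_smul _ _ h1.1, h1.2, opEval_smul _ _ hφ, h.adj_sub_d, neg_add, sub_eq_add_neg (-s)]

/-- The commutator formula in degree zero. -/
theorem adj_br (hX : A.Admissible X) (hY : A.Admissible Y) (s t : F) (f : V) :
    A.adj (A.br s X Y) (s + t) f = A.adj X s (A.adj Y t f) - A.adj Y t (A.adj X s f)
      + A.adj (DiffFunctionAlgebra.contr (X [], s) Y) (s + t) f
      + A.adj (DiffFunctionAlgebra.contr (Y [], t) X) (s + t) f := by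
  -- The value on one argument has four terms. The two with nested brackets turn into the
  -- commutator; the two with two arguments turn into the contractions by the scalars X [] and Y [].
  have e : ∀ r, A.br s X Y [(f, r)] = opEval A.dl (-(s + r)) (fun τ => X [(Y [], τ), (f, r)])
      - Y [(X [(f, r)], s + r)] + A.adj X s (Y [(f, r)]) + Y [(X [], s), (f, r)] := fun r => by
    have e1 : ∀ τ, X [(f, r), (Y [], τ)] = -X [(Y [], τ), (f, r)] := fun τ => hX.swap _ _ _
    have e2 : Y [(f, r), (X [], s)] = -Y [(X [], s), (f, r)] := hY.swap _ _ _
    rw [br_cons, br_nil, br_nil, sgn_nil, sgn_singleton, adj]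
    simp only [contr_apply, e1, e2, opEval_neg]
    abel
  -- The double substitution evaluates the slot of Y [] at the scalar t, as in a contraction.
  have hp := (hX.polyFun₂ (Y []) f).opEval_opEval A.dl s (-(s + t))
  rw [show -(s + -(s + t)) = t by ring] at hp
  rw [adj]
  simp only [e, opEval_add, opEval_sub, hp.2.1, (hY.opEval_insert ((hX.conf []).mem f) s t).2,
    hX.opEval_adj ((hY.conf []).mem f)]
  rw [show -(s + t) + s = -t by ring]
  simp only [adj, contr_apply]
  abel

theorem br_totalOp_left (hX : A.Admissible X) (hY : A.Admissible Y) (s : F) :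
    A.br s (A.totalOp X) Y = -(s • A.br s X Y) := by
  funext l
  induction l generalizing X Y s with
  | nil =>
    have h1 : A.adj (A.totalOp X) s (Y []) = -(s • A.adj X s (Y [])) := by
      have hm := (hX.conf []).mem (Y [])
      simp only [adj, totalOp, lamSum_cons, lamSum_nil, add_zero, opd_apply, opEval_add]
      have := opEval_map A.dl (-s) hm
      change _ + opEval A.dl (-s) (fun t => A.dl (X [(Y [], t)])) = _
      rw [this, opEval_smul _ _ hm]
      module
    have h2 : Y [(A.d (X []), s)] = -(s • Y [(X [], s)]) := (hY.conf []).map_d _ _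
    rw [br_nil, h1, totalOp_nil, h2, Pi.neg_apply, Pi.smul_apply, br_nil, smul_sub]
    abel
  | cons a l ih =>
    simp only [br_cons, contr_totalOp, hY.sgn.br_add_left, hY.sgn.br_smul_left, Pi.add_apply,
      ih (hX.contr a) hY.sgn, ih hX (hY.contr a), Pi.neg_apply, Pi.smul_apply]
    module

theorem br_totalOp_right (hX : A.Admissible X) (hY : A.Admissible Y) (s : F) :
    A.br s X (A.totalOp Y) = s • A.br s X Y + A.totalOp (A.br s X Y) := by
  funext l
  induction l generalizing X Y s with
  | nil =>
    simp only [br_nil, hX.adj_d, totalOp, lamSum_cons, lamSum_nil, add_zero,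
      Pi.add_apply, Pi.smul_apply, opd_apply, map_sub, zero_smul, zero_add]
    module
  | cons a l ih =>
    simp only [br_cons, contr_totalOp, sgn_totalOp, hX.br_add_right, hX.br_smul_right,
      Pi.add_apply, ih (hX.contr a) hY.sgn, ih hX (hY.contr a), Pi.smul_apply,
      totalOp, lamSum_cons, opd_apply, map_add, map_neg]
    module

end Admissible

end DiffFunctionAlgebra

/-! ### Skewsymmetry, the Jacobi identity and the odd Leibniz rule at scalar values of λ. -/

namespace DiffFunctionAlgebra

open PolyFun MvPolynomial

variable {F V I : Type*} [Field F] [CommRing V] [Algebra F V] [CharZero F]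
  {A : DiffFunctionAlgebra F V I}

/-- The wrong parity gives X l = -X l, and 2 is invertible. -/
theorem HasParity.apply_eq_zero {n : ℕ} {X : List (V × F) → V} (h : HasParity n X)
    {l : List (V × F)} (hl : Odd (n + l.length)) : X l = 0 := by
  have h1 := congrArg (fun v => (-1 : F) ^ n • v) (congrFun h l)
  simp only [sgn, Pi.smul_apply, smul_smul, ← pow_add, hl.neg_one_pow, neg_one_smul,
    (Even.add_self n).neg_one_pow, one_smul] at h1
  have h2 : (2 : F) • X l = 0 := by rw [two_smul]; nth_rewrite 1 [← h1]; exact neg_add_cancel _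
  simpa using h2

theorem neg_one_pow_mul_succ_succ (x y : ℕ) : (-1 : F) ^ ((x + 1) * (y + 1))
    = -((-1) ^ x * (-1) ^ y * (-1) ^ (x * y)) := by
  rw [show (x + 1) * (y + 1) = x + y + x * y + 1 by ring, pow_succ, pow_add, pow_add]; ring

theorem neg_one_pow_succ_mul (x y : ℕ) : (-1 : F) ^ ((x + 1) * y)
    = (-1) ^ (x * y) * (-1) ^ y := by
  rw [add_mul, one_mul, pow_add]

theorem neg_one_pow_mul_succ (x y : ℕ) : (-1 : F) ^ (x * (y + 1))
    = (-1) ^ (x * y) * (-1) ^ x := by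
  rw [mul_add, mul_one, pow_add]

namespace Admissible

variable [Fintype I] {X Y Z : List (V × F) → V}

/-- Skewsymmetry of the `λ`-bracket. -/
theorem br_skew (hX : A.Admissible X) (hY : A.Admissible Y) {x y : ℕ} (px : HasParity x X)
    (py : HasParity y Y) (t : F) (l : List (V × F)) :
    A.br t Y X l = -((-1 : F) ^ ((x + 1) * (y + 1)) •
      opEval A.dl (-(t + lamSum l)) fun s => A.br s X Y l) := by
  induction l generalizing X Y x y t with
  | nil =>
    have e1 := opEval_opEval A.dl (-t) 0 ((hX.conf []).mem (Y []))
    simp only [zero_sub, neg_neg] at e1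
    simp only [br_nil, lamSum_nil, add_zero, opEval_sub]
    change A.adj Y t (X []) - _ = -(_ • (opEval A.dl (-t) (fun s => opEval A.dl (-s)
      (fun τ => X [(Y [], τ)])) - A.adj Y t (X [])))
    rw [e1]
    -- At the empty list the exchange is literally antisymmetric. The sign can differ only when x
    -- and y are both even, and then X and Y vanish on single arguments.
    rcases Nat.even_or_odd ((x + 1) * (y + 1)) with h | h
    · rw [h.neg_one_pow, one_smul, neg_sub]
    · rw [Nat.odd_mul] at h
      have h1 : ∀ a, X [a] = 0 := fun a => px.apply_eq_zero h.1
      have h2 : ∀ a, Y [a] = 0 := fun a => py.apply_eq_zero h.2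
      simp [h1, h2, adj, opEval_zero]
  | cons a l ih =>
    have h1 := ih hX (hY.contr a) px (py.contr a) (t + a.2)
    have h2 := ih (hX.contr a) hY (px.contr a) py t
    have ex : DiffFunctionAlgebra.sgn X = _ := px
    have ey : DiffFunctionAlgebra.sgn Y = _ := py
    have h3 := opEval_shift A.dl (-(t + lamSum (a :: l))) a.2 ((hX.contr a).br_mem hY l)
    rw [lamSum_cons, show -(t + (a.2 + lamSum l)) + a.2 = -(t + lamSum l) by ring] at h3
    simp only [br_cons, ex, ey, (hY.contr a).br_smul_right, (hX.contr a).br_smul_right,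
      Pi.smul_apply, h1, h2, opEval_add, opEval_neg, opEval_const_smul, lamSum_cons,
      neg_one_pow_mul_succ_succ, neg_one_pow_mul_succ, neg_one_pow_succ_mul, pow_succ, h3,
      show t + a.2 + lamSum l = t + (a.2 + lamSum l) by ring]
    -- All signs are products of (-1)^x, (-1)^y and (-1)^(xy); fixing the first two leaves a linear
    -- identity.
    rcases neg_one_pow_eq_or F x with hp | hp <;> rcases neg_one_pow_eq_or F y with hq | hq <;>
      rw [hp, hq] <;> module

/-- By sesquilinearity ∂ inside X acts as -(s + t), so -s - ∂ acts as the scalar t. -/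
theorem cat_opEval_left (h : A.Admissible X) {χ : F → V} (hχ : χ ∈ polyFun F V) (s t : F) :
    X [(opEval A.dl (-s) χ, s + t)] = X [(χ t, s + t)] := by
  induction hχ using induction with
  | const v => rw [opEval_const]
  | add φ hφ ψ hψ h1 h2 => rw [opEval_add, (h.conf []).map_add, h1, h2, ← (h.conf []).map_add]
  | smul φ hφ h1 =>
    have e : -s • opEval A.dl (-s) φ - A.dl (opEval A.dl (-s) φ)
        = -s • opEval A.dl (-s) φ + (-1 : F) • A.d (opEval A.dl (-s) φ) := by
      rw [neg_smul 1, one_smul, sub_eq_add_neg]; rfl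
    rw [opEval_smul _ _ hφ, e, (h.conf []).map_add, (h.conf []).map_smul, (h.conf []).map_smul,
      (h.conf []).map_d, h1, (h.conf []).map_smul]
    module

theorem apply_zero_cons (h : A.Admissible X) (t : F) (l : List (V × F)) : X ((0, t) :: l) = 0 := by
  have := (h.conf l).map_smul 0 0 t
  rwa [zero_smul, zero_smul] at this

theorem adj_eq_zero {x : ℕ} (px : HasParity x X) (hx : Even x) (s : F) (g : V) :
    A.adj X s g = 0 := by
  have h1 : ∀ a, X [a] = 0 := fun a => px.apply_eq_zero (hx.add_one)
  simp [adj, h1, opEval_zero]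

theorem adj_contr_zero (h : A.Admissible X) (r s : F) (g : V) :
    A.adj (DiffFunctionAlgebra.contr (0, r) X) s g = 0 := by
  simp [adj, contr_apply, h.apply_zero_cons, opEval_zero]

/-- The action on the scalar Z [] is the commutator formula `adj_br`. The terms where Z has one
argument match by sesquilinearity, and those where it has two match by alternation. -/
theorem br_jacobi_nil (hX : A.Admissible X) (hY : A.Admissible Y) (hZ : A.Admissible Z) {x y : ℕ}
    (px : HasParity x X) (py : HasParity y Y) (s t : F) :
    A.br s X (A.br t Y Z) [] - (-1 : F) ^ ((x + 1) * (y + 1)) • A.br t Y (A.br s X Z) []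
      = A.br (s + t) (A.br s X Y) Z [] := by
  have e1 : Z [(A.adj X s (Y []), s + t)] = Z [(X [(Y [], t)], s + t)] :=
    hZ.cat_opEval_left ((hX.conf []).mem _) s t
  have e2 : Z [(A.adj X s (Y []) - Y [(X [], s)], s + t)]
      = Z [(X [(Y [], t)], s + t)] - Z [(Y [(X [], s)], s + t)] := by
    have e : A.adj X s (Y []) - Y [(X [], s)] = A.adj X s (Y []) + (-1 : F) • Y [(X [], s)] := by
      rw [neg_one_smul, sub_eq_add_neg]
    rw [e, (hZ.conf []).map_add, (hZ.conf []).map_smul, e1, neg_one_smul, sub_eq_add_neg]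
  have e3 : ∀ {X : List (V × F) → V} (hX : A.Admissible X) s f g,
      A.adj X s (f - g) = A.adj X s f - A.adj X s g := fun hX s f g => by
    have e : f - g = f + (-1 : F) • g := by rw [neg_one_smul, sub_eq_add_neg]
    rw [e, (hX.isVect s).map_add, (hX.isVect s).map_smul, neg_one_smul, sub_eq_add_neg]
  have e4 : Z [(Y [], t), (X [], s)] = -Z [(X [], s), (Y [], t)] := hZ.swap _ _ _
  rw [br_nil A s X (A.br t Y Z), br_nil A t Y (A.br s X Z), br_nil A (s + t), br_nil A t Y Z, br_nil A s X Z, br_nil A s X Y,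
    br_cons, br_cons, hX.adj_br hY, e2, e3 hX, e3 hY]
  simp only [br_nil, contr_apply, sgn_nil, sgn_singleton, e4, add_comm t s]
  have a1 := (hX.isVect s).map_zero
  have a2 := (hY.isVect t).map_zero
  -- For odd parity the value at the empty list vanishes, for even parity the values on one argument
  -- do. The remaining terms agree once the sign is known.
  rcases Nat.even_or_odd x with hx | hx <;> rcases Nat.even_or_odd y with hy | hy
  · have b1 : ∀ a, X [a] = 0 := fun a => px.apply_eq_zero hx.add_one
    have b2 : ∀ a, Y [a] = 0 := fun a => py.apply_eq_zero hy.add_one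
    rw [(hx.add_one.mul hy.add_one).neg_one_pow]
    simp only [adj_eq_zero px hx, adj_eq_zero py hy, b1, b2, hZ.apply_zero_cons]
    module
  · have b1 : ∀ a, X [a] = 0 := fun a => px.apply_eq_zero hx.add_one
    have b2 : Y [] = 0 := py.apply_eq_zero hy
    have b3 : ∀ a b, Y [a, b] = 0 := fun a b => py.apply_eq_zero (hy.add_even even_two)
    rw [(hy.add_one.mul_left (x + 1)).neg_one_pow]
    have b4 : ∀ s g, A.adj (DiffFunctionAlgebra.contr (X [], s) Y) t g = 0 := fun s g => by
      simp [adj, contr_apply, b3, opEval_zero]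
    have b5 : ∀ s t g, A.adj (DiffFunctionAlgebra.contr (X [], s) Y) t g = 0 := fun s t g => by
      simp [adj, contr_apply, b3, opEval_zero]
    simp only [adj_eq_zero px hx, b1, b2, b5, hX.adj_contr_zero, hZ.apply_zero_cons,
      hY.apply_zero_cons, a2]
    have b6 : Z [(X [], s), (0, t)] = 0 := by rw [hZ.swap, hZ.apply_zero_cons, neg_zero]
    simp only [b6]
    module
  · have b1 : ∀ a, Y [a] = 0 := fun a => py.apply_eq_zero hy.add_one
    have b2 : X [] = 0 := px.apply_eq_zero hx
    have b3 : ∀ a b, X [a, b] = 0 := fun a b => px.apply_eq_zero (hx.add_even even_two)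
    rw [(hx.add_one.mul_right (y + 1)).neg_one_pow]
    have b5 : ∀ s t g, A.adj (DiffFunctionAlgebra.contr (Y [], s) X) t g = 0 := fun s t g => by
      simp [adj, contr_apply, b3, opEval_zero]
    simp only [adj_eq_zero py hy, b1, b2, b5, hY.adj_contr_zero, hZ.apply_zero_cons,
      hX.apply_zero_cons, a1]
    module
  · have b1 : Y [] = 0 := py.apply_eq_zero hy
    have b2 : X [] = 0 := px.apply_eq_zero hx
    rw [(hy.add_one.mul_left (x + 1)).neg_one_pow]
    simp only [b1, b2, hX.adj_contr_zero, hY.adj_contr_zero, hZ.apply_zero_cons,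
      hX.apply_zero_cons, hY.apply_zero_cons, a1, a2]
    module

/-- The Jacobi identity of the `λ`-bracket. -/
theorem br_jacobi (hX : A.Admissible X) (hY : A.Admissible Y) (hZ : A.Admissible Z) {x y : ℕ}
    (px : HasParity x X) (py : HasParity y Y) (s t : F) (l : List (V × F)) :
    A.br s X (A.br t Y Z) l - (-1 : F) ^ ((x + 1) * (y + 1)) • A.br t Y (A.br s X Z) l
      = A.br (s + t) (A.br s X Y) Z l := by
  induction l generalizing X Y Z x y s t with
  | nil => exact br_jacobi_nil hX hY hZ px py s t
  | cons a l ih =>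
    -- The new argument is absorbed by X, by Y or by Z; each possibility is one instance of the
    -- inductive hypothesis, with λ or μ shifted accordingly.
    have h1 := ih (hX.contr a) hY hZ.sgn (px.contr a) py (s + a.2) t
    have h2 := ih hX (hY.contr a) hZ.sgn px (py.contr a) s (t + a.2)
    have h3 := ih hX hY (hZ.contr a) px py s t
    have ex : DiffFunctionAlgebra.sgn X = _ := px
    have ey : DiffFunctionAlgebra.sgn Y = _ := py
    simp only [neg_one_pow_mul_succ_succ, neg_one_pow_mul_succ, neg_one_pow_succ_mul, pow_succ]
      at h1 h2 h3
    simp only [br_cons, contr_br, hX.br_add_right, hX.br_neg_right, hY.br_add_right,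
      hY.br_neg_right, hZ.sgn.br_add_left, hZ.sgn.br_neg_left, hY.sgn_br hZ, hX.sgn_br hZ,
      (hX.contr a).br_neg_right, (hY.contr a).br_neg_right, Pi.add_apply, Pi.neg_apply, ex, ey,
      hZ.sgn.br_smul_left, hZ.br_smul_left, (hX.contr a).br_smul_right, (hY.contr a).br_smul_right,
      Pi.smul_apply, neg_one_pow_mul_succ_succ]
    rw [show s + t + a.2 = s + a.2 + t by ring, ← h1, ← h3, show s + a.2 + t = s + (t + a.2) by ring,
      ← h2]
    rcases neg_one_pow_eq_or F x with hp | hp <;> rcases neg_one_pow_eq_or F y with hq | hq <;>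
      rw [hp, hq] <;> module

/-- The odd Leibniz rule. -/
theorem br_cat (hX : A.Admissible X) (hY : A.Admissible Y) (hZ : A.Admissible Z) {x y : ℕ}
    (px : HasParity x X) (py : HasParity y Y) (s : F) (l : List (V × F)) :
    A.br s X (cat Y Z) l = cat (A.br s X Y) Z l
      + (-1 : F) ^ ((x + 1) * y) • cat Y (A.br s X Z) l := by
  induction l generalizing X Y Z x y s with
  | nil =>
    simp only [br_nil, cat_nil, cat_cons, sgn_nil, contr_apply, (hX.isVect s).map_mul]
    -- With positive sign this is the product rule for `adj X s` and linearity of Y and Z. A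
    -- negative sign forces x even and y odd, so that `adj X s` and Y [] both vanish.
    rcases Nat.even_or_odd ((x + 1) * y) with h | h
    · rw [h.neg_one_pow]; simp only [one_smul]; ring
    · rw [Nat.odd_mul] at h
      have h1 : ∀ g, A.adj X s g = 0 := adj_eq_zero px (by grind) s
      have h2 : Y [] = 0 := py.apply_eq_zero h.2
      simp only [h1, h2]; ring_nf; simp
  | cons a l ih =>
    have h1 := ih (hX.contr a) hY hZ.sgn (px.contr a) py (s + a.2)
    have h2 := ih hX (hY.contr a) hZ.sgn px (py.contr a) s
    have h3 := ih hX hY (hZ.contr a) px py s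
    have ex : DiffFunctionAlgebra.sgn X = _ := px
    have ey : DiffFunctionAlgebra.sgn Y = _ := py
    simp only [neg_one_pow_mul_succ_succ, neg_one_pow_mul_succ, neg_one_pow_succ_mul, pow_succ]
      at h1 h2 h3
    simp only [br_cons, contr_cat, sgn_cat, hX.br_add_right, Pi.add_apply, h1, h2, h3, cat_cons,
      contr_br, cat_add_left, cat_add_right, cat_neg_left, cat_neg_right, Pi.neg_apply,
      hX.sgn_br hZ, ex, ey, cat_smul_left, cat_smul_right, Pi.smul_apply, hZ.sgn.br_smul_left,
      (hX.contr a).br_smul_right, neg_one_pow_succ_mul]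
    rcases neg_one_pow_eq_or F x with hp | hp <;> rcases neg_one_pow_eq_or F y with hq | hq <;>
      rw [hp, hq] <;> module

end Admissible

end DiffFunctionAlgebra

namespace DiffFunctionAlgebra

/-! ## Sums over shuffles -/

/-- The permutation sending `p` to `0` and acting as `τ` on the remaining elements. -/
def insertPerm {k : ℕ} (p : Fin (k + 1)) (τ : Equiv.Perm (Fin k)) : Equiv.Perm (Fin (k + 1)) :=
  Equiv.Perm.decomposeFin.symm (0, τ) * p.cycleRange

theorem insertPerm_self {k : ℕ} (p : Fin (k + 1)) (τ : Equiv.Perm (Fin k)) :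
    insertPerm p τ p = 0 := by
  simp [insertPerm]

theorem insertPerm_succAbove {k : ℕ} (p : Fin (k + 1)) (τ : Equiv.Perm (Fin k)) (x : Fin k) :
    insertPerm p τ (p.succAbove x) = (τ x).succ := by
  simp [insertPerm]

theorem sign_insertPerm {k : ℕ} (p : Fin (k + 1)) (τ : Equiv.Perm (Fin k)) :
    (Equiv.Perm.sign (insertPerm p τ) : ℤ) = (-1) ^ (p : ℕ) * Equiv.Perm.sign τ := by
  simp [insertPerm, Fin.sign_cycleRange, mul_comm]

theorem insertPerm_injective {k : ℕ} (p : Fin (k + 1)) :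
    Function.Injective (insertPerm p) := by
  intro τ τ' h
  have := Equiv.Perm.decomposeFin.symm.injective (mul_right_cancel h)
  simpa using this

theorem exists_insertPerm {k : ℕ} {p : Fin (k + 1)} {σ : Equiv.Perm (Fin (k + 1))} (h : σ p = 0) :
    ∃ τ, insertPerm p τ = σ := by
  obtain ⟨⟨q, τ⟩, hq⟩ := Equiv.Perm.decomposeFin.symm.surjective (σ * p.cycleRange⁻¹)
  have h0 : q = 0 := by
    have := congrArg (fun ρ : Equiv.Perm (Fin (k + 1)) => ρ 0) hq
    simp only [Equiv.Perm.decomposeFin_symm_apply_zero, Equiv.Perm.mul_apply] at this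
    have hz : p.cycleRange⁻¹ 0 = p := Fin.cycleRange_symm_zero p
    rw [this, hz, h]
  subst h0
  exact ⟨τ, by rw [insertPerm, hq, inv_mul_cancel_right]⟩

theorem mem_shuffles {a b k : ℕ} {e : a + b = k} {σ : Equiv.Perm (Fin k)} :
    σ ∈ shuffles e ↔ StrictMono (fst e σ) ∧ StrictMono (snd e σ) := by
  simp [shuffles]

theorem strictMono_cons_zero_succ {a k : ℕ} {g : Fin a → Fin k} {f : Fin (a + 1) → Fin (k + 1)}
    (h0 : f 0 = 0) (hs : ∀ j, f j.succ = (g j).succ) : StrictMono f ↔ StrictMono g := by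
  refine ⟨fun h i j hij => ?_, fun h i j => ?_⟩
  · have := h (Fin.succ_lt_succ_iff.mpr hij)
    rwa [hs, hs, Fin.succ_lt_succ_iff] at this
  · refine Fin.cases (fun hij => ?_) (fun i => ?_) i
    · obtain ⟨j, rfl⟩ := Fin.exists_succ_eq.mpr (Fin.pos_iff_ne_zero.mp hij)
      rw [h0, hs]; exact Fin.succ_pos _
    · refine Fin.cases (fun hij => ?_) (fun j hij => ?_) j
      · exact absurd hij (Fin.not_lt_zero _)
      · rw [hs, hs, Fin.succ_lt_succ_iff]
        exact h (Fin.succ_lt_succ_iff.mp hij)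

theorem strictMono_succ_comp {a k : ℕ} {g : Fin a → Fin k} {f : Fin a → Fin (k + 1)}
    (hs : ∀ j, f j = (g j).succ) : StrictMono f ↔ StrictMono g := by
  refine ⟨fun h i j hij => ?_, fun h i j hij => ?_⟩
  · have := h hij
    rwa [hs, hs, Fin.succ_lt_succ_iff] at this
  · rw [hs, hs, Fin.succ_lt_succ_iff]
    exact h hij

section recursion

variable {a b k : ℕ}

theorem fst_insertPerm_zero_zero (e : a + 1 + b = k + 1) (τ : Equiv.Perm (Fin k)) :
    fst e (insertPerm 0 τ) 0 = 0 := insertPerm_self 0 τ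

theorem fst_insertPerm_zero_succ (e : a + 1 + b = k + 1) (e' : a + b = k) (τ : Equiv.Perm (Fin k))
    (j : Fin a) : fst e (insertPerm 0 τ) j.succ = (fst e' τ j).succ :=
  insertPerm_succAbove 0 τ (Fin.cast e' (Fin.castAdd b j))

theorem snd_insertPerm_zero (e : a + 1 + b = k + 1) (e' : a + b = k) (τ : Equiv.Perm (Fin k))
    (j : Fin b) : snd e (insertPerm 0 τ) j = (snd e' τ j).succ := by
  rw [snd, snd, ← insertPerm_succAbove 0 τ]
  congr 1
  ext; simp; omega

theorem fst_insertPerm (e : a + (b + 1) = k + 1) (e' : a + b = k) (p : Fin (k + 1))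
    (hp : (p : ℕ) = a) (τ : Equiv.Perm (Fin k))
    (j : Fin a) : fst e (insertPerm p τ) j = (fst e' τ j).succ := by
  rw [fst, fst, ← insertPerm_succAbove p τ, Fin.succAbove_of_castSucc_lt]
  · rfl
  · rw [Fin.lt_def]; simp; omega

theorem snd_insertPerm_zero' (e : a + (b + 1) = k + 1) (p : Fin (k + 1))
    (hp : (p : ℕ) = a) (τ : Equiv.Perm (Fin k)) : snd e (insertPerm p τ) 0 = 0 := by
  rw [snd, ← insertPerm_self p τ]
  congr 1
  ext; simp [hp]

theorem snd_insertPerm_succ (e : a + (b + 1) = k + 1) (e' : a + b = k) (p : Fin (k + 1))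
    (hp : (p : ℕ) = a) (τ : Equiv.Perm (Fin k))
    (j : Fin b) : snd e (insertPerm p τ) j.succ = (snd e' τ j).succ := by
  rw [snd, snd, ← insertPerm_succAbove p τ, Fin.succAbove_of_le_castSucc]
  · congr 1
  · rw [Fin.le_def]; simp; omega

theorem insertPerm_zero_mem (e : a + 1 + b = k + 1) (e' : a + b = k) (τ : Equiv.Perm (Fin k)) :
    insertPerm 0 τ ∈ shuffles e ↔ τ ∈ shuffles e' := by
  rw [mem_shuffles, mem_shuffles,
    strictMono_cons_zero_succ (fst_insertPerm_zero_zero e τ) (fst_insertPerm_zero_succ e e' τ),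
    strictMono_succ_comp (snd_insertPerm_zero e e' τ)]

theorem insertPerm_mem (e : a + (b + 1) = k + 1) (e' : a + b = k) (p : Fin (k + 1))
    (hp : (p : ℕ) = a) (τ : Equiv.Perm (Fin k)) :
    insertPerm p τ ∈ shuffles e ↔ τ ∈ shuffles e' := by
  rw [mem_shuffles, mem_shuffles, strictMono_succ_comp (fst_insertPerm e e' p hp τ),
    strictMono_cons_zero_succ (snd_insertPerm_zero' e p hp τ) (snd_insertPerm_succ e e' p hp τ)]

/-- A shuffle increases along each block, so the smallest index opens the block that contains it. -/
theorem symm_zero_eq_of_lt {e : a + b = k + 1} {σ : Equiv.Perm (Fin (k + 1))} (h : σ ∈ shuffles e)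
    (hlt : (σ.symm 0 : ℕ) < a) : σ 0 = 0 := by
  obtain ⟨h1, _⟩ := mem_shuffles.mp h
  have ha : 0 < a := by omega
  have e1 : fst e σ ⟨σ.symm 0, hlt⟩ = 0 := by
    rw [fst]
    exact σ.apply_symm_apply 0
  have e2 : fst e σ ⟨0, ha⟩ = σ 0 := rfl
  rcases Nat.eq_zero_or_pos (σ.symm 0 : ℕ) with h0 | h0
  · rw [← e2, ← e1]; congr 2; exact h0.symm
  · have := h1 (show (⟨0, ha⟩ : Fin a) < ⟨σ.symm 0, hlt⟩ from h0)
    rw [e1] at this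
    exact absurd this (Fin.not_lt_zero _)

theorem symm_zero_eq_of_not_lt {e : a + b = k + 1} {σ : Equiv.Perm (Fin (k + 1))}
    (h : σ ∈ shuffles e) (hlt : ¬ (σ.symm 0 : ℕ) < a) (p : Fin (k + 1)) (hp : (p : ℕ) = a) :
    σ p = 0 := by
  obtain ⟨_, h1⟩ := mem_shuffles.mp h
  have hb' := (σ.symm 0).isLt
  have hb : 0 < b := by omega
  have hq : (σ.symm 0 : ℕ) - a < b := by omega
  have e1 : snd e σ ⟨(σ.symm 0 : ℕ) - a, hq⟩ = 0 := by
    rw [snd]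
    convert σ.apply_symm_apply 0 using 2
    ext; simp; omega
  have e2 : snd e σ ⟨0, hb⟩ = σ p := by
    rw [snd]; congr 1; ext; simp [hp]
  rcases Nat.eq_zero_or_pos ((σ.symm 0 : ℕ) - a) with h0 | h0
  · rw [← e2, ← e1]; congr 2; exact h0.symm
  · have := h1 (show (⟨0, hb⟩ : Fin b) < ⟨(σ.symm 0 : ℕ) - a, hq⟩ from h0)
    rw [e1] at this
    exact absurd this (Fin.not_lt_zero _)

variable {M : Type*} [AddCommMonoid M]

theorem sum_shuffles_lt (e : a + 1 + b = k + 1) (e' : a + b = k)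
    (f : Equiv.Perm (Fin (k + 1)) → M) :
    ∑ σ ∈ (shuffles e).filter (fun σ => (σ.symm 0 : ℕ) < a + 1), f σ
      = ∑ τ ∈ shuffles e', f (insertPerm 0 τ) := by
  symm
  refine Finset.sum_bij (fun τ _ => insertPerm 0 τ) (fun τ hτ => ?_)
    (fun τ _ τ' _ h => insertPerm_injective 0 h) (fun σ hσ => ?_) (fun _ _ => rfl)
  · rw [Finset.mem_filter]
    refine ⟨(insertPerm_zero_mem e e' τ).mpr hτ, ?_⟩
    have : (insertPerm 0 τ).symm 0 = 0 := by rw [Equiv.symm_apply_eq, insertPerm_self]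
    rw [this]; simp
  · rw [Finset.mem_filter] at hσ
    obtain ⟨τ, rfl⟩ := exists_insertPerm (symm_zero_eq_of_lt hσ.1 hσ.2)
    exact ⟨τ, (insertPerm_zero_mem e e' τ).mp hσ.1, rfl⟩

theorem sum_shuffles_not_lt (e : a + (b + 1) = k + 1) (e' : a + b = k) (p : Fin (k + 1))
    (hp : (p : ℕ) = a) (f : Equiv.Perm (Fin (k + 1)) → M) :
    ∑ σ ∈ (shuffles e).filter (fun σ => ¬ (σ.symm 0 : ℕ) < a), f σ
      = ∑ τ ∈ shuffles e', f (insertPerm p τ) := by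
  symm
  refine Finset.sum_bij (fun τ _ => insertPerm p τ) (fun τ hτ => ?_)
    (fun τ _ τ' _ h => insertPerm_injective p h) (fun σ hσ => ?_) (fun _ _ => rfl)
  · rw [Finset.mem_filter]
    refine ⟨(insertPerm_mem e e' p hp τ).mpr hτ, ?_⟩
    have : (insertPerm p τ).symm 0 = p := by rw [Equiv.symm_apply_eq, insertPerm_self]
    rw [this, hp]; simp
  · rw [Finset.mem_filter] at hσ
    obtain ⟨τ, rfl⟩ := exists_insertPerm (symm_zero_eq_of_not_lt hσ.1 hσ.2 p hp)
    exact ⟨τ, (insertPerm_mem e e' p hp τ).mp hσ.1, rfl⟩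

end recursion

variable {K M : Type*} [AddCommGroup M]

/-- The sum over all ways to split a list into two complementary sublists, with the sign of the
corresponding shuffle. -/
def splitSum : (List K → List K → M) → List K → M
  | G, [] => G [] []
  | G, a :: l => splitSum (fun p q => G (a :: p) q) l
      + splitSum (fun p q => (-1 : ℤ) ^ p.length • G p (a :: q)) l

/-- The sum over the shuffles with given block sizes. -/
def blockSum {a b k : ℕ} (e : a + b = k) (G : List K → List K → M) (v : Fin k → K) : M :=
  ∑ σ ∈ shuffles e, (Equiv.Perm.sign σ : ℤ) •
    G (List.ofFn (v ∘ fst e σ)) (List.ofFn (v ∘ snd e σ))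

/-- The shuffles are divided according to the block containing the first index. Deleting that index
leaves a shuffle of the others. The sign is unchanged if it opened the first block; if it opened the
second, it had to pass the h entries of the first. -/
theorem sum_blockSum (k : ℕ) (G : List K → List K → M) (v : Fin k → K) :
    ∑ h : Fin (k + 1), blockSum (Nat.add_sub_cancel' (Nat.le_of_lt_succ h.isLt)) G v
      = splitSum G (List.ofFn v) := by
  induction k generalizing G with
  | zero =>
    simp only [Nat.reduceAdd, Finset.univ_unique, Finset.sum_singleton, List.ofFn_zero, splitSum]
    rw [blockSum, Finset.sum_eq_single 1]
    · simp
    · intro σ _ h; exact absurd (Subsingleton.elim _ _) h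
    · intro h
      refine absurd (mem_shuffles.mpr ⟨fun i => ?_, fun i => ?_⟩) h
      · exact absurd i.isLt (by simp)
      · exact absurd i.isLt (by simp)
  | succ k ih =>
    set A : Fin (k + 2) → M := fun h =>
      ∑ σ ∈ (shuffles (Nat.add_sub_cancel' (Nat.le_of_lt_succ h.isLt))).filter
        (fun σ => (σ.symm 0 : ℕ) < h), (Equiv.Perm.sign σ : ℤ) •
        G (List.ofFn (v ∘ fst (Nat.add_sub_cancel' (Nat.le_of_lt_succ h.isLt)) σ))
          (List.ofFn (v ∘ snd (Nat.add_sub_cancel' (Nat.le_of_lt_succ h.isLt)) σ)) with hA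
    set B : Fin (k + 2) → M := fun h =>
      ∑ σ ∈ (shuffles (Nat.add_sub_cancel' (Nat.le_of_lt_succ h.isLt))).filter
        (fun σ => ¬ (σ.symm 0 : ℕ) < h), (Equiv.Perm.sign σ : ℤ) •
        G (List.ofFn (v ∘ fst (Nat.add_sub_cancel' (Nat.le_of_lt_succ h.isLt)) σ))
          (List.ofFn (v ∘ snd (Nat.add_sub_cancel' (Nat.le_of_lt_succ h.isLt)) σ)) with hB
    have hAB : ∀ h : Fin (k + 2),
        blockSum (Nat.add_sub_cancel' (Nat.le_of_lt_succ h.isLt)) G v = A h + B h :=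
      fun h => (Finset.sum_filter_add_sum_filter_not _ _ _).symm
    have hA0 : A 0 = 0 := by
      refine Finset.sum_eq_zero fun σ hσ => ?_
      simp at hσ
    have hBl : B (Fin.last _) = 0 := by
      refine Finset.sum_eq_zero fun σ hσ => ?_
      have h1 := (Finset.mem_filter.mp hσ).2
      exact absurd (σ.symm 0).isLt h1
    simp only [hAB, Finset.sum_add_distrib]
    -- An empty block cannot contain the first index. Dropping these two extreme terms leaves two
    -- sums over k + 1 block sizes, matching the two branches of `splitSum`.
    rw [Fin.sum_univ_succ A, hA0, zero_add, Fin.sum_univ_castSucc B, hBl, add_zero, List.ofFn_succ,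
      splitSum, ← ih, ← ih]
    congr 1
    · refine Finset.sum_congr rfl fun h _ => ?_
      have hk : (h : ℕ) + (k - h) = k := Nat.add_sub_cancel' (Nat.le_of_lt_succ h.isLt)
      have key : ∀ b (e : (h : ℕ) + 1 + b = k + 1) (e' : (h : ℕ) + b = k),
          (∑ σ ∈ (shuffles e).filter (fun σ => (σ.symm 0 : ℕ) < (h : ℕ) + 1),
            (Equiv.Perm.sign σ : ℤ) • G (List.ofFn (v ∘ fst e σ)) (List.ofFn (v ∘ snd e σ)))
          = blockSum e' (fun p q => G (v 0 :: p) q) fun i => v i.succ := by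
        intro b e e'
        rw [sum_shuffles_lt e e', blockSum]
        refine Finset.sum_congr rfl fun τ _ => ?_
        have h1 : List.ofFn (v ∘ fst e (insertPerm 0 τ))
            = v 0 :: List.ofFn ((fun i => v i.succ) ∘ fst e' τ) := by
          rw [List.ofFn_succ]
          simp only [Function.comp, fst_insertPerm_zero_zero, fst_insertPerm_zero_succ e e']
          rfl
        have h2 : v ∘ snd e (insertPerm 0 τ) = (fun i => v i.succ) ∘ snd e' τ := by
          funext j; simp only [Function.comp, snd_insertPerm_zero e e']
        rw [sign_insertPerm, h1, h2]; simp
      have hb : k + 1 - (h.succ : ℕ) = k - h := by simp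
      have e1 : (h : ℕ) + 1 + (k + 1 - (h.succ : ℕ)) = k + 1 := by simp; omega
      have := key _ e1 (by omega)
      refine Eq.trans this ?_
      congr 1
    · refine Finset.sum_congr rfl fun h _ => ?_
      have key : ∀ b b' (hb : b = b' + 1) (e : (h : ℕ) + b = k + 1) (e' : (h : ℕ) + b' = k),
          (∑ σ ∈ (shuffles e).filter (fun σ => ¬ (σ.symm 0 : ℕ) < (h : ℕ)),
            (Equiv.Perm.sign σ : ℤ) • G (List.ofFn (v ∘ fst e σ)) (List.ofFn (v ∘ snd e σ)))
          = blockSum e' (fun p q => (-1 : ℤ) ^ p.length • G p (v 0 :: q)) fun i => v i.succ := by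
        rintro b b' rfl e e'
        rw [sum_shuffles_not_lt e e' h rfl, blockSum]
        refine Finset.sum_congr rfl fun τ _ => ?_
        have h1 : List.ofFn (v ∘ snd e (insertPerm h τ))
            = v 0 :: List.ofFn ((fun i => v i.succ) ∘ snd e' τ) := by
          rw [List.ofFn_succ]
          simp only [Function.comp, snd_insertPerm_zero' e h rfl, snd_insertPerm_succ e e' h rfl]
          rfl
        have h2 : v ∘ fst e (insertPerm h τ) = (fun i => v i.succ) ∘ fst e' τ := by
          funext j; simp only [Function.comp, fst_insertPerm e e' h rfl]
        rw [sign_insertPerm, h1, h2, List.length_ofFn, mul_comm, mul_smul]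
      have hlt := Nat.le_of_lt_succ h.isLt
      exact key _ (k - h) (by simp; omega) _ _

theorem splitSum_congr {G G' : List K → List K → M} {l : List K}
    (h : ∀ p q, p.length + q.length = l.length → G p q = G' p q) :
    splitSum G l = splitSum G' l := by
  induction l generalizing G G' with
  | nil => exact h [] [] rfl
  | cons a l ih =>
    rw [splitSum, splitSum]
    congr 1
    · exact ih fun p q hpq => h _ _ (by simp [← hpq]; omega)
    · exact ih fun p q hpq => by rw [h _ _ (by simp [← hpq]; omega)]

theorem splitSum_neg (G : List K → List K → M) (l : List K) :
    splitSum (fun p q => -G p q) l = -splitSum G l := by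
  induction l generalizing G with
  | nil => rfl
  | cons a l ih => simp only [splitSum, ih, smul_neg, neg_add]

end DiffFunctionAlgebra

/-! ### Agreement of the recursive operations with the sums over shuffles. -/

namespace DiffFunctionAlgebra

open PolyFun MvPolynomial

theorem blockSum_congr {K M : Type*} [AddCommGroup M] {a b a' b' k : ℕ} {e : a + b = k}
    {e' : a' + b' = k} (ha : a = a') {G G' : List K → List K → M}
    (h : ∀ p q, p.length = a → q.length = b → G p q = G' p q) (v : Fin k → K) :
    blockSum e G v = blockSum e' G' v := by
  subst ha
  obtain rfl : b = b' := by omega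
  exact Finset.sum_congr rfl fun σ _ => by rw [h _ _ (by simp) (by simp)]

theorem sum_blockSum_rev {K M : Type*} [AddCommGroup M] (k : ℕ) (G : List K → List K → M)
    (v : Fin k → K) :
    ∑ h : Fin (k + 1), blockSum (Nat.sub_add_cancel (Nat.le_of_lt_succ h.isLt)) G v
      = splitSum G (List.ofFn v) := by
  rw [← sum_blockSum, ← Equiv.sum_comp Fin.revPerm]
  refine Finset.sum_congr rfl fun h _ => blockSum_congr ?_ (fun _ _ _ _ => rfl) v
  rw [Fin.revPerm_apply, Fin.val_rev]
  have := h.isLt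
  omega

variable {F V I : Type*} [Field F] [CommRing V] [Algebra F V]

theorem neg_one_pow_zsmul (n : ℕ) (v : V) : ((-1 : ℤ) ^ n) • v = (-1 : F) ^ n • v := by
  rcases neg_one_pow_eq_or ℤ n with h | h <;> rcases Nat.even_or_odd n with hn | hn <;>
    simp [hn.neg_one_pow]

theorem cat_eq_splitSum (X Y : List (V × F) → V) (l : List (V × F)) :
    cat X Y l = splitSum (fun p q => (-1 : ℤ) ^ (q.length * p.length) • (X p * Y q)) l := by
  induction l generalizing X Y with
  | nil => simp [cat_nil, splitSum]
  | cons a l ih =>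
    rw [cat_cons, ih, ih, splitSum]
    congr 1
    · refine splitSum_congr fun p q _ => ?_
      rw [List.length_cons, mul_add, mul_one, pow_add, sgn, mul_smul_comm,
        ← neg_one_pow_zsmul q.length, smul_smul]
      rfl
    · refine splitSum_congr fun p q _ => ?_
      rw [List.length_cons, smul_smul, ← pow_add, add_mul, one_mul,
        show p.length + (q.length * p.length + p.length)
          = q.length * p.length + (p.length + p.length) by ring, pow_add _ (q.length * p.length),
        (Even.add_self p.length).neg_one_pow, mul_one]
      rfl

/-- Both sides obey the same recursion: the head of the list belongs to the inner cochain when it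
joins the first block and to the outer one otherwise. In the latter case alternation moves it to the
front of the outer cochain, at the cost of one sign. -/
theorem br_eq_splitSum [Infinite F] [Fintype I] {A : DiffFunctionAlgebra F V I}
    {X Y : List (V × F) → V} (hX : A.Admissible X) (hY : A.Admissible Y) (s : F)
    (l : List (V × F)) :
    A.br s X Y l = splitSum (fun p q =>
        opEval A.dl (-s - lamSum q) fun r => X ((Y p, r) :: q)) l
      - splitSum (fun p q => (-1 : ℤ) ^ (q.length * (p.length + 1)) •
          Y ((X p, s + lamSum l - lamSum q) :: q)) l := by
  induction l generalizing X Y s with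
  | nil => simp [br_nil, splitSum, lamSum_nil, adj]
  | cons a l ih =>
    rw [br_cons, ih (hX.contr a) hY.sgn, ih hX (hY.contr a), splitSum, splitSum]
    have e1 : splitSum (fun p q => (-1 : ℤ) ^ p.length •
        opEval A.dl (-s - lamSum (a :: q)) fun r => X ((Y p, r) :: a :: q)) l
        = -splitSum (fun p q => opEval A.dl (-(s + a.2) - lamSum q) fun r =>
          contr a X ((sgn Y p, r) :: q)) l := by
      rw [← splitSum_neg]
      refine splitSum_congr fun p q _ => ?_
      have h1 : ∀ r, contr a X ((sgn Y p, r) :: q)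
          = -((-1 : F) ^ p.length • X ((Y p, r) :: a :: q)) := fun r => by
        rw [contr_apply, hX.swap, sgn, (hX.conf _).map_smul]
      simp only [h1, opEval_neg, opEval_const_smul, neg_neg, neg_one_pow_zsmul (F := F), lamSum_cons]
      congr 3; ring
    have e2 : splitSum (fun p q => (-1 : ℤ) ^ (q.length * ((a :: p).length + 1)) •
          Y ((X (a :: p), s + lamSum (a :: l) - lamSum q) :: q)) l
        = -splitSum (fun p q => (-1 : ℤ) ^ (q.length * (p.length + 1)) •
          sgn Y ((contr a X p, s + a.2 + lamSum l - lamSum q) :: q)) l := by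
      rw [← splitSum_neg]
      refine splitSum_congr fun p q _ => ?_
      rw [sgn, ← neg_one_pow_zsmul, smul_smul, ← pow_add, ← neg_smul, lamSum_cons, contr_apply]
      congr 1
      · simp only [List.length_cons]
        rw [show q.length * (p.length + 1 + 1) = q.length * (p.length + 1) + q.length by ring,
          ← add_assoc, pow_succ _ (q.length * (p.length + 1) + q.length)]
        simp
      · congr 3; ring
    have e3 : splitSum (fun p q => (-1 : ℤ) ^ p.length • (-1 : ℤ) ^ ((a :: q).length *
          (p.length + 1)) • Y ((X p, s + lamSum (a :: l) - lamSum (a :: q)) :: a :: q)) l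
        = splitSum (fun p q => (-1 : ℤ) ^ (q.length * (p.length + 1)) •
          contr a Y ((X p, s + lamSum l - lamSum q) :: q)) l := by
      refine splitSum_congr fun p q _ => ?_
      rw [contr_apply, hY.swap a, lamSum_cons, lamSum_cons, smul_neg, smul_smul, ← neg_smul,
        show s + (a.2 + lamSum l) - (a.2 + lamSum q) = s + lamSum l - lamSum q by ring]
      congr 1
      rw [List.length_cons, ← pow_add,
        show p.length + (q.length + 1) * (p.length + 1)
          = q.length * (p.length + 1) + 1 + (p.length + p.length) by ring, pow_add,
        (Even.add_self p.length).neg_one_pow, mul_one, pow_succ, mul_neg_one]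
    rw [e1, e2, e3]
    simp only [contr_apply]
    abel

namespace Admissible

variable [Fintype I] {A : DiffFunctionAlgebra F V I} {X : List (V × F) → V}

theorem map_add (h : A.Admissible X) (f g : V) (r : F) (l : List (V × F)) :
    X ((f + g, r) :: l) = X ((f, r) :: l) + X ((g, r) :: l) := (h.conf l).map_add f g r

theorem map_smul (h : A.Admissible X) (c : F) (f : V) (r : F) (l : List (V × F)) :
    X ((c • f, r) :: l) = c • X ((f, r) :: l) := (h.conf l).map_smul c f r

end Admissible

/-! ### Evaluation of the frozen formulas -/

section eval

variable (A : DiffFunctionAlgebra F V I) {τ : Type*}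

theorem evalAt_coeffD (t : τ → F) (P : MvPolynomial τ V) :
    evalAt t (A.coeffD τ P) = A.d (evalAt t P) := by
  induction P using MvPolynomial.induction_on with
  | C v => rw [coeffD_C, evalAt_C, evalAt_C]
  | add p q hp hq => simp only [map_add, hp, hq]
  | mul_X p i hp => rw [coeffD_mul_X, evalAt_mul_X, evalAt_mul_X, hp, Derivation.map_smul]

theorem evalAt_rename {τ' : Type*} (t : τ' → F) (f : τ → τ') (P : MvPolynomial τ V) :
    evalAt t (rename f P) = evalAt (t ∘ f) P := by
  rw [evalAt, aeval_rename]; rfl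

theorem evalAt_totalD {n : ℕ} (t : Fin n → F) (P : MvPolynomial (Fin n) V) :
    evalAt t (A.totalD n P) = A.opd (∑ i, t i) (evalAt t P) := by
  rw [totalD, LinearMap.add_apply, map_add, LinearMap.mulLeft_apply, map_mul, map_sum,
    evalAt_coeffD, opd_apply, Algebra.smul_def, map_sum]
  simp only [evalAt_X]

theorem moveLeft_C (P : MvPolynomial τ V) : A.moveLeft τ (Polynomial.C P) = P := by
  rw [moveLeft, Polynomial.lsum_apply, Polynomial.sum_C_index (by simp)]; simp

theorem moveLeft_mul_X (Q : Polynomial (MvPolynomial τ V)) :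
    A.moveLeft τ (Q * Polynomial.X) = A.coeffD τ (A.moveLeft τ Q) := by
  induction Q using Polynomial.induction_on' with
  | add p q hp hq => simp only [add_mul, map_add, hp, hq]
  | monomial n v =>
    rw [Polynomial.monomial_mul_X, moveLeft, Polynomial.lsum_apply, Polynomial.lsum_apply,
      Polynomial.sum_monomial_index _ _ (by simp), Polynomial.sum_monomial_index _ _ (by simp),
      pow_succ', Module.End.mul_apply]

/-- Polynomials in the `λ`'s with constant coefficients. -/
def IsConst (α : MvPolynomial τ V) : Prop :=
  ∀ P : MvPolynomial τ V, A.coeffD τ (P * α) = A.coeffD τ P * α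

theorem isConst_X (i : τ) : A.IsConst (X i) := A.coeffD_mul_X i

variable {A}

theorem IsConst.add {α β : MvPolynomial τ V} (h : A.IsConst α) (h' : A.IsConst β) :
    A.IsConst (α + β) := fun P => by rw [mul_add, map_add, h, h', mul_add]

theorem IsConst.neg {α : MvPolynomial τ V} (h : A.IsConst α) : A.IsConst (-α) := fun P => by
  rw [mul_neg, map_neg, h, mul_neg]

theorem IsConst.sub {α β : MvPolynomial τ V} (h : A.IsConst α) (h' : A.IsConst β) :
    A.IsConst (α - β) := sub_eq_add_neg α β ▸ h.add h'.neg

theorem isConst_zero : A.IsConst (0 : MvPolynomial τ V) := fun P => by simp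

theorem IsConst.sum {ι : Type*} (s : Finset ι) {α : ι → MvPolynomial τ V}
    (h : ∀ i, A.IsConst (α i)) : A.IsConst (∑ i ∈ s, α i) := by
  classical
  induction s using Finset.induction_on with
  | empty => exact isConst_zero
  | insert a s ha ih => rw [Finset.sum_insert ha]; exact (h a).add ih

theorem moveLeft_mul_C {α : MvPolynomial τ V} (h : A.IsConst α)
    (Q : Polynomial (MvPolynomial τ V)) :
    A.moveLeft τ (Q * Polynomial.C α) = A.moveLeft τ Q * α := by
  induction Q using Polynomial.induction_on' with
  | add p q hp hq => simp only [add_mul, map_add, hp, hq]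
  | monomial n v =>
    rw [Polynomial.monomial_mul_C, moveLeft, Polynomial.lsum_apply, Polynomial.lsum_apply,
      Polynomial.sum_monomial_index _ _ (by simp), Polynomial.sum_monomial_index _ _ (by simp)]
    induction n with
    | zero => simp
    | succ n ih => rw [pow_succ', Module.End.mul_apply, ih, h, Module.End.mul_apply]

/-- Every substitution in the box products sends each variable either to a polynomial with constant
coefficients or to one fixed expression α - ∂. `ρ r` evaluates the former and leaves the latter
equal to r, so that `opEval` performs the last substitution. -/
theorem evalAt_moveLeft_aeval [Infinite F] {ι : Type*} {t : τ → F} {α : MvPolynomial τ V}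
    (hα : A.IsConst α) {c : F} (hc : evalAt t α = algebraMap F V c)
    {g : ι → Polynomial (MvPolynomial τ V)} {ρ : F → ι → F}
    (hg : ∀ i, (g i = Polynomial.C α - Polynomial.X ∧ ∀ r, ρ r i = r) ∨
      ∃ β b, A.IsConst β ∧ g i = Polynomial.C β ∧ evalAt t β = algebraMap F V b ∧ ∀ r, ρ r i = b)
    (P : MvPolynomial ι V) :
    (fun r => evalAt (ρ r) P) ∈ polyFun F V ∧
    evalAt t (A.moveLeft τ (aeval g P)) = opEval A.dl c fun r => evalAt (ρ r) P := by
  induction P using MvPolynomial.induction_on with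
  | C v =>
    simp only [evalAt_C, opEval_const, algHom_C]
    refine ⟨const_mem v, ?_⟩
    have : algebraMap V (Polynomial (MvPolynomial τ V)) v = Polynomial.C (C v) := rfl
    rw [this, moveLeft_C, evalAt_C]; rfl
  | add p q hp hq =>
    simp only [map_add, opEval_add, hp.2, hq.2, and_true]
    exact PolyFun.add_mem' hp.1 hq.1
  | mul_X p i hp =>
    simp only [map_mul, aeval_X, evalAt_mul_X]
    simp only [← map_mul, evalAt_mul_X]
    rcases hg i with ⟨h1, h2⟩ | ⟨β, b, h1, h2, h3, h4⟩
    · simp only [h2]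
      refine ⟨PolyFun.smul_mem' hp.1, ?_⟩
      rw [h1, mul_sub, map_sub, moveLeft_mul_C hα, moveLeft_mul_X, map_sub, map_mul,
        evalAt_coeffD, hp.2, hc, opEval_smul _ _ hp.1, mul_comm, ← Algebra.smul_def]
      rfl
    · simp only [h4]
      refine ⟨const_smul_mem b hp.1, ?_⟩
      rw [h2, moveLeft_mul_C h1, map_mul, hp.2, h3, opEval_const_smul, mul_comm,
        ← Algebra.smul_def]

/-- In a box product the outer cochain acts on the coefficients of the inner one. Once the λ's are
scalars of F, F-linearity lets it act on the value instead. -/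
theorem sum_support_eq (t : τ → F) (P : MvPolynomial τ V) {ψ : V → V}
    (h1 : ∀ f g, ψ (f + g) = ψ f + ψ g) (h2 : ∀ (r : F) f, ψ (r • f) = r • ψ f) :
    ∑ β ∈ P.support, evalAt t (monomial β (1 : V)) * ψ (P.coeff β) = ψ (evalAt t P) := by
  have h0 : ψ 0 = 0 := by simpa using h2 0 0
  let T : V →ₗ[F] V := ⟨⟨ψ, h1⟩, h2⟩
  change ∑ β ∈ P.support, _ * T (P.coeff β) = T (evalAt t P)
  conv_rhs => rw [P.as_sum, map_sum, map_sum]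
  refine Finset.sum_congr rfl fun β _ => ?_
  have e : ∀ v : V, evalAt t (monomial β v)
      = (β.prod fun i n => t i ^ n) • v := fun v => by
    rw [evalAt, aeval_monomial, Algebra.smul_def, mul_comm]
    congr 1
    simp only [Finsupp.prod, map_prod, map_pow]
  rw [e, e, T.map_smul, smul_mul_assoc, one_mul]

/-- Lists of arguments and values. -/
def zipFn {k : ℕ} (v : Fin k → V) (t : Fin k → F) : Fin k → V × F := fun i => (v i, t i)

theorem toList_zipFn (Z : ∀ n, A.Coch n) {n : ℕ} (v : Fin n → V) (t : Fin n → F) :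
    toList Z (List.ofFn (zipFn v t)) = evalAt t (Z n v) := toList_ofFn Z _

theorem zipFn_comp {k m : ℕ} (v : Fin k → V) (t : Fin k → F) (f : Fin m → Fin k) :
    zipFn v t ∘ f = zipFn (v ∘ f) (t ∘ f) := rfl

theorem lamSum_ofFn_zipFn {k : ℕ} (v : Fin k → V) (t : Fin k → F) :
    lamSum (List.ofFn (zipFn v t)) = ∑ i, t i := by
  rw [lamSum, List.map_ofFn, List.sum_ofFn]; rfl

theorem toList_cons_zipFn (Z : ∀ n, A.Coch n) {n : ℕ} (g : V) (r : F) (v : Fin n → V)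
    (t : Fin n → F) : toList Z ((g, r) :: List.ofFn (zipFn v t))
      = evalAt (Fin.cons r t) (Z (n + 1) (Fin.cons g v)) := by
  have : (g, r) :: List.ofFn (zipFn v t)
      = List.ofFn (zipFn (Fin.cons g v : Fin (n + 1) → V) (Fin.cons r t)) := by
    rw [List.ofFn_succ]; rfl
  rw [this, toList_zipFn]

/-- The common evaluation of all box products. -/
theorem evalAt_shuffleBox [Infinite F] {h m k : ℕ} (e : m + h = k) (ν : Fin k → τ) (t : τ → F)
    {θ : Equiv.Perm (Fin k) → Polynomial (MvPolynomial τ V)} {X : A.Coch (h + 1)} (Y : A.Coch m)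
    (v : Fin k → V) {Φ : Equiv.Perm (Fin k) → V → V}
    (hΦ : ∀ σ g, evalAt t (A.moveLeft τ (aeval
          (Fin.cons (θ σ) (fun j => Polynomial.C (MvPolynomial.X (ν (snd e σ j)))) :
            Fin (h + 1) → Polynomial (MvPolynomial τ V))
          (X (Fin.cons g (v ∘ snd e σ) : Fin (h + 1) → V)))) = Φ σ g)
    (h1 : ∀ σ f g, Φ σ (f + g) = Φ σ f + Φ σ g) (h2 : ∀ σ (r : F) f, Φ σ (r • f) = r • Φ σ f) :
    evalAt t (A.shuffleBox e ν θ X Y v) = ∑ σ ∈ shuffles e, (Equiv.Perm.sign σ : ℤ) •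
      Φ σ (evalAt ((t ∘ ν) ∘ fst e σ) (Y (v ∘ fst e σ))) := by
  rw [shuffleBox, map_sum]
  refine Finset.sum_congr rfl fun σ _ => ?_
  rw [map_zsmul, map_sum]
  congr 1
  rw [← sum_support_eq _ _ (h1 σ) (h2 σ)]
  refine Finset.sum_congr rfl fun β _ => ?_
  rw [map_mul, hΦ, evalAt_rename]
  rfl

/-- The point with `λ = s` and `λ_i = t_i`. -/
def optPt {k : ℕ} (s : F) (t : Fin k → F) : Option (Fin k) → F := fun o => o.elim s t

variable [Infinite F] [Fintype I]

/-- Only linearity of X in its first argument is assumed, so the formula is available before an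
element of the prolongation is known to be admissible. -/
theorem evalAt_boxLam {h m k : ℕ} (e : m + h = k) {X Y : ∀ n, A.Coch n}
    (h1 : ∀ f g r l, toList X ((f + g, r) :: l) = toList X ((f, r) :: l) + toList X ((g, r) :: l))
    (h2 : ∀ (c : F) f r l, toList X ((c • f, r) :: l) = c • toList X ((f, r) :: l)) (v : Fin k → V) (s : F) (t : Fin k → F) :
    evalAt (optPt s t) (A.boxLam e (X (h + 1)) (Y m) v)
      = blockSum e (fun p q => opEval A.dl (-s - lamSum q) fun r =>
          toList X ((toList Y p, r) :: q)) (zipFn v t) := by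
  rw [boxLam, evalAt_shuffleBox (Φ := fun σ g =>
    opEval A.dl (-s - lamSum (List.ofFn (zipFn v t ∘ snd e σ))) fun r =>
      toList X ((g, r) :: List.ofFn (zipFn v t ∘ snd e σ)))]
  · refine Finset.sum_congr rfl fun σ _ => ?_
    have e1 : toList Y (List.ofFn (zipFn v t ∘ fst e σ))
        = evalAt ((optPt s t ∘ some) ∘ fst e σ) (Y m (v ∘ fst e σ)) := by
      rw [zipFn_comp, toList_zipFn]; rfl
    beta_reduce
    rw [e1]
  · intro σ g
    simp only [zipFn_comp, toList_cons_zipFn, lamSum_ofFn_zipFn]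
    refine (evalAt_moveLeft_aeval
      (α := -MvPolynomial.X none - ∑ j, MvPolynomial.X (some (snd e σ j))) ?_ ?_ ?_ _).2
    · exact (A.isConst_X _).neg.sub (IsConst.sum _ fun j => A.isConst_X _)
    · simp only [map_sub, map_neg, evalAt_X, map_sum]; rfl
    · intro i
      refine Fin.cases (Or.inl ⟨?_, fun r => rfl⟩) (fun j => Or.inr ?_) i
      · simp only [Fin.cons_zero, map_sub, map_neg, map_sum]
      · exact ⟨_, t (snd e σ j), A.isConst_X _, rfl, by rw [evalAt_X]; rfl, fun r => rfl⟩
  · intro σ f g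
    simp only [h1, opEval_add]
  · intro σ r f
    simp only [h2, opEval_const_smul]

theorem evalAt_boxL {h m k : ℕ} (e : m + h = k) {X Y : ∀ n, A.Coch n}
    (hX : A.Admissible (toList X)) (v : Fin k → V) (t : Fin k → F) :
    evalAt t (A.boxL e (X (h + 1)) (Y m) v)
      = blockSum e (fun p q => opEval A.dl (- lamSum q) fun r =>
          toList X ((toList Y p, r) :: q)) (zipFn v t) := by
  rw [boxL, evalAt_shuffleBox (Φ := fun σ g =>
    opEval A.dl (- lamSum (List.ofFn (zipFn v t ∘ snd e σ))) fun r =>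
      toList X ((g, r) :: List.ofFn (zipFn v t ∘ snd e σ)))]
  · refine Finset.sum_congr rfl fun σ _ => ?_
    have e1 : toList Y (List.ofFn (zipFn v t ∘ fst e σ))
        = evalAt ((t ∘ id) ∘ fst e σ) (Y m (v ∘ fst e σ)) := by
      rw [zipFn_comp, toList_zipFn]; rfl
    beta_reduce
    rw [e1]
  · intro σ g
    simp only [zipFn_comp, toList_cons_zipFn, lamSum_ofFn_zipFn]
    refine (evalAt_moveLeft_aeval
      (α := - ∑ j, MvPolynomial.X (snd e σ j)) ?_ ?_ ?_ _).2
    · exact (IsConst.sum _ fun j => A.isConst_X _).neg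
    · simp only [map_neg, evalAt_X, map_sum]; rfl
    · intro i
      refine Fin.cases (Or.inl ⟨?_, fun r => rfl⟩) (fun j => Or.inr ?_) i
      · simp only [Fin.cons_zero, map_neg, map_sum]
      · exact ⟨_, t (snd e σ j), A.isConst_X _, rfl, by rw [evalAt_X]; rfl, fun r => rfl⟩
  · intro σ f g
    simp only [(hX.conf _).map_add, opEval_add]
  · intro σ r f
    simp only [(hX.conf _).map_smul, opEval_const_smul]

theorem evalAt_box {h m k : ℕ} (e : m + h = k) {X Y : ∀ n, A.Coch n}
    (hX : A.Admissible (toList X)) (v : Fin k → V) (t : Fin k → F) :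
    evalAt t (A.box e (X (h + 1)) (Y m) v)
      = blockSum e (fun p q => toList X ((toList Y p, lamSum p) :: q)) (zipFn v t) := by
  rw [box, evalAt_shuffleBox (Φ := fun σ g =>
      toList X ((g, lamSum (List.ofFn (zipFn v t ∘ fst e σ))) ::
        List.ofFn (zipFn v t ∘ snd e σ)))]
  · refine Finset.sum_congr rfl fun σ _ => ?_
    have e1 : toList Y (List.ofFn (zipFn v t ∘ fst e σ))
        = evalAt ((t ∘ id) ∘ fst e σ) (Y m (v ∘ fst e σ)) := by
      rw [zipFn_comp, toList_zipFn]; rfl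
    beta_reduce
    rw [e1]
  · intro σ g
    simp only [zipFn_comp, toList_cons_zipFn, lamSum_ofFn_zipFn]
    have := (evalAt_moveLeft_aeval (A := A) (t := t) (α := (0 : MvPolynomial (Fin k) V)) (c := 0)
      isConst_zero (by simp)
      (g := Fin.cons (Polynomial.C (∑ j, MvPolynomial.X (fst e σ j)))
        (fun j => Polynomial.C (MvPolynomial.X (snd e σ j))))
      (ρ := fun _ => Fin.cons (∑ j, t (fst e σ j)) (t ∘ snd e σ)) ?_
      (X (h + 1) (Fin.cons g (v ∘ snd e σ)))).2
    · rw [opEval_const] at this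
      exact this
    · intro i
      refine Or.inr (Fin.cases ?_ (fun j => ?_) i)
      · exact ⟨_, ∑ j, t (fst e σ j), IsConst.sum _ fun j => A.isConst_X _, rfl,
          by simp only [evalAt_X, map_sum], fun r => rfl⟩
      · exact ⟨_, t (snd e σ j), A.isConst_X _, rfl, by rw [evalAt_X], fun r => rfl⟩
  · intro σ f g
    simp only [(hX.conf _).map_add]
  · intro σ r f
    simp only [(hX.conf _).map_smul]

theorem evalAt_skewSub {k : ℕ} (P : MvPolynomial (Option (Fin k)) V) (s : F) (t : Fin k → F) :
    evalAt (optPt s t) (A.skewSub P)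
      = opEval A.dl (-s - ∑ j, t j) fun r => evalAt (optPt r t) P := by
  refine (evalAt_moveLeft_aeval
    (α := -MvPolynomial.X none - ∑ j, MvPolynomial.X (some j)) ?_ ?_ ?_ _).2
  · exact (A.isConst_X _).neg.sub (IsConst.sum _ fun j => A.isConst_X _)
  · simp only [map_sub, map_neg, evalAt_X, map_sum, optPt, Option.elim]
  · rintro (_ | j)
    · exact Or.inl ⟨by simp only [Option.elim, map_sub, map_neg, map_sum], fun r => rfl⟩
    · exact Or.inr ⟨_, t j, A.isConst_X _, rfl, by rw [evalAt_X]; rfl, fun r => rfl⟩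

theorem opEval_zsmul (c : F) (n : ℤ) (φ : F → V) :
    opEval A.dl c (fun t => n • φ t) = n • opEval A.dl c φ := map_zsmul (opEval A.dl c) n φ

theorem evalAt_lamBracket {X Y : ∀ n, A.Coch n} (hX : A.Admissible (toList X))
    (hY : A.Admissible (toList Y)) {k : ℕ} (v : Fin k → V) (s : F) (t : Fin k → F) :
    evalAt (optPt s t) (A.lamBracket X Y k v)
      = A.br s (toList X) (toList Y) (List.ofFn (zipFn v t)) := by
  rw [br_eq_splitSum hX hY, ← sum_blockSum_rev, ← sum_blockSum_rev, lamBracket, map_sum,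
    ← Finset.sum_sub_distrib]
  refine Finset.sum_congr rfl fun h _ => ?_
  rw [map_sub, evalAt_boxLam _ hX.map_add hX.map_smul, map_zsmul, evalAt_skewSub]
  congr 1
  simp only [evalAt_boxLam _ hY.map_add hY.map_smul, blockSum, opEval_sum, opEval_zsmul, Finset.smul_sum]
  refine Finset.sum_congr rfl fun σ _ => ?_
  rw [smul_comm]
  congr 1
  rw [List.length_ofFn, List.length_ofFn]
  congr 1
  have e1 : ∀ r, -r - lamSum (List.ofFn (zipFn v t ∘
      snd (Nat.sub_add_cancel (Nat.le_of_lt_succ h.isLt)) σ))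
      = -lamSum (List.ofFn (zipFn v t ∘
      snd (Nat.sub_add_cancel (Nat.le_of_lt_succ h.isLt)) σ)) - r := fun r => by ring
  simp only [e1]
  -- The substitution for λ and the one for the first variable of Y both contain -∂ and cancel; what
  -- remains is s plus the sum of all variables minus that of the second block.
  rw [opEval_opEval _ _ _ ((hY.conf _).mem _), lamSum_ofFn_zipFn]
  congr 3; ring

theorem evalAt_wedge (X Y : ∀ n, A.Coch n) {k : ℕ} (v : Fin k → V) (t : Fin k → F) :
    evalAt t (A.wedge X Y k v) = cat (toList X) (toList Y) (List.ofFn (zipFn v t)) := by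
  rw [cat_eq_splitSum, ← sum_blockSum, wedge, map_sum]
  refine Finset.sum_congr rfl fun h _ => ?_
  rw [map_zsmul, map_sum, blockSum, Finset.smul_sum]
  refine Finset.sum_congr rfl fun σ _ => ?_
  rw [map_zsmul, map_mul, evalAt_rename, evalAt_rename, smul_comm, List.length_ofFn,
    List.length_ofFn, zipFn_comp, zipFn_comp, toList_zipFn, toList_zipFn]

theorem evalAt_optPt {k : ℕ} (P : MvPolynomial (Option (Fin k)) V) (s : F) (t : Fin k → F) :
    evalAt (optPt s t) P = ((optionEquivLeft V (Fin k) P).map (evalAt t).toRingHom).eval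
      (algebraMap F V s) := by
  induction P using MvPolynomial.induction_on with
  | C v => simp [evalAt_C, optionEquivLeft_C]
  | add p q hp hq => simp only [map_add, hp, hq, Polynomial.map_add, Polynomial.eval_add]
  | mul_X p i hp =>
    rw [map_mul, hp, map_mul, Polynomial.map_mul, Polynomial.eval_mul]
    congr 1
    rcases i with _ | i
    · simp [evalAt_X, optionEquivLeft_X_none, optPt]
    · simp [evalAt_X, optionEquivLeft_X_some, optPt]

/-- The bound depends on P only, hence on the arguments but not on the scalars; `IsExpansion` asks
for this uniformity. -/
theorem evalAt_optPt_eq_sum {k : ℕ} (P : MvPolynomial (Option (Fin k)) V) :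
    ∃ N, ∀ M, N ≤ M → ∀ (s : F) (t : Fin k → F), evalAt (optPt s t) P
      = ∑ j ∈ Finset.range M, s ^ j • evalAt t (lamCoeff j P) := by
  refine ⟨(optionEquivLeft V (Fin k) P).natDegree + 1, fun M hM s t => ?_⟩
  rw [evalAt_optPt, Polynomial.eval_eq_sum_range' (n := M)]
  · refine Finset.sum_congr rfl fun j _ => ?_
    rw [Polynomial.coeff_map, Algebra.smul_def, map_pow, mul_comm]
    rfl
  · exact (Polynomial.natDegree_map_le).trans_lt hM

end eval

end DiffFunctionAlgebra

namespace DiffFunctionAlgebra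

open PolyFun MvPolynomial Filter

variable {F V I : Type*} [Field F] [CommRing V] [Algebra F V] [Infinite F]
  {A : DiffFunctionAlgebra F V I}

/-! ## Polynomials and their values -/

theorem evalAt_monomial {τ : Type*} (t : τ → F) (β : τ →₀ ℕ) (v : V) :
    evalAt t (monomial β v) = (β.prod fun i n => t i ^ n) • v := by
  rw [evalAt, aeval_monomial, Algebra.smul_def, mul_comm]
  congr 1
  simp only [Finsupp.prod, map_prod, map_pow]

/-- As in one variable, linear functionals on V reduce the claim to scalar polynomials over an
infinite field. -/
theorem eq_of_evalAt_eq {τ : Type*} {P Q : MvPolynomial τ V}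
    (h : ∀ t : τ → F, evalAt t P = evalAt t Q) : P = Q := by
  suffices H : ∀ P : MvPolynomial τ V, (∀ t : τ → F, evalAt t P = 0) → P = 0 from
    sub_eq_zero.mp (H _ fun t => by rw [map_sub, h, sub_self])
  classical
  intro P hP
  ext β
  rw [coeff_zero, ← Module.forall_dual_apply_eq_zero_iff F]
  intro φ
  have hq : ∑ γ ∈ P.support, monomial γ (φ (P.coeff γ)) = 0 := by
    refine MvPolynomial.funext fun t => ?_
    have := congrArg φ (hP t)
    rw [P.as_sum, map_sum] at this
    simp only [evalAt_monomial, map_sum, map_smul, map_zero] at this ⊢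
    rw [← this]
    exact Finset.sum_congr rfl fun γ _ => by rw [eval_monomial, smul_eq_mul, mul_comm]
  have := congrArg (MvPolynomial.coeff β) hq
  rw [coeff_sum, coeff_zero] at this
  simp only [coeff_monomial, Finset.sum_ite_eq'] at this
  split_ifs at this with hβ
  · exact this
  · rw [notMem_support_iff.mp hβ, map_zero]

theorem polyFun₂_evalAt {τ : Type*} (P : MvPolynomial τ V) {ρ : F → F → τ → F}
    (hρ : ∀ i, (∀ s t, ρ s t i = s) ∨ (∀ s t, ρ s t i = t) ∨ ∃ c, ∀ s t, ρ s t i = c) :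
    PolyFun₂ fun s t => evalAt (ρ s t) P := by
  induction P using MvPolynomial.induction_on with
  | C v => simp only [evalAt_C]; exact .const v
  | add p q hp hq => simp only [map_add]; exact .add _ _ hp hq
  | mul_X p i hp =>
    simp only [evalAt_mul_X]
    rcases hρ i with h | h | ⟨c, h⟩
    · simp only [h]; exact .smul_left _ hp
    · simp only [h]; exact .smul_right _ hp
    · simp only [h]
      have key : ∀ {φ : F → F → V}, PolyFun₂ φ → PolyFun₂ fun s t => c • φ s t := by
        intro φ hφ
        induction hφ with
        | const v => exact .const (c • v)
        | add φ ψ _ _ h1 h2 => simp only [smul_add]; exact .add _ _ h1 h2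
        | smul_left φ _ h => simp only [smul_comm c]; exact .smul_left _ h
        | smul_right φ _ h => simp only [smul_comm c]; exact .smul_right _ h
      exact key hp

theorem exists_toList {X : List (V × F) → V}
    (h : ∀ n (v : Fin n → V), ∃ P : MvPolynomial (Fin n) V,
      ∀ t, evalAt t P = X (List.ofFn (zipFn v t))) : ∃ Z : ∀ n, A.Coch n, toList Z = X := by
  choose Z hZ using h
  refine ⟨Z, funext fun l => ?_⟩
  rw [toList, hZ]
  exact congrArg X (List.ofFn_get l)

theorem toList_mem (Z : ∀ n, A.Coch n) (g : V) (l : List (V × F)) :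
    (fun t => toList Z ((g, t) :: l)) ∈ polyFun F V := by
  have := (polyFun₂_evalAt (Z (l.length + 1) (Fin.cons g fun i => (l.get i).1))
    (ρ := fun _ t => (Fin.cons t fun i => (l.get i).2 : Fin (l.length + 1) → F)) fun i =>
      Or.inr (Fin.cases (Or.inl fun _ _ => rfl) (fun i => Or.inr ⟨_, fun _ _ => rfl⟩) i)).mem_right 0
  convert this using 2 with t
  rw [← toList_cons_zipFn]
  exact congrArg (fun m => toList Z ((g, t) :: m)) (List.ofFn_get l).symm

theorem toList_ext {Z Z' : ∀ n, A.Coch n} (h : toList Z = toList Z') : Z = Z' := by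
  funext n v
  exact eq_of_evalAt_eq fun t => by rw [← toList_zipFn Z, h, toList_zipFn Z']

/-! ## Expansions in powers of `λ` -/

theorem eq_zero_of_sum_pow_smul {M : ℕ} {c : ℕ → V}
    (h : ∀ s : F, ∑ j ∈ Finset.range M, s ^ j • c j = 0) : ∀ j < M, c j = 0 := by
  intro j hj
  have h0 : (∑ j ∈ Finset.range M, Polynomial.monomial j (c j)) = 0 := by
    apply polyEval_injective (F := F)
    funext s
    rw [map_sum, Finset.sum_apply, map_zero, Pi.zero_apply, ← h s]
    refine Finset.sum_congr rfl fun i _ => ?_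
    rw [polyEval_eq_sum, Polynomial.sum_monomial_index _ _ (by simp)]
  have := congrArg (fun p => Polynomial.coeff p j) h0
  simpa [Polynomial.finsetSum_coeff, Polynomial.coeff_monomial, hj] using this

/-- `Φ_s = ∑ s^j Z_j`, where the sum is finite for each collection of arguments. -/
def IsExpansion (Φ : F → List (V × F) → V) (Z : ℕ → List (V × F) → V) : Prop :=
  ∀ v : List V, ∀ᶠ M in atTop, ∀ s l, l.map Prod.fst = v →
    Φ s l = ∑ j ∈ Finset.range M, s ^ j • Z j l

/-- For a given g the condition involves only g and the u_q on which g depends. Finitely many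
argument tuples share one bound on the degree in s, so the condition can be compared coefficient by
coefficient. -/
theorem IsExpansion.isVect_iff {Φ : F → List (V × F) → V} {Z : ℕ → List (V × F) → V}
    (h : IsExpansion Φ Z) (l : List (V × F)) (r : F) :
    (∀ s, A.IsVect fun g => opEval A.dl r fun t => Φ s ((g, t) :: l)) ↔
      ∀ j, A.IsVect fun g => opEval A.dl r fun t => Z j ((g, t) :: l) := by
  have key : ∀ g, ∀ᶠ M in atTop, ∀ s,
      (opEval A.dl r fun t => Φ s ((g, t) :: l))
        - A.vf (fun q => opEval A.dl r fun t => Φ s ((A.uvar q, t) :: l)) g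
      = ∑ j ∈ Finset.range M, s ^ j • ((opEval A.dl r fun t => Z j ((g, t) :: l))
        - A.vf (fun q => opEval A.dl r fun t => Z j ((A.uvar q, t) :: l)) g) := by
    intro g
    have h1 : ∀ g, ∀ᶠ M in atTop, ∀ s, (opEval A.dl r fun t => Φ s ((g, t) :: l))
        = ∑ j ∈ Finset.range M, s ^ j • opEval A.dl r fun t => Z j ((g, t) :: l) := by
      intro g
      filter_upwards [h (g :: l.map Prod.fst)] with M hM s
      simp only [← opEval_const_smul, ← opEval_sum]
      congr 1
      funext t
      exact hM s _ rfl
    filter_upwards [h1 g, (eventually_all_finset (A.supp g)).2 fun q _ => h1 (A.uvar q)] with M h2 h3 s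
    simp only [smul_sub, Finset.sum_sub_distrib, ← h2, vf, Finset.smul_sum]
    congr 1
    rw [Finset.sum_comm]
    refine Finset.sum_congr rfl fun q hq => ?_
    simp only [h3 q hq s, Finset.mul_sum, mul_smul_comm]
  refine ⟨fun H j g => ?_, fun H s g => ?_⟩
  · obtain ⟨M, hM, hj⟩ := ((key g).and (eventually_gt_atTop j)).exists
    exact sub_eq_zero.mp (eq_zero_of_sum_pow_smul (F := F)
      (fun s => by rw [← hM s]; exact sub_eq_zero.mpr (H s g)) j hj)
  · obtain ⟨M, hM⟩ := (key g).exists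
    refine sub_eq_zero.mp ((hM s).trans (Finset.sum_eq_zero fun j _ => ?_))
    rw [sub_eq_zero.mpr (H j g), smul_zero]

/-- Each defining condition is linear and concerns finitely many argument tuples at a time, so it
descends to the coefficients. Conformality is tested through `isConf_of_isVect`, where the
characteristic does not appear. -/
theorem IsExpansion.admissible [Fintype I] {Φ : F → List (V × F) → V}
    {Z : ℕ → List (V × F) → V}
    (h : IsExpansion Φ Z) (hΦ : ∀ s, A.Admissible (Φ s))
    (hZ : ∀ j, ∃ Y : ∀ n, A.Coch n, toList Y = Z j) (j : ℕ) : A.Admissible (Z j) where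
  poly := hZ j
  alt l₁ a b l₂ := by
    obtain ⟨M, ⟨h1, h2⟩, hj⟩ := (((h ((l₁ ++ a :: b :: l₂).map Prod.fst)).and
      (h ((l₁ ++ b :: a :: l₂).map Prod.fst))).and (eventually_gt_atTop j)).exists
    refine eq_neg_of_add_eq_zero_left (eq_zero_of_sum_pow_smul (F := F)
      (c := fun j => Z j (l₁ ++ a :: b :: l₂) + Z j (l₁ ++ b :: a :: l₂)) (fun s => ?_) j hj)
    simp only [smul_add, Finset.sum_add_distrib]
    rw [← h1 s _ rfl, ← h2 s _ rfl, (hΦ s).alt, neg_add_cancel]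
  conf l := by
    refine isConf_of_isVect (fun g => ?_) (fun g t => ?_) fun s => ?_
    · obtain ⟨Y, hY⟩ := hZ j
      rw [← hY]
      exact toList_mem Y g l
    · obtain ⟨M, ⟨h1, h2⟩, hj⟩ := (((h (((A.d g, t) :: l).map Prod.fst)).and
        (h (((g, t) :: l).map Prod.fst))).and (eventually_gt_atTop j)).exists
      refine eq_neg_of_add_eq_zero_left (eq_zero_of_sum_pow_smul (F := F)
        (c := fun j => Z j ((A.d g, t) :: l) + t • Z j ((g, t) :: l)) (fun s => ?_) j hj)
      simp only [smul_add, Finset.sum_add_distrib, smul_comm _ t, ← Finset.smul_sum]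
      rw [← h1 s _ rfl, ← h2 s _ rfl, ((hΦ s).conf l).map_d, neg_add_cancel]
    · exact (h.isVect_iff l (-s)).1 (fun r => ((hΦ r).conf l).isVect s) j

theorem isExpansion_lamCoeff (Q : ∀ k, (Fin k → V) → MvPolynomial (Option (Fin k)) V)
    {Φ : F → List (V × F) → V}
    (h : ∀ k v s t, evalAt (optPt s t) (Q k v) = Φ s (List.ofFn (zipFn v t))) :
    IsExpansion Φ fun j => toList (A := A) fun k v => lamCoeff j (Q k v) := by
  intro v
  obtain ⟨N, hN⟩ := evalAt_optPt_eq_sum (F := F) (Q v.length v.get)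
  filter_upwards [eventually_ge_atTop N] with M hM s l hl
  subst hl
  have h1 := hN M hM s fun i => (l.get (i.cast (by simp))).2
  rw [h] at h1
  have h2 : List.ofFn (zipFn (l.map Prod.fst).get fun i => (l.get (i.cast (by simp))).2) = l := by
    apply List.ext_getElem <;> simp [zipFn]
  rw [h2] at h1
  rw [h1]
  refine Finset.sum_congr rfl fun j _ => ?_
  conv_rhs => rw [← h2, toList_zipFn]

theorem exists_toList_of_eval (Q : ∀ k, (Fin k → V) → MvPolynomial (Option (Fin k)) V) (s : F)
    {X : List (V × F) → V} (h : ∀ k v t, evalAt (optPt s t) (Q k v) = X (List.ofFn (zipFn v t))) :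
    ∃ Z : ∀ n, A.Coch n, toList Z = X := by
  refine exists_toList fun n v => ?_
  obtain ⟨N, hN⟩ := evalAt_optPt_eq_sum (F := F) (Q n v)
  refine ⟨∑ j ∈ Finset.range N, s ^ j • lamCoeff j (Q n v), fun t => ?_⟩
  rw [← h, hN N le_rfl, map_sum]
  simp only [evalAt_smul]

/-! ## Closure properties -/

namespace Admissible

variable [Fintype I] {X Y : List (V × F) → V}

/-- With one argument the transform of the bracket is, by `adj_br`, a commutator of vector fields
plus two vector fields. Further arguments are moved to the front and contracted away. -/
theorem isConf_br (hX : A.Admissible X) (hY : A.Admissible Y) (s : F) (l : List (V × F)) :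
    A.IsConf fun g t => A.br s X Y ((g, t) :: l) := by
  induction l generalizing X Y s with
  | nil =>
    refine isConf_of_isVect (fun g => ?_) (fun g t => ?_) fun r => ?_
    · obtain ⟨Zx, rfl⟩ := hX.poly
      obtain ⟨Zy, rfl⟩ := hY.poly
      obtain ⟨Z, hZ⟩ := exists_toList_of_eval (A := A) (A.lamBracket Zx Zy) s
        fun k v t => evalAt_lamBracket hX hY v s t
      rw [← hZ]
      exact toList_mem Z g []
    · simp only [br_cons, hX.contr_d, hY.contr_d, hY.sgn.br_smul_left, hX.br_smul_right,
        Pi.smul_apply]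
      module
    -- The transform at r is needed, and `adj_br` gives it at a sum s + t; hence t = r - s.
    · have e := fun g => hX.adj_br hY s (r - s) g
      rw [add_sub_cancel] at e
      have e' : (fun g => opEval A.dl (-r) fun t => A.br s X Y [(g, t)])
          = fun g => A.adj (A.br s X Y) r g := rfl
      rw [e']
      simp only [e]
      exact ((((hX.isVect _).commutator (hY.isVect _)).add ((hY.contr _).isVect r)).add
        ((hX.contr _).isVect r))
  | cons b l ih =>
    have e : (fun g t => A.br s X Y ((g, t) :: b :: l)) = fun g t =>
        A.br (s + b.2) (DiffFunctionAlgebra.contr b X) (DiffFunctionAlgebra.sgn Y) ((g, t) :: l)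
          + -A.br s X (DiffFunctionAlgebra.contr b Y) ((g, t) :: l) := by
      funext g t
      rw [show A.br s X Y ((g, t) :: b :: l) = -A.br s X Y (b :: (g, t) :: l) from
        hX.br_alt hY s [] (g, t) b l, br_cons]
      abel
    rw [e]
    exact (ih (hX.contr b) hY.sgn _).add (ih hX (hY.contr b) _).neg

theorem br (hX : A.Admissible X) (hY : A.Admissible Y) (s : F) : A.Admissible (A.br s X Y) where
  poly := by
    obtain ⟨Zx, rfl⟩ := hX.poly
    obtain ⟨Zy, rfl⟩ := hY.poly
    exact exists_toList_of_eval (A := A) (A.lamBracket Zx Zy) s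
        fun k v t => evalAt_lamBracket hX hY v s t
  alt := hX.br_alt hY s
  conf := hX.isConf_br hY s

theorem cat_alt (hX : A.Admissible X) (hY : A.Admissible Y) (l₁ : List (V × F))
    (a b : V × F) (l₂ : List (V × F)) :
    cat X Y (l₁ ++ a :: b :: l₂) = -cat X Y (l₁ ++ b :: a :: l₂) := by
  induction l₁ generalizing X Y with
  | nil =>
    have e1 : DiffFunctionAlgebra.contr a (DiffFunctionAlgebra.contr b X)
        = -DiffFunctionAlgebra.contr b (DiffFunctionAlgebra.contr a X) := by
      funext l; exact hX.swap b a l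
    have e2 : DiffFunctionAlgebra.contr a (DiffFunctionAlgebra.contr b Y)
        = -DiffFunctionAlgebra.contr b (DiffFunctionAlgebra.contr a Y) := by
      funext l; exact hY.swap b a l
    simp only [List.nil_append, cat_cons, contr_sgn, sgn_sgn, e1, e2, cat_neg_left, cat_neg_right,
      Pi.neg_apply]
    abel
  | cons c l ih =>
    simp only [List.cons_append, cat_cons, ih (hX.contr c) hY.sgn, ih hX (hY.contr c)]
    abel

theorem isConf_cat (hX : A.Admissible X) (hY : A.Admissible Y) (l : List (V × F)) :
    A.IsConf fun g t => cat X Y ((g, t) :: l) := by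
  induction l generalizing X Y with
  | nil =>
    have e : (fun g t => cat X Y [(g, t)]) = fun g t => Y [] * X [(g, t)] + X [] * Y [(g, t)] := by
      funext g t
      rw [cat_cons, cat_nil, cat_nil, sgn_nil, contr_apply, contr_apply, mul_comm]
    rw [e]
    exact ((hX.conf []).mul_left _).add ((hY.conf []).mul_left _)
  | cons b l ih =>
    have e : (fun g t => cat X Y ((g, t) :: b :: l)) = fun g t =>
        -cat (DiffFunctionAlgebra.contr b X) (DiffFunctionAlgebra.sgn Y) ((g, t) :: l)
          + -cat X (DiffFunctionAlgebra.contr b Y) ((g, t) :: l) := by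
      funext g t
      rw [show DiffFunctionAlgebra.cat X Y ((g, t) :: b :: l)
        = -DiffFunctionAlgebra.cat X Y (b :: (g, t) :: l) from hX.cat_alt hY [] (g, t) b l, cat_cons]
      abel
    rw [e]
    exact (ih (hX.contr b) hY.sgn).neg.add (ih hX (hY.contr b)).neg

theorem cat (hX : A.Admissible X) (hY : A.Admissible Y) : A.Admissible (cat X Y) where
  poly := by
    obtain ⟨Zx, rfl⟩ := hX.poly
    obtain ⟨Zy, rfl⟩ := hY.poly
    exact exists_toList fun n v => ⟨_, evalAt_wedge Zx Zy v⟩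
  alt := hX.cat_alt hY
  conf := hX.isConf_cat hY

end Admissible

theorem toList_totalD (Z : ∀ n, A.Coch n) :
    toList (A := A) (fun n v => A.totalD n (Z n v)) = A.totalOp (toList Z) := by
  funext l
  rw [toList, evalAt_totalD, totalOp, lamSum, toList]
  congr 2
  rw [← List.sum_ofFn]
  congr 1
  apply List.ext_getElem <;> simp

theorem toList_single {n : ℕ} (X : A.Coch n) (l : List (V × F)) :
    toList (Pi.single n X) l = if h : n = l.length then
      evalAt (fun i => (l.get (i.cast h)).2) (X fun i => (l.get (i.cast h)).1) else 0 := by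
  split_ifs with h
  · rw [toList_eq _ l h, Pi.single_eq_same]
  · rw [toList, Pi.single_eq_of_ne (Ne.symm h), Pi.zero_apply, map_zero]

theorem toList_single_eq (Z : ∀ n, A.Coch n) (n : ℕ) (l : List (V × F)) :
    toList (Pi.single n (Z n)) l = if l.length = n then toList Z l else 0 := by
  rw [toList_single]
  by_cases h : l.length = n
  · subst h; simp [toList]
  · rw [dif_neg (Ne.symm h), if_neg h]

section

variable [Fintype I]

theorem admissible_totalOp {X : List (V × F) → V} (h : A.Admissible X) :
    A.Admissible (A.totalOp X) where
  poly := by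
    obtain ⟨Z, rfl⟩ := h.poly
    exact ⟨_, toList_totalD Z⟩
  alt l₁ a b l₂ := by
    have : lamSum (l₁ ++ a :: b :: l₂) = lamSum (l₁ ++ b :: a :: l₂) := by
      simp only [lamSum, List.map_append, List.sum_append, List.map_cons, List.sum_cons]; ring
    rw [totalOp, this, h.alt, map_neg, totalOp]
  conf l := (h.conf l).opd (lamSum l)

theorem toList_single_zero (v : V) :
    toList (A := A) (Pi.single 0 fun _ => C v) = scalarFun v := by
  funext l
  rw [toList_single]
  cases l with
  | nil => simp [scalarFun, evalAt_C]
  | cons a l => simp [scalarFun]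

theorem admissible_scalarFun (v : V) : A.Admissible (scalarFun v : List (V × F) → V) where
  poly := ⟨_, toList_single_zero v⟩
  alt l₁ a b l₂ := by cases l₁ <;> simp [scalarFun]
  conf l := IsConf.zero

theorem admissible_toList_iff {Z : ∀ n, A.Coch n} :
    A.Admissible (toList Z) ↔ ∀ n, A.Admissible (toList (Pi.single n (Z n))) := by
  refine ⟨fun h n => ⟨⟨_, rfl⟩, fun l₁ a b l₂ => ?_, fun l => ?_⟩,
    fun h => ⟨⟨_, rfl⟩, fun l₁ a b l₂ => ?_, fun l => ?_⟩⟩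
  · have : (l₁ ++ a :: b :: l₂).length = (l₁ ++ b :: a :: l₂).length := by simp
    rw [toList_single_eq, toList_single_eq, this, h.alt]
    split_ifs <;> simp
  · simp only [toList_single_eq, List.length_cons]
    split_ifs
    · exact h.conf l
    · exact IsConf.zero
  · have := (h _).alt l₁ a b l₂ (X := toList (Pi.single (l₁ ++ a :: b :: l₂).length (Z _)))
    rwa [toList_single_eq, toList_single_eq, if_pos rfl, if_pos (by simp)] at this
  · have := (h (l.length + 1)).conf l
    simpa only [toList_single_eq, List.length_cons, if_true] using this

end

end DiffFunctionAlgebra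

namespace DiffFunctionAlgebra

open PolyFun MvPolynomial Filter

/-! ## Permutations of arguments -/

section lists

variable {K M : Type*} [AddCommGroup M]

theorem ofFn_comp_swap {n : ℕ} (a : Fin (n + 1) → K) (i : Fin n) :
    ∃ l₁ l₂, List.ofFn a = l₁ ++ a i.castSucc :: a i.succ :: l₂ ∧
      List.ofFn (a ∘ Equiv.swap i.castSucc i.succ) = l₁ ++ a i.succ :: a i.castSucc :: l₂ := by
  refine ⟨(List.ofFn a).take i, (List.ofFn a).drop (i + 2), ?_, ?_⟩
  · apply List.ext_getElem
    · simp; omega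
    · intro j h1 h2
      simp only [List.getElem_append, List.getElem_cons, List.length_take, List.length_ofFn,
        List.getElem_take, List.getElem_drop, List.getElem_ofFn]
      split_ifs
      · rfl
      · congr 1; ext; simp; omega
      · congr 1; ext; simp; omega
      · congr 1; ext; simp; omega
  · apply List.ext_getElem
    · simp; omega
    · intro j h1 h2
      have hi := i.isLt
      rw [List.length_ofFn] at h1
      simp only [List.getElem_append, List.getElem_cons, List.length_take, List.length_ofFn,
        List.getElem_take, List.getElem_drop, List.getElem_ofFn, Function.comp_apply,
        Equiv.swap_apply_def, Fin.ext_iff, Fin.val_castSucc, Fin.val_succ]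
      split_ifs <;> first | rfl | omega | (congr 1; ext; simp; omega)

theorem apply_ofFn_comp_perm {X : List K → M}
    (h : ∀ l₁ a b l₂, X (l₁ ++ a :: b :: l₂) = -X (l₁ ++ b :: a :: l₂)) {n : ℕ}
    (σ : Equiv.Perm (Fin n)) (a : Fin n → K) :
    X (List.ofFn (a ∘ σ)) = (Equiv.Perm.sign σ : ℤ) • X (List.ofFn a) := by
  cases n with
  | zero => rw [Subsingleton.elim σ 1]; simp
  | succ n =>
    have hσ : σ ∈ Submonoid.closure (Set.range fun i : Fin n => Equiv.swap i.castSucc i.succ) := by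
      rw [Equiv.Perm.mclosure_swap_castSucc_succ]; trivial
    induction hσ using Submonoid.closure_induction generalizing a with
    | mem σ hσ =>
      obtain ⟨i, rfl⟩ := hσ
      obtain ⟨l₁, l₂, h1, h2⟩ := ofFn_comp_swap a i
      dsimp only
      rw [h2, h, ← h1, Equiv.Perm.sign_swap (Fin.castSucc_lt_succ).ne]
      simp
    | one => simp
    | mul σ τ _ _ h1 h2 =>
      rw [Equiv.Perm.coe_mul, ← Function.comp_assoc, h2, h1, smul_smul, map_mul, mul_comm]
      simp

theorem apply_append_swap {X : List K → M}
    (h : ∀ n (σ : Equiv.Perm (Fin n)) a,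
      X (List.ofFn (a ∘ σ)) = (Equiv.Perm.sign σ : ℤ) • X (List.ofFn a))
    (l₁ : List K) (a b : K) (l₂ : List K) :
    X (l₁ ++ a :: b :: l₂) = -X (l₁ ++ b :: a :: l₂) := by
  have hlen : (l₁ ++ b :: a :: l₂).length = l₁.length + 1 + l₂.length + 1 := by simp; omega
  let f : Fin (l₁.length + 1 + l₂.length + 1) → K := fun i => (l₁ ++ b :: a :: l₂)[i]
  have h1 : List.ofFn f = l₁ ++ b :: a :: l₂ := by
    apply List.ext_getElem
    · simp; omega
    · intro j _ _; rw [List.getElem_ofFn]; rfl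
  have h2 : List.ofFn (f ∘ Equiv.swap (⟨l₁.length, by omega⟩ : Fin _) ⟨l₁.length + 1, by omega⟩)
      = l₁ ++ a :: b :: l₂ := by
    apply List.ext_getElem
    · simp; omega
    · intro j h1 h2
      simp only [List.getElem_ofFn, Function.comp_apply, Equiv.swap_apply_def, Fin.ext_iff, f]
      split_ifs with h3 h4
      · subst h3; simp
      · subst h4; simp
      · simp only [Fin.getElem_fin, List.getElem_append, List.getElem_cons]
        split_ifs <;> first | rfl | omega
  rw [← h1, ← h2, h, Equiv.Perm.sign_swap (by simp [Fin.ext_iff])]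
  simp

theorem exists_ofFn_update {V F : Type*} {n : ℕ} (v : Fin n → V) (t : Fin n → F) (i : Fin n) :
    ∃ l₁ l₂, ∀ f r, List.ofFn (zipFn (Function.update v i f) (Function.update t i r))
      = l₁ ++ (f, r) :: l₂ := by
  refine ⟨(List.ofFn (zipFn v t)).take i, (List.ofFn (zipFn v t)).drop (i + 1), fun f r => ?_⟩
  apply List.ext_getElem
  · simp; omega
  · intro j h1 h2
    have hi := i.isLt
    rw [List.length_ofFn] at h1
    simp only [List.getElem_append, List.getElem_cons, List.length_take, List.length_ofFn,
      List.getElem_take, List.getElem_drop, List.getElem_ofFn, zipFn, Function.update_apply,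
      Fin.ext_iff]
    split_ifs <;> first | rfl | omega | (congr 2 <;> (try ext) <;> simp <;> omega)

theorem exists_eq_ofFn_zipFn {V F : Type*} {k : ℕ} {l : List (V × F)} (h : l.length = k) :
    ∃ (v : Fin k → V) (t : Fin k → F), l = List.ofFn (zipFn v t) := by
  subst h
  exact ⟨fun i => (l.get i).1, fun i => (l.get i).2, (List.ofFn_get l).symm⟩

theorem shuffles_zero {k : ℕ} (e : 0 + k = k) : shuffles e = {1} := by
  ext σ
  have h0 : ∀ j, snd e σ j = σ j := fun j => by
    rw [snd]; congr 1; ext; simp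
  rw [mem_shuffles, Finset.mem_singleton]
  refine ⟨fun ⟨_, h⟩ => ?_, ?_⟩
  · have := (StrictMono.range_inj (f := snd e σ) (g := id) h strictMono_id).1 (by
      rw [funext h0]; simp [σ.surjective.range_eq])
    ext j
    rw [← h0, this]; rfl
  · rintro rfl
    exact ⟨fun i => i.elim0, fun i j hij => by rw [h0, h0]; exact hij⟩

theorem blockSum_zero {k : ℕ} (e : 0 + k = k) (G : List K → List K → M) (v : Fin k → K) :
    blockSum e G v = G [] (List.ofFn v) := by
  rw [blockSum, shuffles_zero, Finset.sum_singleton, Equiv.Perm.sign_one]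
  have : v ∘ snd e 1 = v := by
    funext j
    rw [Function.comp_apply, snd, Equiv.Perm.one_apply]
    congr 1; ext; simp
  rw [this]
  simp

end lists

/-! ### The full prolongation as the space of admissible functions. -/

variable {F V I : Type*} [Field F] [CommRing V] [Algebra F V] [Infinite F]
  {A : DiffFunctionAlgebra F V I}

theorem Admissible.apply_append_cons [Fintype I] {X : List (V × F) → V} (h : A.Admissible X)
    (l₁ : List (V × F)) (a : V × F) (l₂ : List (V × F)) :
    X (l₁ ++ a :: l₂) = (-1 : F) ^ l₁.length • X (a :: (l₁ ++ l₂)) := by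
  induction l₁ generalizing X with
  | nil => simp
  | cons c l ih =>
    have := ih (h.contr c)
    simp only [contr_apply] at this
    rw [List.cons_append, this, h.swap c a, List.length_cons, pow_succ, smul_neg]
    simp

/-- A scalar has no arguments to contract, so every argument goes to X. This matches the bracket in
the definition of the prolongation with `br`. -/
theorem br_scalarFun [Fintype I] {X : List (V × F) → V} (h : A.Admissible X) (s : F) (f : V)
    (l : List (V × F)) : A.br s X (scalarFun f) l
      = opEval A.dl (-s - lamSum l) fun r => X ((f, r) :: l) := by
  have h1 : sgn (scalarFun f : List (V × F) → V) = scalarFun f := by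
    funext l; cases l <;> simp [sgn, scalarFun]
  induction l generalizing X s with
  | nil => rw [br_nil, scalarFun, lamSum_nil, sub_zero, scalarFun, sub_zero, adj]
  | cons a l ih =>
    have h2 : A.br s X 0 = 0 := by simpa using h.br_smul_right s 0 0
    rw [br_cons, contr_scalarFun, h1, ih (h.contr a), h2, Pi.zero_apply, add_zero, ← opEval_neg,
      lamSum_cons, show -(s + a.2) - lamSum l = -s - (a.2 + lamSum l) by ring]
    congr 1
    funext r
    rw [contr_apply, h.swap, neg_neg]

theorem evalAt_boxLam_zero {n : ℕ} {X : A.Coch (n + 1)}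
    (h1 : ∀ f g r l, toList (Pi.single (n + 1) X) ((f + g, r) :: l)
      = toList (Pi.single (n + 1) X) ((f, r) :: l) + toList (Pi.single (n + 1) X) ((g, r) :: l))
    (h2 : ∀ (c : F) f r l, toList (Pi.single (n + 1) X) ((c • f, r) :: l)
      = c • toList (Pi.single (n + 1) X) ((f, r) :: l)) [Fintype I]
    (f : V) (v : Fin n → V) (s : F) (t : Fin n → F) :
    evalAt (optPt s t) (A.boxLam (Nat.zero_add n) X (fun _ => C f) v)
      = opEval A.dl (-s - lamSum (List.ofFn (zipFn v t))) fun r =>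
        toList (Pi.single (n + 1) X) ((f, r) :: List.ofFn (zipFn v t)) := by
  have := evalAt_boxLam (Nat.zero_add n) (Y := Pi.single 0 fun _ => C f) h1 h2 v s t
  rw [Pi.single_eq_same, Pi.single_eq_same, blockSum_zero] at this
  rw [this]
  simp only [toList_single_zero, scalarFun]

theorem toList_single_of_length_ne {n : ℕ} (X : A.Coch n) {l : List (V × F)} (h : l.length ≠ n) :
    toList (Pi.single n X) l = 0 := by
  rw [toList_single, dif_neg (Ne.symm h)]

theorem toList_single_zipFn {n : ℕ} (X : A.Coch n) (v : Fin n → V) (t : Fin n → F) :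
    toList (Pi.single n X) (List.ofFn (zipFn v t)) = evalAt t (X v) := by
  rw [toList_zipFn, Pi.single_eq_same]

theorem toList_single_cons_zipFn {n : ℕ} (X : A.Coch (n + 1)) (g : V) (r : F) (v : Fin n → V)
    (t : Fin n → F) : toList (Pi.single (n + 1) X) ((g, r) :: List.ofFn (zipFn v t))
      = evalAt (Fin.cons r t) (X (Fin.cons g v)) := by
  rw [toList_cons_zipFn, Pi.single_eq_same]

theorem isExpansion_boxLam_zero {n : ℕ} {X : A.Coch (n + 1)}
    (h1 : ∀ f g r l, toList (Pi.single (n + 1) X) ((f + g, r) :: l)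
      = toList (Pi.single (n + 1) X) ((f, r) :: l) + toList (Pi.single (n + 1) X) ((g, r) :: l))
    (h2 : ∀ (c : F) f r l, toList (Pi.single (n + 1) X) ((c • f, r) :: l)
      = c • toList (Pi.single (n + 1) X) ((f, r) :: l)) [Fintype I] (f : V) :
    IsExpansion (fun s l => opEval A.dl (-s - lamSum l) fun r =>
        toList (Pi.single (n + 1) X) ((f, r) :: l))
      fun j => toList (A := A) (Pi.single n fun v => lamCoeff j
        (A.boxLam (Nat.zero_add n) X (fun _ => C f) v)) := by
  have := isExpansion_lamCoeff (A := A) (Φ := fun s l => opEval A.dl (-s - lamSum l) fun r =>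
      toList (Pi.single (n + 1) X) ((f, r) :: l))
    (fun k v => if h : k = n then A.boxLam ((Nat.zero_add n).trans h.symm)
      X (fun _ => C f) v else 0) ?_
  · convert this using 3 with j
    funext k v
    by_cases h : k = n
    · subst h; simp
    · simp [h, lamCoeff]
  · intro k v s t
    by_cases h : k = n
    · subst h
      rw [dif_pos rfl]
      exact evalAt_boxLam_zero h1 h2 f v s t
    · rw [dif_neg h, map_zero]
      have : ∀ r, toList (Pi.single (n + 1) X) ((f, r) :: List.ofFn (zipFn v t)) = 0 :=
        fun r => toList_single_of_length_ne X (by simpa using h)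
      simp only [this, opEval_zero]

theorem Admissible.mem_tildeWd [Fintype I] {n : ℕ} {X : A.Coch n}
    (h : A.Admissible (toList (Pi.single n X))) : X ∈ A.tildeWd n := by
  have key : ∀ (v : Fin n → V) (t : Fin n → F) (i : Fin n), ∃ l, ∃ c : F, ∀ f,
      evalAt t (X (Function.update v i f)) = c • toList (Pi.single n X) ((f, t i) :: l) := by
    intro v t i
    obtain ⟨l₁, l₂, hl⟩ := exists_ofFn_update v t i
    refine ⟨l₁ ++ l₂, (-1) ^ l₁.length, fun f => ?_⟩
    have := hl f (t i)
    rw [Function.update_eq_self] at this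
    rw [← toList_single_zipFn, this, h.apply_append_cons]
  refine ⟨⟨{ toFun := X, map_update_add' := ?_, map_update_smul' := ?_ }, fun v => rfl⟩,
    fun v i => eq_of_evalAt_eq (F := F) fun t => ?_, fun σ v => eq_of_evalAt_eq (F := F) fun t => ?_⟩
  · intro inst v i f g
    obtain rfl := Subsingleton.elim inst (instDecidableEqFin n)
    refine eq_of_evalAt_eq (F := F) fun t => ?_
    obtain ⟨l, c, H⟩ := key v t i
    rw [_root_.map_add, H, H, H, ← smul_add, ← (h.conf l).map_add]
  · intro inst v i r f
    obtain rfl := Subsingleton.elim inst (instDecidableEqFin n)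
    refine eq_of_evalAt_eq (F := F) fun t => ?_
    obtain ⟨l, c, H⟩ := key v t i
    rw [evalAt_smul, H, H, (h.conf l).map_smul, smul_comm]
  · obtain ⟨l, c, H⟩ := key v t i
    have h1 := H (v i)
    rw [Function.update_eq_self] at h1
    rw [H, map_neg, map_mul, evalAt_X, ← Algebra.smul_def, h1, (h.conf l).map_d, smul_neg,
      smul_comm]
  · rw [evalAt_rename, map_zsmul, ← toList_single_zipFn, ← toList_single_zipFn,
      ← apply_ofFn_comp_perm h.alt]
    rfl

/-- Conformality in g is obtained by placing another argument f in front: X(g, f, …) = -X(f, g, …)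
is an inverse transform of [X_u f] at (g, …), which is conformal in g by assumption. -/
theorem admissible_of_mem_tildeWd [Fintype I] {n : ℕ} {X : A.Coch (n + 2)}
    (hX : X ∈ A.tildeWd (n + 2))
    (hc : ∀ (f : V) (j : ℕ), A.Admissible (toList (A := A) (Pi.single (n + 1) fun v =>
      lamCoeff j (A.boxLam (Nat.zero_add (n + 1)) X (fun _ => C f) v)))) :
    A.Admissible (toList (Pi.single (n + 2) X)) := by
  obtain ⟨⟨T, hT⟩, hd, hσ⟩ := hX
  have h1 : ∀ f g r l, toList (Pi.single (n + 2) X) ((f + g, r) :: l)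
      = toList (Pi.single (n + 2) X) ((f, r) :: l)
        + toList (Pi.single (n + 2) X) ((g, r) :: l) := by
    intro f g r l
    by_cases hl : l.length = n + 1
    · obtain ⟨v, t, rfl⟩ := exists_eq_ofFn_zipFn hl
      simp only [toList_single_cons_zipFn, hT, MultilinearMap.cons_add, map_add]
    · simp only [toList_single_of_length_ne X (l := (_, r) :: l) (by simpa using hl), add_zero]
  have h2 : ∀ (c : F) f r l, toList (Pi.single (n + 2) X) ((c • f, r) :: l)
      = c • toList (Pi.single (n + 2) X) ((f, r) :: l) := by
    intro c f r l
    by_cases hl : l.length = n + 1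
    · obtain ⟨v, t, rfl⟩ := exists_eq_ofFn_zipFn hl
      simp only [toList_single_cons_zipFn, hT, MultilinearMap.cons_smul, evalAt_smul]
    · simp only [toList_single_of_length_ne X (l := (_, r) :: l) (by simpa using hl), smul_zero]
  have halt : ∀ l₁ a b l₂, toList (Pi.single (n + 2) X) (l₁ ++ a :: b :: l₂)
      = -toList (Pi.single (n + 2) X) (l₁ ++ b :: a :: l₂) := by
    refine apply_append_swap fun m σ a => ?_
    by_cases hm : m = n + 2
    · subst hm
      have e : a = zipFn (fun i => (a i).1) fun i => (a i).2 := rfl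
      rw [e, zipFn_comp, toList_single_zipFn, toList_single_zipFn, ← map_zsmul, ← hσ, evalAt_rename]
    · rw [toList_single_of_length_ne X (by simpa using hm),
        toList_single_of_length_ne X (by simpa using hm), smul_zero]
  refine ⟨⟨_, rfl⟩, halt, fun l => ?_⟩
  by_cases hl : l.length = n + 1
  swap
  · simp only [toList_single_of_length_ne X (l := (_, _) :: l) (by simpa using hl)]
    exact IsConf.zero
  refine isConf_of_isVect (fun g => toList_mem _ _ _) (fun g t => ?_) fun s => ?_
  · obtain ⟨v, t', rfl⟩ := exists_eq_ofFn_zipFn hl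
    have := hd (Fin.cons g v) 0
    rw [Fin.cons_zero, Fin.update_cons_zero] at this
    rw [toList_single_cons_zipFn, toList_single_cons_zipFn, this, map_neg, map_mul, evalAt_X,
      Algebra.smul_def]
    rfl
  obtain ⟨⟨f, t₀⟩, l, rfl⟩ := List.exists_cons_of_length_eq_add_one hl
  have hl' : l.length = n := by simpa using hl
  set D : F → List (V × F) → V := fun s l => opEval A.dl (-s - lamSum l) fun r =>
        toList (Pi.single (n + 2) X) ((f, r) :: l) with hD
  have hexp := isExpansion_boxLam_zero h1 h2 f
  have hvect := (hexp.isVect_iff l (-s)).2 (fun j => ((hc f j).conf l).isVect s)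
  have e : ∀ g t, toList (Pi.single (n + 2) X) ((g, t) :: (f, t₀) :: l)
      = -opEval A.dl (-((lamSum l + t₀) + t)) fun u => D u ((g, t) :: l) := by
    intro g t
    have h3 := halt [] (g, t) (f, t₀) l
    rw [List.nil_append, List.nil_append] at h3
    have h4 := opEval_opEval A.dl (-((lamSum l + t₀) + t)) (-lamSum ((g, t) :: l))
      (toList_mem (Pi.single (n + 2) X) f ((g, t) :: l))
    rw [show -lamSum ((g, t) :: l) - (-((lamSum l + t₀) + t)) = t₀ by rw [lamSum_cons]; ring] at h4
    rw [h3, ← h4]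
    simp only [hD]
    congr 2
    funext u
    congr 2
    ring
  have hpoly : ∀ g, PolyFun₂ fun u t => D u ((g, t) :: l) := by
    intro g
    obtain ⟨v, t', rfl⟩ := exists_eq_ofFn_zipFn hl'
    have := polyFun₂_evalAt (A.boxLam (Nat.zero_add (n + 1)) X (fun _ => C f) (Fin.cons g v))
      (ρ := fun u t => optPt u (Fin.cons t t')) (fun i => ?_)
    · convert this using 3 with u t
      rw [evalAt_boxLam_zero h1 h2]
      have : List.ofFn (zipFn (Fin.cons g v : Fin (n + 1) → V) (Fin.cons t t'))
        = (g, t) :: List.ofFn (zipFn v t') := by rw [List.ofFn_succ]; rfl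
      rw [this]
    · rcases i with _ | i
      · exact Or.inl fun _ _ => rfl
      · exact Or.inr (Fin.cases (Or.inl fun _ _ => rfl) (fun i => Or.inr ⟨_, fun _ _ => rfl⟩) i)
  -- Transforming in the variable of g cancels the ∂ in the substitution for u, leaving the bracket
  -- with f at a fixed scalar. There the transform in g is already known to be a vector field.
  have e2 : ∀ g, (opEval A.dl (-s) fun t => toList (Pi.single (n + 2) X) ((g, t) :: (f, t₀) :: l))
      = -opEval A.dl (-s) fun t => D (-(lamSum l + t₀ + -s)) ((g, t) :: l) := by
    intro g
    simp only [e, opEval_neg]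
    rw [((hpoly g).opEval_opEval A.dl _ _).2.1]
  simp only [e2]
  exact (hvect _).neg

theorem evalAt_pow_totalD (t : Fin 1 → F) (m : ℕ) (P : MvPolynomial (Fin 1) V) :
    evalAt t (((A.totalD 1 : Module.End F (MvPolynomial (Fin 1) V)) ^ m) P)
      = (A.opd (t 0) ^ m) (evalAt t P) := by
  induction m generalizing P with
  | zero => simp
  | succ m ih =>
    rw [pow_succ, pow_succ, Module.End.mul_apply, Module.End.mul_apply, ih, evalAt_totalD]
    simp

theorem evalAt_pow_neg_totalD (t : Fin 1 → F) (m : ℕ) (P : MvPolynomial (Fin 1) V) :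
    evalAt t (((-A.totalD 1 : Module.End F (MvPolynomial (Fin 1) V)) ^ m) P)
      = ((-A.opd (t 0)) ^ m) (evalAt t P) := by
  induction m generalizing P with
  | zero => simp
  | succ m ih =>
    rw [pow_succ, pow_succ, Module.End.mul_apply, Module.End.mul_apply, ih, LinearMap.neg_apply,
      map_neg, evalAt_totalD]
    simp

theorem evalAt_confVF [Fintype I] (P : I → Polynomial V) (v : Fin 1 → V) (t : Fin 1 → F) :
    evalAt t (A.confVF P v) = A.confAt P (v 0) (t 0) := by
  rw [confVF, confAt, map_sum]
  refine Finset.sum_congr rfl fun i _ => ?_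
  rw [diffOp, Polynomial.sum, Polynomial.sum, map_sum]
  refine Finset.sum_congr rfl fun m _ => ?_
  rw [map_mul, evalAt_C, evalAt_pow_totalD, euler, eulerAt, map_sum]
  simp only [evalAt_pow_neg_totalD, evalAt_C]

theorem mem_CVect_iff [Fintype I] {X : A.Coch 1} :
    X ∈ A.CVect ↔ A.Admissible (toList (Pi.single 1 X)) := by
  constructor
  · rintro ⟨P, rfl⟩
    refine ⟨⟨_, rfl⟩, fun l₁ a b l₂ => ?_, fun l => ?_⟩
    · rw [toList_single_of_length_ne _ (by simp; omega),
        toList_single_of_length_ne _ (by simp; omega), neg_zero]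
    · cases l with
      | nil =>
        refine ⟨P, fun g t => ?_⟩
        have := toList_single_zipFn (A.confVF P) (fun _ => g) (fun _ => t)
        rw [evalAt_confVF] at this
        exact this
      | cons a l =>
        simp only [toList_single_of_length_ne _ (l := (_, _) :: a :: l) (n := 1) (by simp)]
        exact IsConf.zero
  · intro h
    obtain ⟨P, hP⟩ := h.conf []
    refine ⟨P, funext fun v => eq_of_evalAt_eq (F := F) fun t => ?_⟩
    rw [evalAt_confVF, ← hP, ← toList_single_zipFn]
    rfl

/-- For the converse in higher degree, the bracket with f is the bracket with an admissible scalar,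
and its coefficients in λ are admissible by `IsExpansion.admissible`. -/
theorem mem_fullProlongation_iff [Fintype I] {n : ℕ} {X : A.Coch n} :
    X ∈ A.fullProlongation A.CVect n ↔ A.Admissible (toList (Pi.single n X)) := by
  induction n with
  | zero =>
    refine ⟨fun _ => ?_, fun _ => trivial⟩
    -- With no arguments there are no variables, so X is an element of V.
    have : X = fun _ => C (evalAt (fun _ => (0 : F)) (X Fin.elim0)) := by
      funext v
      refine eq_of_evalAt_eq (F := F) fun t => ?_
      rw [evalAt_C, Subsingleton.elim v Fin.elim0, Subsingleton.elim t fun _ => 0]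
    rw [this, toList_single_zero]
    exact admissible_scalarFun _
  | succ n ih =>
    cases n with
    | zero => exact mem_CVect_iff
    | succ n =>
      refine ⟨fun h => admissible_of_mem_tildeWd h.1 fun f j => ih.1 (h.2 f j), fun h =>
        ⟨h.mem_tildeWd, fun f j => ih.2 ?_⟩⟩
      refine (isExpansion_boxLam_zero h.map_add h.map_smul f).admissible (fun s => ?_)
        (fun j => ⟨_, rfl⟩) j
      have := h.br (admissible_scalarFun f) s
      rwa [funext (br_scalarFun h s f)] at this

theorem admissible_iff_forall_mem [Fintype I] {Z : ∀ n, A.Coch n} :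
    A.Admissible (toList Z) ↔ ∀ n, Z n ∈ A.fullProlongation A.CVect n := by
  simp only [mem_fullProlongation_iff, admissible_toList_iff (Z := Z)]

end DiffFunctionAlgebra

namespace DiffFunctionAlgebra

open PolyFun MvPolynomial Filter

variable {F V I : Type*} [Field F] [CommRing V] [Algebra F V] [Infinite F]
  {A : DiffFunctionAlgebra F V I}

/-! ## Admissible functions are determined by their values on generators -/

section uniqueness

variable [Fintype I]

/-- Sesquilinearity extends the vanishing to all u_i^(n). The transformed vector fields then have
zero coefficients, and the inverse transform gives φ = 0. -/
theorem IsConf.eq_zero {φ : V → F → V} (h : A.IsConf φ) (hu : ∀ i t, φ (A.u i) t = 0) (g : V)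
    (t : F) : φ g t = 0 := by
  have h1 : ∀ i n t, φ (A.uvar (i, n)) t = 0 := by
    intro i n t
    induction n with
    | zero => exact hu i t
    | succ n ih => rw [uvar_succ, h.map_d, ih, smul_zero, neg_zero]
  have h2 : ∀ s, opEval A.dl (0 - s) (φ g) = 0 := by
    intro s
    have := h.isVect s g
    rw [zero_sub]
    refine this.trans (Finset.sum_eq_zero fun q _ => ?_)
    have e : φ (A.uvar q) = fun _ => 0 := funext fun t => h1 q.1 q.2 t
    beta_reduce
    rw [e, opEval_zero, mul_zero]
  have h3 := opEval_opEval A.dl (-t) 0 (h.mem g)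
  rw [show (fun s => opEval A.dl (0 - s) (φ g)) = fun _ => 0 from funext h2, opEval_zero,
    zero_sub, neg_neg] at h3
  exact h3.symm

theorem Admissible.eq_zero {X : List (V × F) → V} (h : A.Admissible X)
    (hu : ∀ l, (∀ a ∈ l, ∃ i, a.1 = A.u i) → X l = 0) (l : List (V × F)) : X l = 0 := by
  induction l generalizing X with
  | nil => exact hu [] (by simp)
  | cons a l ih =>
    refine (h.conf l).eq_zero (fun i t => ih (h.contr (A.u i, t)) fun l' hl' => ?_) a.1 a.2
    refine hu _ fun b hb => ?_
    rcases List.mem_cons.mp hb with rfl | hb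
    · exact ⟨i, rfl⟩
    · exact hl' b hb

theorem Admissible.ext {X Y : List (V × F) → V} (hX : A.Admissible X) (hY : A.Admissible Y)
    (hu : ∀ l, (∀ a ∈ l, ∃ i, a.1 = A.u i) → X l = Y l) : X = Y := by
  funext l
  have := (hX.add hY.neg).eq_zero (fun l hl => by
    rw [Pi.add_apply, Pi.neg_apply, hu l hl, add_neg_cancel]) l
  exact add_neg_eq_zero.mp this

theorem ext_of_single {n : ℕ} {X Y : A.Coch n} (hX : A.Admissible (toList (Pi.single n X)))
    (hY : A.Admissible (toList (Pi.single n Y)))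
    (h : ∀ i : Fin n → I, X (A.u ∘ i) = Y (A.u ∘ i)) : X = Y := by
  have := hX.ext hY fun l hl => ?_
  · have := congrFun (toList_ext this) n
    rwa [Pi.single_eq_same, Pi.single_eq_same] at this
  · by_cases hn : l.length = n
    · obtain ⟨v, t, rfl⟩ := exists_eq_ofFn_zipFn hn
      have hv : ∀ j, ∃ i, v j = A.u i := fun j =>
        hl (zipFn v t j) (List.mem_ofFn.mpr ⟨j, rfl⟩)
      choose i hi using hv
      rw [toList_single_zipFn, toList_single_zipFn, show v = A.u ∘ i from funext hi, h]
    · rw [toList_single_of_length_ne X hn, toList_single_of_length_ne Y hn]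

end uniqueness

/-! ## Evaluation of the master formula -/

section master

variable {n : ℕ}

variable (A) in
/-- `P(t_0 + ∂, …, t_{n-1} + ∂)`, where the `s`-th `∂` acts on `h_s`. -/
def multiOp (t : Fin n → F) (h : Fin n → V) : MvPolynomial (Fin n) V →ₗ[F] V :=
  (Finsupp.lsum F fun β : Fin n →₀ ℕ =>
      LinearMap.mulRight F (∏ s, (A.opd (t s) ^ β s) (h s)))
    ∘ₗ (AddMonoidAlgebra.coeffLinearEquiv F).toLinearMap

theorem multiOp_monomial (t : Fin n → F) (h : Fin n → V) (β : Fin n →₀ ℕ) (c : V) :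
    A.multiOp t h (monomial β c) = c * ∏ s, (A.opd (t s) ^ β s) (h s) := by
  have : (AddMonoidAlgebra.coeffLinearEquiv F) (monomial β c : MvPolynomial (Fin n) V)
      = Finsupp.single β c := rfl
  simp [multiOp, this]

theorem multiOp_C (t : Fin n → F) (h : Fin n → V) (c : V) :
    A.multiOp t h (C c) = c * ∏ s, h s := by
  have := multiOp_monomial (A := A) t h 0 c
  simpa using this

theorem multiOp_mul_X (t : Fin n → F) (h : Fin n → V) (P : MvPolynomial (Fin n) V) (r : Fin n) :
    A.multiOp t h (P * X r) = A.multiOp t (Function.update h r (A.opd (t r) (h r))) P := by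
  induction P using MvPolynomial.induction_on' with
  | monomial β c =>
    rw [X, monomial_mul, multiOp_monomial, multiOp_monomial, mul_one]
    congr 1
    refine Finset.prod_congr rfl fun s _ => ?_
    by_cases hs : s = r
    · subst hs
      simp [pow_succ]
    · simp [hs, Finsupp.single_apply, Ne.symm hs]
  | add p q hp hq => rw [add_mul, map_add, hp, hq, map_add]

theorem multiOp_rename (t : Fin n → F) (h : Fin n → V) (P : MvPolynomial (Fin n) V)
    (σ : Equiv.Perm (Fin n)) : A.multiOp t h (rename σ P) = A.multiOp (t ∘ σ) (h ∘ σ) P := by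
  induction P using MvPolynomial.induction_on' with
  | monomial β c =>
    rw [rename_monomial, multiOp_monomial, multiOp_monomial, ← Equiv.prod_comp σ]
    simp only [Finsupp.mapDomain_apply σ.injective, Function.comp_apply]
  | add p q hp hq => simp only [map_add, hp, hq]

theorem opd_pow_one (t : F) (m : ℕ) : (A.opd t ^ m) (1 : V) = algebraMap F V (t ^ m) := by
  induction m with
  | zero => simp
  | succ m ih =>
    rw [pow_succ', Module.End.mul_apply, ih, opd_apply, Derivation.map_algebraMap, add_zero,
      pow_succ', map_mul, Algebra.smul_def]

theorem multiOp_one (t : Fin n → F) (P : MvPolynomial (Fin n) V) :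
    A.multiOp t (fun _ => 1) P = evalAt t P := by
  induction P using MvPolynomial.induction_on' with
  | monomial β c =>
    rw [multiOp_monomial, evalAt_monomial, Algebra.smul_def, mul_comm, Finsupp.prod_fintype _ _
      (by simp), map_prod]
    simp only [opd_pow_one]
  | add p q hp hq => simp only [map_add, hp, hq]

variable (A) in
/-- `multiOp` as a multilinear map. -/
def multiOpML (t : Fin n → F) (P : MvPolynomial (Fin n) V) :
    MultilinearMap F (fun _ : Fin n => V) V :=
  ∑ β ∈ P.support, (LinearMap.mulLeft F (P.coeff β)).compMultilinearMap
    ((MultilinearMap.mkPiAlgebra F (Fin n) V).compLinearMap fun s => A.opd (t s) ^ β s)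

theorem multiOp_eq (t : Fin n → F) (h : Fin n → V) (P : MvPolynomial (Fin n) V) :
    A.multiOp t h P = A.multiOpML t P h := by
  conv_lhs => rw [P.as_sum]
  rw [map_sum, multiOpML, sum_apply]
  refine Finset.sum_congr rfl fun β _ => ?_
  rw [multiOp_monomial]
  simp

theorem prod_insertAt_C (L : List (Fin n)) (g : Fin n → V) (c : V) :
    (L.map fun s => (A.insertAt s (g s) : Module.End F (MvPolynomial (Fin n) V))).prod (C c)
      = C (c * (L.map g).prod) := by
  induction L with
  | nil => simp
  | cons a L ih =>
    rw [List.map_cons, List.prod_cons, Module.End.mul_apply, ih, insertAt_C, List.map_cons,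
      List.prod_cons]
    congr 1; ring

/-- Only the operator in the variable λ_r sees the factor λ_r, and absence of repetitions makes it
unique, so exactly one entry of g is differentiated. -/
theorem prod_insertAt_mul_X {L : List (Fin n)} (hL : L.Nodup) (g : Fin n → V)
    (P : MvPolynomial (Fin n) V) (r : Fin n) :
    (L.map fun s => (A.insertAt s (g s) : Module.End F (MvPolynomial (Fin n) V))).prod (P * X r)
      = (L.map fun s => (A.insertAt s (g s) : Module.End F (MvPolynomial (Fin n) V))).prod P * X r
        + if r ∈ L then (L.map fun s => (A.insertAt s (Function.update g r (A.d (g r)) s) :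
          Module.End F (MvPolynomial (Fin n) V))).prod P else 0 := by
  induction L with
  | nil => simp
  | cons a L ih =>
    obtain ⟨ha, hL⟩ := List.nodup_cons.mp hL
    simp only [List.map_cons, List.prod_cons, Module.End.mul_apply]
    rw [ih hL, map_add, insertAt_mul_X, add_assoc]
    congr 1
    by_cases h : r = a
    · subst h
      rw [if_pos rfl, if_neg ha, map_zero, add_zero, if_pos List.mem_cons_self,
        Function.update_self]
      congr 3
      refine List.map_congr_left fun s hs => ?_
      rw [Function.update_of_ne (by rintro rfl; exact ha hs)]
    · rw [if_neg h, zero_add]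
      simp only [List.mem_cons, h, false_or]
      split_ifs
      · rw [Function.update_of_ne (Ne.symm h)]
      · rw [map_zero]

/-- Each e^{∂∂_λ} shifts its own variable by ∂ acting on its own insertion, so at scalars the
product replaces λ_s by t_s + ∂ acting on g_s. -/
theorem evalAt_prod_insertAt (t : Fin n → F) (g : Fin n → V) (P : MvPolynomial (Fin n) V) :
    evalAt t ((List.ofFn fun s => (A.insertAt s (g s) :
      Module.End F (MvPolynomial (Fin n) V))).prod P) = A.multiOp t g P := by
  rw [List.ofFn_eq_map]
  induction P using MvPolynomial.induction_on generalizing g with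
  | C c =>
    rw [prod_insertAt_C, evalAt_C, multiOp_C, ← List.ofFn_eq_map, List.prod_ofFn]
  | add p q hp hq => simp only [map_add, hp, hq]
  | mul_X P r ih =>
    rw [prod_insertAt_mul_X (List.nodup_finRange n), if_pos (List.mem_finRange r), map_add,
      evalAt_mul_X, ih, ih, multiOp_mul_X, multiOp_eq, multiOp_eq, multiOp_eq, opd_apply,
      MultilinearMap.map_update_add, MultilinearMap.map_update_smul, Function.update_eq_self]

theorem multiOp_neg_mulLeft_pow (t : Fin n → F) (a : Fin n) (k : ℕ) (g : Fin n → V)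
    (P : MvPolynomial (Fin n) V) :
    A.multiOp t g (((-LinearMap.mulLeft F (X a) : Module.End F (MvPolynomial (Fin n) V)) ^ k) P)
      = A.multiOp t (Function.update g a (((-A.opd (t a)) ^ k) (g a))) P := by
  induction k generalizing g with
  | zero => simp
  | succ k ih =>
    rw [pow_succ', Module.End.mul_apply, LinearMap.neg_apply, LinearMap.mulLeft_apply, map_neg,
      mul_comm, multiOp_mul_X, ih, Function.update_idem, Function.update_self, multiOp_eq,
      ← MultilinearMap.map_update_neg, multiOp_eq, pow_succ, Module.End.mul_apply,
      LinearMap.neg_apply, map_neg]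

theorem multiOp_prod_neg_mulLeft (t : Fin n → F) {L : List (Fin n)} (hL : L.Nodup) (m : Fin n → ℕ)
    (g : Fin n → V) (P : MvPolynomial (Fin n) V) :
    A.multiOp t g ((L.map fun s =>
      (-LinearMap.mulLeft F (X s) : Module.End F (MvPolynomial (Fin n) V)) ^ m s).prod P)
      = A.multiOp t (fun s => if s ∈ L then ((-A.opd (t s)) ^ m s) (g s) else g s) P := by
  induction L generalizing g with
  | nil => simp
  | cons a L ih =>
    obtain ⟨ha, hL⟩ := List.nodup_cons.mp hL
    rw [List.map_cons, List.prod_cons, Module.End.mul_apply, multiOp_neg_mulLeft_pow, ih hL]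
    congr 2
    funext s
    by_cases h : s = a
    · subst h
      simp [ha]
    · simp [h]

variable (A) in
/-- The right-hand side of the master formula for given values on the generators. -/
def masterPoly (R : (Fin n → I) → MvPolynomial (Fin n) V) : A.Coch n := fun f =>
  ∑ q ∈ Fintype.piFinset fun s => A.supp (f s),
    ((List.ofFn fun s => (A.insertAt s (A.pd (q s).1 (q s).2 (f s)) :
        Module.End F (MvPolynomial (Fin n) V))).prod)
      (((List.ofFn fun s => (-(LinearMap.mulLeft F (X s)) :
        Module.End F (MvPolynomial (Fin n) V)) ^ (q s).2).prod) (R fun s => (q s).1))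

variable [Fintype I]

theorem sum_supp_eq_eulerAt [DecidableEq I] (i : I) (t : F) (g : V) :
    (∑ q ∈ A.supp g, if q.1 = i then ((-A.opd t) ^ q.2) (A.pd q.1 q.2 g) else 0)
      = A.eulerAt i t g := by
  classical
  rw [← Finset.sum_filter, eulerAt_eq_sum A i t g subset_rfl]
  symm
  have hsub : ((A.supp g).filter fun q => q.1 = i).image Prod.snd ⊆ (A.supp g).image Prod.snd :=
    Finset.image_subset_image (Finset.filter_subset _ _)
  rw [← Finset.sum_subset hsub, Finset.sum_image]
  · refine Finset.sum_congr rfl fun q hq => ?_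
    rw [(Finset.mem_filter.mp hq).2]
  · intro q hq q' hq' h
    exact Prod.ext ((Finset.mem_filter.mp hq).2.trans (Finset.mem_filter.mp hq').2.symm) h
  · intro k _ hk
    have : (i, k) ∉ A.supp g := fun h => hk (Finset.mem_image.mpr
      ⟨(i, k), Finset.mem_filter.mpr ⟨h, rfl⟩, rfl⟩)
    rw [A.pd_eq_zero this, map_zero]

/-- The factor (-λ_s)^m becomes (-t_s - ∂)^m acting on ∂f_s/∂u_i^(m), and the sum over m assembles
the Euler operator. In this form alternation and conformality of the master formula can be read off.
-/
theorem evalAt_masterPoly (R : (Fin n → I) → MvPolynomial (Fin n) V) (f : Fin n → V)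
    (t : Fin n → F) : evalAt t (A.masterPoly R f)
      = ∑ i : Fin n → I, A.multiOp t (fun s => A.eulerAt (i s) (t s) (f s)) (R i) := by
  classical
  have h1 : ∀ q : Fin n → I × ℕ, evalAt t (((List.ofFn fun s =>
        (A.insertAt s (A.pd (q s).1 (q s).2 (f s)) :
        Module.End F (MvPolynomial (Fin n) V))).prod)
      (((List.ofFn fun s => (-(LinearMap.mulLeft F (X s)) :
        Module.End F (MvPolynomial (Fin n) V)) ^ (q s).2).prod) (R fun s => (q s).1)))
      = ∑ i : Fin n → I, A.multiOpML t (R i) (fun s => if (q s).1 = i s then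
          ((-A.opd (t s)) ^ (q s).2) (A.pd (q s).1 (q s).2 (f s)) else 0) := by
    intro q
    rw [evalAt_prod_insertAt, List.ofFn_eq_map,
      multiOp_prod_neg_mulLeft t (List.nodup_finRange n) (fun s => (q s).2),
      -- The sum over all i is inserted with Kronecker deltas, so that multilinearity can later turn
      -- the sum over q into a product of sums.
      Finset.sum_eq_single fun s => (q s).1]
    · simp [multiOp_eq]
    · intro i _ hi
      obtain ⟨s, hs⟩ := Function.ne_iff.mp hi
      exact MultilinearMap.map_coord_zero _ s (if_neg (Ne.symm hs))
    · simp
  rw [masterPoly, map_sum]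
  simp only [h1]
  rw [Finset.sum_comm]
  refine Finset.sum_congr rfl fun i _ => ?_
  rw [multiOp_eq]
  simp only [← sum_supp_eq_eulerAt]
  rw [MultilinearMap.map_sum_finset]

theorem isConf_sum {ι : Type*} (S : Finset ι) {φ : ι → V → F → V} (h : ∀ i, A.IsConf (φ i)) :
    A.IsConf fun g t => ∑ i ∈ S, φ i g t := by
  classical
  induction S using Finset.induction_on with
  | empty => simpa using IsConf.zero
  | insert a S ha ih => simp only [Finset.sum_insert ha]; exact (h a).add ih

theorem isConf_opd_pow_eulerAt (j : I) (m : ℕ) :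
    A.IsConf fun g r => (A.opd r ^ m) (A.eulerAt j r g) := by
  classical
  refine ⟨fun i => if i = j then Polynomial.monomial m 1 else 0, fun g t => ?_⟩
  rw [confAt, Finset.sum_eq_single j]
  · rw [if_pos rfl, diffOp_monomial, one_mul]
  · intro i _ hi
    rw [if_neg hi, diffOp_zero_left]
  · simp

theorem isConf_multiOp {k : ℕ} (P : MvPolynomial (Fin (k + 1)) V) (j : I) (t : Fin k → F)
    (h : Fin k → V) :
    A.IsConf fun g r => A.multiOp (Fin.cons r t) (Fin.cons (A.eulerAt j r g) h) P := by
  induction P using MvPolynomial.induction_on' with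
  | monomial β c =>
    simp only [multiOp_monomial, Fin.prod_univ_succ, Fin.cons_zero, Fin.cons_succ]
    have := (isConf_opd_pow_eulerAt (A := A) j (β 0)).mul_left
      (c * ∏ s : Fin k, (A.opd (t s) ^ β s.succ) (h s))
    convert this using 3
    ring
  | add p q hp hq => simp only [map_add]; exact hp.add hq

/-- Skewsymmetric collections of values on the generators. -/
def IsSkew (R : (Fin n → I) → MvPolynomial (Fin n) V) : Prop :=
  ∀ (σ : Equiv.Perm (Fin n)) i, rename σ (R (i ∘ σ)) = (Equiv.Perm.sign σ : ℤ) • R i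

/-- Skewsymmetry follows by reindexing the sum over i. In the first argument the formula is a
differential operator in r + ∂ applied to Euler operators, hence a conformal vector field. -/
theorem IsSkew.admissible {R : (Fin n → I) → MvPolynomial (Fin n) V} (hR : IsSkew R) :
    A.Admissible (toList (Pi.single n (A.masterPoly R))) where
  poly := ⟨_, rfl⟩
  alt := by
    refine apply_append_swap fun m σ a => ?_
    by_cases hm : m = n
    · subst hm
      have e : a = zipFn (fun i => (a i).1) fun i => (a i).2 := rfl
      rw [e, zipFn_comp, toList_single_zipFn, toList_single_zipFn, evalAt_masterPoly,
        evalAt_masterPoly, ← Equiv.sum_comp (Equiv.arrowCongr σ.symm (Equiv.refl I)),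
        Finset.smul_sum]
      refine Finset.sum_congr rfl fun i _ => ?_
      rw [← map_zsmul, ← hR, multiOp_rename]
      rfl
    · rw [toList_single_of_length_ne _ (by simpa using hm),
        toList_single_of_length_ne _ (by simpa using hm), smul_zero]
  conf l := by
    by_cases hl : l.length + 1 = n
    · obtain ⟨k, rfl⟩ : ∃ k, n = k + 1 := ⟨l.length, hl.symm⟩
      obtain ⟨v, t, rfl⟩ := exists_eq_ofFn_zipFn (show l.length = k by omega)
      simp only [toList_single_cons_zipFn, evalAt_masterPoly]
      refine isConf_sum _ fun i => ?_
      have := isConf_multiOp (A := A) (R i) (i 0) t fun s => A.eulerAt (i s.succ) (t s) (v s)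
      convert this using 5 with g r
      funext s
      refine Fin.cases rfl (fun s => rfl) s
    · simp only [toList_single_of_length_ne _ (l := (_, _) :: l) hl]
      exact IsConf.zero

theorem masterPoly_u (R : (Fin n → I) → MvPolynomial (Fin n) V) (i : Fin n → I) :
    A.masterPoly R (A.u ∘ i) = R i := by
  classical
  refine eq_of_evalAt_eq (F := F) fun t => ?_
  rw [evalAt_masterPoly, Finset.sum_eq_single i]
  · simp [eulerAt_u, multiOp_one]
  · intro j _ hj
    obtain ⟨s, hs⟩ := Function.ne_iff.mp hj
    rw [multiOp_eq]
    refine MultilinearMap.map_coord_zero _ s ?_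
    rw [Function.comp_apply, eulerAt_u, if_neg hs]
  · simp

theorem Admissible.isSkew {X : A.Coch n} (h : A.Admissible (toList (Pi.single n X))) :
    IsSkew fun i => X (A.u ∘ i) := fun σ i => h.mem_tildeWd.2.2 σ (A.u ∘ i)

theorem Admissible.eq_masterPoly {X : A.Coch n} (h : A.Admissible (toList (Pi.single n X))) :
    X = A.masterPoly fun i => X (A.u ∘ i) :=
  ext_of_single h h.isSkew.admissible fun i =>
    (masterPoly_u (A := A) (fun i => X (A.u ∘ i)) i).symm

/-- All operators in the master formula descend to the quotient, so the formula may be computed from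
any lifts of the values on generators. -/
theorem toQ_masterPoly {R : (Fin n → I) → MvPolynomial (Fin n) V} {Y : A.QCoch n}
    (h : ∀ i, A.toQ n (R i) = Y (A.u ∘ i)) (f : Fin n → V) :
    A.toQ n (A.masterPoly R f) = A.masterRHS Y f := by
  have h1 : ∀ (L : List (Fin n)) (S : Fin n → Module.End F (MvPolynomial (Fin n) V))
      (T : Fin n → Module.End F (A.QPoly n)), (∀ s P, A.toQ n (S s P) = T s (A.toQ n P)) →
      ∀ P, A.toQ n ((L.map S).prod P) = (L.map T).prod (A.toQ n P) := by
    intro L S T hST P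
    induction L with
    | nil => rfl
    | cons a L ih =>
      rw [List.map_cons, List.prod_cons, Module.End.mul_apply, hST, ih, List.map_cons,
        List.prod_cons, Module.End.mul_apply]
  have h2 : ∀ (s : Fin n) (k : ℕ) P, A.toQ n (((-(LinearMap.mulLeft F (X s)) :
        Module.End F (MvPolynomial (Fin n) V)) ^ k) P)
      = ((-(A.mulLamQ s) : Module.End F (A.QPoly n)) ^ k) (A.toQ n P) := by
    intro s k P
    induction k with
    | zero => rfl
    | succ k ih =>
      rw [pow_succ', pow_succ', Module.End.mul_apply, Module.End.mul_apply, ← ih,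
        LinearMap.neg_apply, LinearMap.neg_apply, map_neg]
      rfl
  rw [masterPoly, masterRHS, map_sum]
  refine Finset.sum_congr rfl fun q _ => ?_
  rw [List.ofFn_eq_map, List.ofFn_eq_map, List.ofFn_eq_map, List.ofFn_eq_map,
    h1 _ _ (fun s => (A.insertAtQ s (A.pd (q s).1 (q s).2 (f s)) :
        Module.End F (A.QPoly n))) fun s P => rfl,
    h1 _ _ (fun s => (-(A.mulLamQ s) : Module.End F (A.QPoly n)) ^ (q s).2) fun s P => h2 s _ P, h]
  rfl

end master

/-! ## Antisymmetrization -/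

section asym

variable [CharZero F] {n : ℕ}

variable (F) in
/-- The antisymmetrization of a collection of polynomials. -/
def asym (S : (Fin n → I) → MvPolynomial (Fin n) V) (i : Fin n → I) : MvPolynomial (Fin n) V :=
  ((n.factorial : F)⁻¹) • ∑ σ : Equiv.Perm (Fin n), (Equiv.Perm.sign σ : ℤ) • rename σ (S (i ∘ σ))

theorem isSkew_asym (S : (Fin n → I) → MvPolynomial (Fin n) V) : IsSkew (asym F S) := by
  intro τ i
  have hr : ∀ (r : F) (P : MvPolynomial (Fin n) V), rename τ (r • P) = r • rename τ P := fun r P =>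
    map_smul ((rename (R := V) τ).toLinearMap.restrictScalars F) r P
  rw [asym, asym, hr, smul_comm (_ : ℤ), map_sum]
  congr 1
  rw [Finset.smul_sum]
  conv_rhs => rw [← Equiv.sum_comp (Equiv.mulLeft τ)]
  refine Finset.sum_congr rfl fun σ _ => ?_
  rw [map_zsmul, rename_rename, Equiv.coe_mulLeft, map_mul, smul_smul, Function.comp_assoc,
    ← Equiv.Perm.coe_mul, Units.val_mul, ← mul_assoc, ← Units.val_mul,
    Int.units_mul_self, Units.val_one, one_mul]

/-- Averaging changes the lifts but not their images, since these are already skewsymmetric. It is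
applied with T the quotient map, for surjectivity of ∫, and with T = λ_0 + ⋯ + λ_k + ∂, for its
kernel. -/
theorem map_asym {M : Type*} [AddCommGroup M] [Module F M] (T : MvPolynomial (Fin n) V →ₗ[F] M)
    {S : (Fin n → I) → MvPolynomial (Fin n) V} {W : (Fin n → I) → M}
    (h : ∀ (σ : Equiv.Perm (Fin n)) i,
      T (rename σ (S (i ∘ σ))) = (Equiv.Perm.sign σ : ℤ) • W i) (i : Fin n → I) :
    T (asym F S i) = W i := by
  rw [asym, map_smul, map_sum]
  simp only [map_zsmul, h, smul_smul]
  have : ∀ σ : Equiv.Perm (Fin n), ((Equiv.Perm.sign σ : ℤ) * (Equiv.Perm.sign σ : ℤ)) = 1 :=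
    fun σ => by rw [← Units.val_mul, Int.units_mul_self, Units.val_one]
  simp only [this, one_smul, Finset.sum_const, Finset.card_univ, Fintype.card_perm,
    Fintype.card_fin]
  rw [← Nat.cast_smul_eq_nsmul F, smul_smul, inv_mul_cancel₀, one_smul]
  exact_mod_cast n.factorial_ne_zero

end asym

end DiffFunctionAlgebra

namespace DiffFunctionAlgebra

open PolyFun MvPolynomial Filter

variable {F V I : Type*} [Field F] [CommRing V] [Algebra F V] [Infinite F]
  {A : DiffFunctionAlgebra F V I}

/-! ## Box products and the quotient by `λ_0 + ⋯ + λ_k + ∂` -/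

theorem isConst_of_evalAt {τ : Type*} {α : MvPolynomial τ V}
    (h : ∀ t : τ → F, ∃ c : F, evalAt t α = algebraMap F V c) : A.IsConst α := fun P =>
  eq_of_evalAt_eq (F := F) fun t => by
    obtain ⟨c, hc⟩ := h t
    rw [evalAt_coeffD, map_mul (evalAt t), map_mul (evalAt t), evalAt_coeffD, hc, mul_comm, ← Algebra.smul_def,
      Derivation.map_smul, Algebra.smul_def, mul_comm]

theorem isConst_rename_monomial {τ κ : Type*} (g : κ → τ) (β : κ →₀ ℕ) :
    A.IsConst (rename g (monomial β (1 : V))) :=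
  isConst_of_evalAt fun t => ⟨_, by
    rw [evalAt_rename, evalAt_monomial, Algebra.smul_def, mul_one]⟩

theorem IsConst.mul_totalD {n : ℕ} {α : MvPolynomial (Fin n) V} (h : A.IsConst α)
    (P : MvPolynomial (Fin n) V) : α * A.totalD n P = A.totalD n (α * P) := by
  rw [totalD, LinearMap.add_apply, LinearMap.add_apply, LinearMap.mulLeft_apply,
    LinearMap.mulLeft_apply, mul_comm α P, h, mul_add]
  ring

theorem IsConst.mul_mem_range {n : ℕ} {α : MvPolynomial (Fin n) V} (h : A.IsConst α)
    {P : MvPolynomial (Fin n) V} (hP : P ∈ LinearMap.range (A.totalD n)) :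
    α * P ∈ LinearMap.range (A.totalD n) := by
  obtain ⟨R, rfl⟩ := hP
  exact ⟨α * R, (h.mul_totalD R).symm⟩

theorem sum_fst_add_sum_snd {M : Type*} [AddCommMonoid M] {a b k : ℕ} (e : a + b = k)
    (σ : Equiv.Perm (Fin k)) (w : Fin k → M) :
    ∑ j, w (fst e σ j) + ∑ j, w (snd e σ j) = ∑ j, w j := by
  subst e
  rw [← Equiv.sum_comp σ, Fin.sum_univ_add]
  rfl

theorem shuffleBox_sub_mem {h m k : ℕ} (e : m + h = k)
    {θ θ' : Equiv.Perm (Fin k) → Polynomial (MvPolynomial (Fin k) V)}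
    {X X' : A.Coch (h + 1)} (Y : A.Coch m) (v : Fin k → V)
    (H : ∀ σ g, A.moveLeft (Fin k) (aeval
          (Fin.cons (θ σ) (fun j => Polynomial.C (MvPolynomial.X (snd e σ j))) :
            Fin (h + 1) → Polynomial (MvPolynomial (Fin k) V))
          (X (Fin.cons g (v ∘ snd e σ) : Fin (h + 1) → V)))
        - A.moveLeft (Fin k) (aeval
          (Fin.cons (θ' σ) (fun j => Polynomial.C (MvPolynomial.X (snd e σ j))) :
            Fin (h + 1) → Polynomial (MvPolynomial (Fin k) V))
          (X' (Fin.cons g (v ∘ snd e σ) : Fin (h + 1) → V))) ∈ LinearMap.range (A.totalD k)) :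
    A.shuffleBox e id θ X Y v - A.shuffleBox e id θ' X' Y v ∈ LinearMap.range (A.totalD k) := by
  rw [shuffleBox, shuffleBox, ← Finset.sum_sub_distrib]
  refine Submodule.sum_mem _ fun σ _ => ?_
  rw [← smul_sub, ← Finset.sum_sub_distrib]
  refine zsmul_mem (Submodule.sum_mem _ fun β _ => ?_) _
  rw [← mul_sub]
  exact (isConst_rename_monomial _ β).mul_mem_range (H σ _)

/-- The values substituted for the first variable differ by the total operator: minus the second
block minus ∂ is the first block minus (λ_0 + ⋯ + λ_{k-1} + ∂), whose image is divided out. -/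
theorem toQ_boxL {h m k : ℕ} (e : m + h = k) (X : A.Coch (h + 1)) (Y : A.Coch m)
    (v : Fin k → V) : A.toQ k (A.boxL e X Y v) = A.toQ k (A.box e X Y v) := by
  rw [← sub_eq_zero, ← map_sub, Submodule.mkQ_apply, Submodule.Quotient.mk_eq_zero]
  refine shuffleBox_sub_mem e Y v fun σ g => ?_
  set α : MvPolynomial (Fin k) V := -∑ j, MvPolynomial.X (snd e σ j) with hα
  set α' : MvPolynomial (Fin k) V := ∑ j, MvPolynomial.X (fst e σ j) with hα'
  have hc : A.IsConst α := (IsConst.sum _ fun j => A.isConst_X _).neg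
  have hc' : A.IsConst α' := IsConst.sum _ fun j => A.isConst_X _
  have hs : α = α' - ∑ j, MvPolynomial.X j := by
    rw [hα, hα', ← sum_fst_add_sum_snd e σ fun j => (MvPolynomial.X j : MvPolynomial (Fin k) V)]
    ring
  rw [← map_neg, ← hα]
  induction X (Fin.cons g (v ∘ snd e σ)) using MvPolynomial.induction_on with
  | C c => simp only [algHom_C, sub_self, zero_mem]
  | add p q hp hq =>
    simp only [map_add]
    have := add_mem hp hq
    rwa [sub_add_sub_comm] at this
  | mul_X p i hp =>
    obtain ⟨R, hR⟩ := hp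
    rw [map_mul (aeval _), map_mul (aeval _), aeval_X, aeval_X]
    refine Fin.cases ?_ (fun j => ?_) i
    · rw [Fin.cons_zero, Fin.cons_zero, mul_sub, map_sub, moveLeft_mul_C hc, moveLeft_mul_X,
        moveLeft_mul_C hc']
      generalize A.moveLeft (Fin k) _ = P at hR ⊢
      generalize A.moveLeft (Fin k) _ = Q at hR ⊢
      refine ⟨α' * R - P, ?_⟩
      rw [map_sub, ← hc'.mul_totalD, hR, totalD, LinearMap.add_apply, LinearMap.mulLeft_apply, hs]
      ring
    · rw [Fin.cons_succ, Fin.cons_succ, moveLeft_mul_C (A.isConst_X _),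
        moveLeft_mul_C (A.isConst_X _), ← sub_mul, ← hR, mul_comm]
      exact (A.isConst_X _).mul_mem_range ⟨R, rfl⟩

/-- The sum of the values of the variables of the first argument of a box product. -/
theorem sum_cons_snd {h m k : ℕ} (e : m + h = k) (σ : Equiv.Perm (Fin k)) (r : F) (t : Fin k → F) :
    ∑ i, (Fin.cons r (t ∘ snd e σ) : Fin (h + 1) → F) i = r + ∑ j, t (snd e σ j) := by
  rw [Fin.sum_univ_succ]; rfl

/-- Under the substitution defining □^L the sum of all variables of X plus ∂ becomes 0, so the image
of the total operator contributes nothing. -/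
theorem boxL_congr {h m k : ℕ} (e : m + h = k) {X X' : A.Coch (h + 1)}
    (hX : ∀ w, X w - X' w ∈ LinearMap.range (A.totalD (h + 1))) (Y : A.Coch m)
    (v : Fin k → V) : A.boxL e X Y v = A.boxL e X' Y v := by
  rw [boxL, boxL, shuffleBox, shuffleBox]
  refine Finset.sum_congr rfl fun σ _ => ?_
  congr 1
  refine Finset.sum_congr rfl fun β _ => ?_
  congr 1
  rw [← sub_eq_zero, ← map_sub, ← map_sub]
  obtain ⟨P, hP⟩ := hX (Fin.cons ((Y (v ∘ fst e σ)).coeff β) (v ∘ snd e σ))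
  rw [← hP]
  refine eq_of_evalAt_eq (F := F) fun t => ?_
  have key := fun P => evalAt_moveLeft_aeval (A := A) (t := t)
      (α := -∑ j, (MvPolynomial.X (snd e σ j) : MvPolynomial (Fin k) V))
      (c := -∑ j, t (snd e σ j)) (IsConst.sum _ fun j => A.isConst_X _).neg
      (by simp only [map_neg, evalAt_X, map_sum])
      (g := Fin.cons (-Polynomial.C (∑ j, MvPolynomial.X (snd e σ j) : MvPolynomial (Fin k) V)
        - Polynomial.X) (fun j => Polynomial.C (MvPolynomial.X (snd e σ j))))
      (ρ := fun r => (Fin.cons r (t ∘ snd e σ) : Fin (h + 1) → F)) (fun i => by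
        refine Fin.cases (Or.inl ⟨?_, fun r => rfl⟩) (fun j => Or.inr ?_) i
        · simp only [Fin.cons_zero, map_neg, map_sum]
        · exact ⟨_, t (snd e σ j), A.isConst_X _, rfl, by rw [evalAt_X], fun r => rfl⟩) P
  rw [map_zero]
  refine (key _).2.trans ?_
  have h1 := (key P).1
  simp only [evalAt_totalD, sum_cons_snd, opd_apply, add_smul, opEval_add, opEval_const_smul]
  rw [opEval_smul _ _ h1]
  have h2 := opEval_map A.dl (-∑ j, t (snd e σ j)) h1
  change (opEval A.dl _ fun r => A.d _) = A.d _ at h2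
  rw [h2]
  change _ - A.d _ + _ + _ = _
  module

theorem toQ_box_congr {h m k : ℕ} (e : m + h = k) {X X' : A.Coch (h + 1)}
    (hX : ∀ w, X w - X' w ∈ LinearMap.range (A.totalD (h + 1))) (Y : A.Coch m)
    (v : Fin k → V) : A.toQ k (A.box e X Y v) = A.toQ k (A.box e X' Y v) := by
  rw [← toQ_boxL, boxL_congr e hX, toQ_boxL]

variable [Fintype I]

theorem Admissible.apply_opd {X : List (V × F) → V} (h : A.Admissible X) (t : F) (g : V)
    (l : List (V × F)) : X ((A.opd t g, t) :: l) = 0 := by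
  rw [opd_apply, (h.conf l).map_add, (h.conf l).map_smul, (h.conf l).map_d, add_neg_cancel]

/-- The inner value enters X at the variable equal to the sum of its own λ's, and by sesquilinearity
X annihilates (λ + ∂)g in the slot with variable λ. -/
theorem box_congr_right {h m k : ℕ} (e : m + h = k) {X Y Y' : ∀ n, A.Coch n}
    (hX : A.Admissible (toList X)) (hY : ∀ n w, Y n w - Y' n w ∈ LinearMap.range (A.totalD n))
    (v : Fin k → V) : A.box e (X (h + 1)) (Y m) v = A.box e (X (h + 1)) (Y' m) v := by
  refine eq_of_evalAt_eq (F := F) fun t => ?_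
  rw [evalAt_box e hX, evalAt_box e hX]
  refine Finset.sum_congr rfl fun σ _ => ?_
  congr 1
  dsimp only
  rw [zipFn_comp, toList_zipFn, toList_zipFn]
  obtain ⟨P, hP⟩ := hY m (v ∘ fst e σ)
  have : evalAt (t ∘ fst e σ) (Y m (v ∘ fst e σ))
      = A.opd (lamSum (List.ofFn (zipFn (v ∘ fst e σ) (t ∘ fst e σ)))) (evalAt (t ∘ fst e σ) P)
        + evalAt (t ∘ fst e σ) (Y' m (v ∘ fst e σ)) := by
    rw [lamSum_ofFn_zipFn, ← evalAt_totalD, hP, map_sub, sub_add_cancel]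
  rw [this, hX.map_add, hX.apply_opd, zero_add]

/-- The `λ`-bracket at `λ = 0` in terms of box products. -/
theorem evalAt_boxL_sub_box {X Y : ∀ n, A.Coch n} (hX : A.Admissible (toList X))
    (hY : A.Admissible (toList Y)) {k : ℕ} (v : Fin k → V) (t : Fin k → F) :
    evalAt t (∑ h : Fin (k + 1),
      (A.boxL (Nat.sub_add_cancel (Nat.le_of_lt_succ h.isLt)) (X (h + 1)) (Y (k - h)) v
      - (-1 : ℤ) ^ ((h : ℕ) * (k - h + 1)) •
        A.box (Nat.sub_add_cancel (Nat.le_of_lt_succ h.isLt)) (Y (h + 1)) (X (k - h)) v))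
      = A.br 0 (toList X) (toList Y) (List.ofFn (zipFn v t)) := by
  rw [br_eq_splitSum hX hY, ← sum_blockSum_rev, ← sum_blockSum_rev, map_sum,
    ← Finset.sum_sub_distrib]
  refine Finset.sum_congr rfl fun h _ => ?_
  rw [map_sub, evalAt_boxL _ hX, map_zsmul, evalAt_box _ hY]
  simp only [neg_zero, zero_sub, zero_add]
  congr 1
  simp only [blockSum, Finset.smul_sum]
  refine Finset.sum_congr rfl fun σ _ => ?_
  rw [smul_comm, List.length_ofFn, List.length_ofFn]
  congr 4
  simp only [zipFn_comp, lamSum_ofFn_zipFn]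
  -- At λ = 0 the sum of all variables minus the second block is the first block.
  rw [← sum_fst_add_sum_snd (Nat.sub_add_cancel (Nat.le_of_lt_succ h.isLt)) σ t]
  simp

/-- Representatives of elements of the quotient. -/
theorem rep_sub_mem {X : ∀ n, A.Coch n} {W : ∀ n, A.QCoch n}
    (h : ∀ n v, W n v = A.toQ n (X n v)) (n : ℕ) (v : Fin n → V) :
    A.rep W n v - X n v ∈ LinearMap.range (A.totalD n) := by
  rw [← Submodule.Quotient.mk_eq_zero, Submodule.Quotient.mk_sub, sub_eq_zero]
  exact (Function.surjInv_eq (Submodule.mkQ_surjective (LinearMap.range (A.totalD n))) _).trans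
    (h n v)

theorem action_eq {X Y : ∀ n, A.Coch n} {W : ∀ n, A.QCoch n}
    (h : ∀ n v, W n v = A.toQ n (X n v)) (hX : A.Admissible (toList X))
    (hY : A.Admissible (toList Y)) {k : ℕ} (v : Fin k → V) (t : Fin k → F) :
    evalAt t (A.action W Y k v) = A.br 0 (toList X) (toList Y) (List.ofFn (zipFn v t)) := by
  rw [← evalAt_boxL_sub_box hX hY, action]
  refine congrArg (evalAt t) (Finset.sum_congr rfl fun i _ => ?_)
  rw [boxL_congr _ (rep_sub_mem h _), box_congr_right _ hY (rep_sub_mem h)]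

/-- Modulo the image of the total operator both box products depend only on the classes, and □^L may
be replaced by □. So admissible representatives may be used, and these give the λ-bracket at λ = 0.
-/
theorem lieBracket_eq {X Y : ∀ n, A.Coch n} {W W' : ∀ n, A.QCoch n}
    (h : ∀ n v, W n v = A.toQ n (X n v)) (h' : ∀ n v, W' n v = A.toQ n (Y n v))
    (hX : A.Admissible (toList X)) (hY : A.Admissible (toList Y)) {k : ℕ} (v : Fin k → V)
    {P : MvPolynomial (Fin k) V} (hP : ∀ t : Fin k → F, evalAt t P
      = A.br 0 (toList X) (toList Y) (List.ofFn (zipFn v t))) :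
    A.lieBracket W W' k v = A.toQ k P := by
  have := eq_of_evalAt_eq (F := F) fun t => (hP t).trans (evalAt_boxL_sub_box hX hY v t).symm
  rw [this, lieBracket, map_sum, map_sum]
  refine Finset.sum_congr rfl fun i _ => ?_
  rw [map_sub, map_sub, map_zsmul, map_zsmul, toQ_boxL, toQ_box_congr _ (rep_sub_mem h _),
    toQ_box_congr _ (rep_sub_mem h' _), box_congr_right _ hX (rep_sub_mem h'),
    box_congr_right _ hY (rep_sub_mem h)]

end DiffFunctionAlgebra

namespace DiffFunctionAlgebra

open PolyFun MvPolynomial Filter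

/-! ## Linear maps with values determined by an injective linear map -/

/-- The operations are first known as functions on lists; injectivity of evaluation turns them into
bilinear maps on the direct sums. -/
theorem exists_bilinear {F M₁ M₂ M E : Type*} [Field F] [AddCommGroup M₁] [Module F M₁]
    [AddCommGroup M₂] [Module F M₂] [AddCommGroup M] [Module F M] [AddCommGroup E] [Module F E]
    (e : M →ₗ[F] E) (he : Function.Injective e) (f : M₁ → M₂ → E)
    (h : ∀ x y, ∃ z, e z = f x y)
    (h1 : ∀ x x' y, f (x + x') y = f x y + f x' y) (h2 : ∀ (r : F) x y, f (r • x) y = r • f x y)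
    (h3 : ∀ x y y', f x (y + y') = f x y + f x y') (h4 : ∀ (r : F) x y, f x (r • y) = r • f x y) :
    ∃ B : M₁ →ₗ[F] M₂ →ₗ[F] M, ∀ x y, e (B x y) = f x y := by
  choose g hg using h
  exact ⟨LinearMap.mk₂ F g (fun x x' y => he (by rw [map_add, hg, hg, hg, h1]))
    (fun r x y => he (by rw [map_smul, hg, hg, h2]))
    (fun x y y' => he (by rw [map_add, hg, hg, hg, h3]))
    (fun r x y => he (by rw [map_smul, hg, hg, h4])), fun x y => hg x y⟩

variable {F V I : Type*} [Field F] [CommRing V] [Algebra F V]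

/-! ## Supports -/

/-- `X` vanishes unless the number of arguments lies in `S`. -/
def SuppIn (S : Set ℕ) (X : List (V × F) → V) : Prop := ∀ l, l.length ∉ S → X l = 0

theorem SuppIn.contr {S : Set ℕ} {X : List (V × F) → V} (h : SuppIn S X) (a : V × F) :
    SuppIn {n | n + 1 ∈ S} (contr a X) := fun l hl => h (a :: l) hl

theorem SuppIn.sgn {S : Set ℕ} {X : List (V × F) → V} (h : SuppIn S X) : SuppIn S (sgn X) :=
  fun l hl => by rw [DiffFunctionAlgebra.sgn, h l hl, smul_zero]

theorem SuppIn.cat_eq_zero {S T : Set ℕ} {X Y : List (V × F) → V} (hX : SuppIn S X)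
    (hY : SuppIn T Y) (l : List (V × F)) (h : ∀ m ∈ S, ∀ n ∈ T, m + n ≠ l.length) :
    cat X Y l = 0 := by
  induction l generalizing S T X Y with
  | nil =>
    rw [cat_nil]
    by_cases h0 : 0 ∈ S
    · rw [hY [] fun h1 => h 0 h0 0 h1 rfl, mul_zero]
    · rw [hX [] h0, zero_mul]
  | cons a l ih =>
    rw [cat_cons, ih (hX.contr a) hY.sgn fun m hm n hn e => h _ hm n hn (by
        rw [List.length_cons, ← e]; ring),
      ih hX (hY.contr a) fun m hm n hn e => h m hm _ hn (by rw [List.length_cons, ← e]; ring),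
      add_zero]

variable [Infinite F] {A : DiffFunctionAlgebra F V I} [Fintype I]

theorem SuppIn.br_eq_zero {S T : Set ℕ} {X Y : List (V × F) → V} (hX : SuppIn S X)
    (hY : SuppIn T Y) (hX' : A.Admissible X) (hY' : A.Admissible Y) (s : F) (l : List (V × F))
    (h : ∀ m ∈ S, ∀ n ∈ T, m + n ≠ l.length + 1) : A.br s X Y l = 0 := by
  induction l generalizing S T X Y s with
  | nil =>
    rw [br_nil]
    have e1 : A.adj X s (Y []) = 0 := by
      by_cases h0 : 0 ∈ T
      · have : ∀ a, X [a] = 0 := fun a => hX [a] fun h1 => h 1 h1 0 h0 rfl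
        simp only [adj, this, opEval_zero]
      · rw [hY [] h0, (hX'.isVect s).map_zero]
    have e2 : Y [(X [], s)] = 0 := by
      by_cases h0 : 0 ∈ S
      · exact hY _ fun h1 => h 0 h0 1 h1 rfl
      · rw [hX [] h0]
        have := (hY'.conf []).map_smul 0 0 s
        rw [zero_smul, zero_smul] at this
        exact this
    rw [e1, e2, sub_zero]
  | cons a l ih =>
    rw [br_cons, ih (hX.contr a) hY.sgn (hX'.contr a) hY'.sgn _ fun m hm n hn e =>
        h _ hm n hn (by rw [List.length_cons, ← e]; ring),
      ih hX (hY.contr a) hX' (hY'.contr a) _ fun m hm n hn e =>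
        h m hm _ hn (by rw [List.length_cons, ← e]; ring), neg_zero, add_zero]

theorem SuppIn.totalOp {S : Set ℕ} {X : List (V × F) → V} (h : SuppIn S X) :
    SuppIn S (A.totalOp X) := fun l hl => by
  rw [DiffFunctionAlgebra.totalOp, h l hl, map_zero]

theorem hasParity_of_suppIn {i : ZMod 2} {x : ℕ} (hx : (x : ZMod 2) = i) {X : List (V × F) → V}
    (h : SuppIn {n | (n : ZMod 2) = i} X) : HasParity x X := by
  funext l
  by_cases hl : (l.length : ZMod 2) = i
  · rw [sgn, Pi.smul_apply]
    have : (-1 : F) ^ l.length = (-1) ^ x := by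
      rw [← hx, ZMod.natCast_eq_natCast_iff'] at hl
      rw [← Nat.div_add_mod l.length 2, hl, pow_add, pow_mul, neg_one_sq, one_pow, one_mul]
      conv_rhs => rw [← Nat.div_add_mod x 2, pow_add, pow_mul, neg_one_sq, one_pow, one_mul]
    rw [this]
  · rw [sgn, Pi.smul_apply, h l hl, smul_zero, smul_zero]

theorem superSign_smul {M : Type*} [AddCommGroup M] [Module F M] {i j : ZMod 2} {x y : ℕ}
    (hx : (x : ZMod 2) = i) (hy : (y : ZMod 2) = j) (v : M) :
    superSign i j • v = (-1 : F) ^ (x * y) • v := by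
  subst hx hy
  rcases Nat.even_or_odd x with h | h
  · have h0 : (x : ZMod 2) = 0 := (ZMod.natCast_eq_zero_iff_even).2 h
    rw [(h.mul_right y).neg_one_pow, superSign, h0, if_neg (by simp)]; simp
  · have h1 : (x : ZMod 2) = 1 := (ZMod.natCast_eq_one_iff_odd).2 h
    rcases Nat.even_or_odd y with h' | h'
    · have h0 : (y : ZMod 2) = 0 := (ZMod.natCast_eq_zero_iff_even).2 h'
      rw [(h'.mul_left x).neg_one_pow, superSign, h0, if_neg (by simp)]; simp
    · have h0 : (y : ZMod 2) = 1 := (ZMod.natCast_eq_one_iff_odd).2 h'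
      rw [(h.mul h').neg_one_pow, superSign, h0, h1, if_pos ⟨rfl, rfl⟩]; simp

/-! ## The space of polyvector fields as a space of functions on lists -/

variable (A)

/-- An element of `W̃^var` as a function on lists. -/
def toFun : A.TildeWvarTotal →ₗ[F] (List (V × F) → V) where
  toFun X := toList (A.coch X)
  map_add' X Y := by
    funext l
    simp only [toList, Pi.add_apply]
    rw [← map_add]
    rfl
  map_smul' r X := by
    funext l
    simp only [toList, Pi.smul_apply, RingHom.id_apply]
    rw [← evalAt_smul]
    rfl

variable {A}

theorem toFun_eq (X : A.TildeWvarTotal) : A.toFun X = toList (A.coch X) := rfl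

theorem toFun_zipFn (X : A.TildeWvarTotal) {n : ℕ} (v : Fin n → V) (t : Fin n → F) :
    A.toFun X (List.ofFn (zipFn v t)) = evalAt t (A.coch X n v) := toList_zipFn _ v t

theorem coch_injective {X Y : A.TildeWvarTotal} (h : A.coch X = A.coch Y) : X = Y :=
  DFinsupp.ext fun n => Subtype.ext (congrFun h n)

theorem toFun_injective : Function.Injective A.toFun := fun _ _ h =>
  coch_injective (toList_ext h)

theorem admissible_toFun (X : A.TildeWvarTotal) : A.Admissible (A.toFun X) :=
  admissible_iff_forall_mem.2 fun n => (X n).2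

theorem coch_eq_zero_iff {X : A.TildeWvarTotal} {n : ℕ} :
    X n = 0 ↔ ∀ l, l.length = n → A.toFun X l = 0 := by
  constructor
  · rintro h l rfl
    rw [toFun_eq, toList, coch, h]
    exact map_zero (evalAt _)
  · intro h
    refine Subtype.ext (funext fun v => eq_of_evalAt_eq (F := F) fun t => ?_)
    have := h (List.ofFn (zipFn v t)) (by simp)
    rw [toFun_zipFn] at this
    exact this.trans (map_zero _).symm

theorem suppIn_iff {X : A.TildeWvarTotal} {S : Set ℕ} :
    SuppIn S (A.toFun X) ↔ ∀ n, n ∉ S → X n = 0 := by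
  simp only [coch_eq_zero_iff]
  exact ⟨fun h n hn l hl => h l (hl ▸ hn), fun h l hl => h _ hl l rfl⟩

theorem coch_eq_of_toFun {X : A.TildeWvarTotal} {Z : ∀ n, A.Coch n} (h : A.toFun X = toList Z) :
    A.coch X = Z := toList_ext h

theorem exists_suppIn (X : A.TildeWvarTotal) : ∃ N, SuppIn {n | n < N} (A.toFun X) := by
  classical
  refine ⟨(DFinsupp.support X).sup id + 1, suppIn_iff.2 fun n hn => ?_⟩
  by_contra h
  exact hn (Nat.lt_succ_of_le (Finset.le_sup (f := id) (DFinsupp.mem_support_toFun X n |>.2 h)))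

theorem exists_coch_eq {Z : ∀ n, A.Coch n} (h : A.Admissible (toList Z)) {N : ℕ}
    (hN : SuppIn {n | n < N} (toList Z)) : ∃ X : A.TildeWvarTotal, A.coch X = Z := by
  have hm := admissible_iff_forall_mem.1 h
  let f : ∀ n, A.TildeWvar n := fun n => (⟨Z n, hm n⟩ : ↥(A.fullProlongation A.CVect n))
  refine ⟨DirectSum.mk A.TildeWvar (Finset.range N) fun n => f n, funext fun n => ?_⟩
  by_cases hn : n ∈ Finset.range N
  · rw [coch, DirectSum.mk_apply_of_mem hn]
    rfl
  · rw [coch, DirectSum.mk_apply_of_notMem hn]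
    funext v
    refine eq_of_evalAt_eq (F := F) fun t => ?_
    have := hN (List.ofFn (zipFn v t)) (by simpa using hn)
    rw [toList_zipFn] at this
    exact (map_zero _).trans this.symm

theorem exists_toFun_eq {x : List (V × F) → V} (h : A.Admissible x) {N : ℕ}
    (hN : SuppIn {n | n < N} x) : ∃ X : A.TildeWvarTotal, A.toFun X = x := by
  obtain ⟨Z, rfl⟩ := h.poly
  obtain ⟨X, hX⟩ := exists_coch_eq h hN
  exact ⟨X, by rw [toFun_eq, hX]⟩

theorem mem_degreeParity_iff {X : A.TildeWvarTotal} {i : ZMod 2} :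
    X ∈ degreeParity F A.TildeWvar 0 i ↔ SuppIn {n | (n : ZMod 2) = i} (A.toFun X) := by
  rw [suppIn_iff]
  change (∀ n : ℕ, (n : ZMod 2) + 0 ≠ i → X n = 0) ↔ _
  simp only [add_zero]
  rfl

theorem mem_range_lof_iff {X : A.TildeWvarTotal} {n : ℕ} :
    X ∈ LinearMap.range (DirectSum.lof F ℕ A.TildeWvar n) ↔ SuppIn {n} (A.toFun X) := by
  rw [suppIn_iff]
  constructor
  · rintro ⟨x, rfl⟩ m hm
    exact DirectSum.of_eq_of_ne _ _ _ hm
  · intro h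
    refine ⟨X n, DFinsupp.ext fun m => ?_⟩
    by_cases hm : m = n
    · subst hm; exact DirectSum.of_eq_same _ _
    · rw [h m hm]; exact DirectSum.of_eq_of_ne _ _ _ hm

/-! ## Finite expansions with coefficients in the space of polyvector fields -/

/-- The polynomial in `λ` obtained by evaluating the coefficients at a list. -/
def evalPoly (A : DiffFunctionAlgebra F V I) (l : List (V × F)) :
    (ℕ →₀ A.TildeWvarTotal) →ₗ[F] Polynomial V :=
  Finsupp.lsum F fun n => ((Polynomial.monomial n : V →ₗ[V] Polynomial V).restrictScalars F) ∘ₗ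
    LinearMap.proj l ∘ₗ A.toFun

theorem evalPoly_single (l : List (V × F)) (n : ℕ) (X : A.TildeWvarTotal) :
    A.evalPoly l (Finsupp.single n X) = Polynomial.monomial n (A.toFun X l) := by
  simp [evalPoly]

theorem coeff_evalPoly (l : List (V × F)) (z : ℕ →₀ A.TildeWvarTotal) (n : ℕ) :
    (A.evalPoly l z).coeff n = A.toFun (z n) l := by
  induction z using Finsupp.induction_linear with
  | zero => simp
  | add z w hz hw => rw [map_add, Polynomial.coeff_add, hz, hw, Finsupp.add_apply, map_add]; rfl
  | single m X =>
    rw [evalPoly_single, Polynomial.coeff_monomial, Finsupp.single_apply]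
    split_ifs <;> simp

variable (A) in
/-- The value of a polynomial in `λ` at a scalar. -/
def evalLam : (ℕ →₀ A.TildeWvarTotal) →ₗ[F] (F → List (V × F) → V) :=
  LinearMap.pi fun s => LinearMap.pi fun l =>
    LinearMap.proj s ∘ₗ polyEval F V ∘ₗ A.evalPoly l

theorem evalLam_apply (z : ℕ →₀ A.TildeWvarTotal) (s : F) (l : List (V × F)) :
    A.evalLam z s l = polyEval F V (A.evalPoly l z) s := rfl

theorem evalLam_single (n : ℕ) (X : A.TildeWvarTotal) (s : F) :
    A.evalLam (Finsupp.single n X) s = s ^ n • A.toFun X := by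
  funext l
  rw [evalLam_apply, evalPoly_single, polyEval_eq_sum, Polynomial.sum_monomial_index _ _ (by simp)]
  rfl

theorem evalLam_eq_sum (z : ℕ →₀ A.TildeWvarTotal) (s : F) :
    A.evalLam z s = z.sum fun n X => s ^ n • A.toFun X := by
  conv_lhs => rw [← z.sum_single, Finsupp.sum, map_sum, Finset.sum_apply]
  simp only [evalLam_single]
  rfl

theorem evalLam_injective : Function.Injective A.evalLam := by
  intro z w h
  ext1 n
  refine toFun_injective (funext fun l => ?_)
  rw [← coeff_evalPoly, ← coeff_evalPoly]
  congr 1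
  exact polyEval_injective (F := F) (funext fun s => congrFun (congrFun h s) l)

theorem evalLam_zero_right (z : ℕ →₀ A.TildeWvarTotal) : A.evalLam z 0 = A.toFun (z 0) := by
  funext l
  rw [evalLam_apply, polyEval_apply, map_zero, ← Polynomial.coeff_zero_eq_eval_zero,
    coeff_evalPoly]

/-! ## The operations -/

theorem exists_mul (A : DiffFunctionAlgebra F V I) :
    ∃ mul : A.TildeWvarTotal →ₗ[F] A.TildeWvarTotal →ₗ[F] A.TildeWvarTotal,
      ∀ X Y, A.toFun (mul X Y) = cat (A.toFun X) (A.toFun Y) := by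
  refine exists_bilinear A.toFun toFun_injective (fun X Y => cat (A.toFun X) (A.toFun Y))
    (fun X Y => ?_) (fun X X' Y => ?_) (fun r X Y => ?_) (fun X Y Y' => ?_) fun r X Y => ?_
  · obtain ⟨M, hM⟩ := exists_suppIn X
    obtain ⟨N, hN⟩ := exists_suppIn Y
    refine exists_toFun_eq (N := M + N) ((admissible_toFun X).cat (admissible_toFun Y))
      fun l hl => hM.cat_eq_zero hN l fun m hm n hn e => hl ?_
    simp only [Set.mem_ofPred_eq] at hm hn ⊢
    omega
  · simp only [map_add, cat_add_left]
  · simp only [map_smul, cat_smul_left]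
  · simp only [map_add, cat_add_right]
  · simp only [map_smul, cat_smul_right]

theorem exists_one (A : DiffFunctionAlgebra F V I) :
    ∃ one : A.TildeWvarTotal, A.toFun one = scalarFun 1 :=
  exists_toFun_eq (N := 1) (admissible_scalarFun 1) fun l hl => by
    cases l with
    | nil => simp at hl
    | cons a l => rfl

theorem exists_D (A : DiffFunctionAlgebra F V I) :
    ∃ D : A.TildeWvarTotal →ₗ[F] A.TildeWvarTotal,
      ∀ X, A.toFun (D X) = A.totalOp (A.toFun X) := by
  have h : ∀ X, ∃ Y, A.toFun Y = A.totalOp (A.toFun X) := fun X => by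
    obtain ⟨N, hN⟩ := exists_suppIn X
    exact exists_toFun_eq (admissible_totalOp (admissible_toFun X)) hN.totalOp
  choose D hD using h
  refine ⟨IsLinearMap.mk' D ⟨fun X Y => toFun_injective ?_, fun r X => toFun_injective ?_⟩, hD⟩
  · rw [map_add, hD, hD, hD, map_add]
    funext l; simp [totalOp]
  · rw [map_smul, hD, hD, map_smul]
    funext l; simp [totalOp]

/-- This is the polynomiality in λ. The bracket is polynomial on each tuple of arguments, and an
admissible coefficient that vanishes on all tuples of generators is zero. -/
theorem exists_lbr_apply (X Y : A.TildeWvarTotal) : ∃ c : ℕ →₀ A.TildeWvarTotal,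
    (∀ j n v, A.coch (c j) n v = lamCoeff j (A.lamBracket (A.coch X) (A.coch Y) n v)) ∧
    ∀ s, A.evalLam c s = A.br s (A.toFun X) (A.toFun Y) := by
  classical
  set Q := A.lamBracket (A.coch X) (A.coch Y) with hQ
  have hX := admissible_toFun X
  have hY := admissible_toFun Y
  have hexp : IsExpansion (fun s => A.br s (A.toFun X) (A.toFun Y))
      fun j => toList (A := A) fun k v => lamCoeff j (Q k v) :=
    isExpansion_lamCoeff Q fun k v s t => evalAt_lamBracket hX hY v s t
  have hadm : ∀ j, A.Admissible (toList (A := A) fun k v => lamCoeff j (Q k v)) :=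
    hexp.admissible (fun s => hX.br hY s) fun j => ⟨_, rfl⟩
  obtain ⟨M, hM⟩ := exists_suppIn X
  obtain ⟨N, hN⟩ := exists_suppIn Y
  have hbr : ∀ s, SuppIn {n | n < M + N} (A.br s (A.toFun X) (A.toFun Y)) := fun s l hl =>
    hM.br_eq_zero hN hX hY s l fun m hm n hn e => hl (by
      simp only [Set.mem_ofPred_eq] at hm hn ⊢; omega)
  have hsupp : ∀ j, SuppIn {n | n < M + N} (toList (A := A) fun k v => lamCoeff j (Q k v)) := by
    intro j l hl
    obtain ⟨K, hK, hj⟩ := ((hexp (l.map Prod.fst)).and (eventually_gt_atTop j)).exists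
    exact eq_zero_of_sum_pow_smul (F := F) (fun s => (hK s l rfl).symm.trans (hbr s l hl)) j hj
  have hex := fun j => exists_coch_eq (hadm j) (hsupp j)
  choose c hc using hex
  obtain ⟨J, hJ⟩ : ∃ J, ∀ j, J ≤ j → c j = 0 := by
    -- Finiteness of I and of the number of arguments leaves finitely many tuples of generators,
    -- hence a common bound for the degree in λ.
    let J := (Finset.range (M + N)).sup fun n => Finset.univ.sup fun i : Fin n → I =>
      (optionEquivLeft V (Fin n) (Q n (A.u ∘ i))).natDegree
    refine ⟨J + 1, fun j hj => DFinsupp.ext fun n => ?_⟩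
    rw [DirectSum.zero_apply]
    by_cases hn : n < M + N
    · have h0 : A.coch (c j) n = 0 := by
        refine ext_of_single (A := A) ?_ ?_ fun i => ?_
        · rw [hc j]; exact admissible_toList_iff.1 (hadm j) n
        · rw [Pi.single_zero]
          exact ⟨⟨0, rfl⟩, (by simp [toList]), fun l => by simpa [toList] using IsConf.zero⟩
        · rw [hc j]
          refine Polynomial.coeff_eq_zero_of_natDegree_lt (lt_of_le_of_lt ?_ hj)
          exact (Finset.le_sup (f := fun i : Fin n → I =>
            (optionEquivLeft V (Fin n) (Q n (A.u ∘ i))).natDegree) (Finset.mem_univ i)).trans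
            (Finset.le_sup (f := fun n => Finset.univ.sup fun i : Fin n → I =>
              (optionEquivLeft V (Fin n) (Q n (A.u ∘ i))).natDegree) (Finset.mem_range.2 hn))
      exact Subtype.ext h0
    · refine (suppIn_iff (S := {n | n < M + N})).1 ?_ n hn
      rw [toFun_eq, hc j]
      exact hsupp j
  refine ⟨Finsupp.onFinset (Finset.range J) c fun j hj => Finset.mem_range.2 (by
    by_contra h; exact hj (hJ j (not_lt.1 h))), fun j n v => ?_, fun s => ?_⟩
  · rw [Finsupp.onFinset_apply, hc j]
  · funext l
    obtain ⟨K, hK, hj⟩ := ((hexp (l.map Prod.fst)).and (eventually_ge_atTop J)).exists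
    rw [evalLam_eq_sum, Finsupp.onFinset_sum _ (by simp), Finset.sum_apply]
    refine Eq.trans ?_ (hK s l rfl).symm
    refine (Finset.sum_congr rfl fun j _ => ?_).trans
      (Finset.sum_subset (Finset.range_subset_range.2 hj) fun j _ h => ?_)
    · rw [Pi.smul_apply, toFun_eq, hc j]
    · beta_reduce
      rw [← hc j, ← toFun_eq, hJ j (by simpa using h), map_zero, Pi.zero_apply, smul_zero]

theorem exists_lbr (A : DiffFunctionAlgebra F V I) :
    ∃ lbr : A.TildeWvarTotal →ₗ[F] A.TildeWvarTotal →ₗ[F] (ℕ →₀ A.TildeWvarTotal),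
      (∀ X Y j n v,
        A.coch (lbr X Y j) n v = lamCoeff j (A.lamBracket (A.coch X) (A.coch Y) n v)) ∧
      ∀ X Y s, A.evalLam (lbr X Y) s = A.br s (A.toFun X) (A.toFun Y) := by
  have hex : ∃ B : A.TildeWvarTotal →ₗ[F] A.TildeWvarTotal →ₗ[F] (ℕ →₀ A.TildeWvarTotal),
      ∀ X Y, A.evalLam (B X Y) = fun s => A.br s (A.toFun X) (A.toFun Y) := by
    refine exists_bilinear A.evalLam evalLam_injective
      (fun X Y s => A.br s (A.toFun X) (A.toFun Y))
      (fun X Y => ?_) (fun X X' Y => ?_) (fun r X Y => ?_) (fun X Y Y' => ?_) fun r X Y => ?_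
    · obtain ⟨c, _, h2⟩ := exists_lbr_apply X Y
      exact ⟨c, funext h2⟩
    · funext s; simp only [map_add, (admissible_toFun Y).br_add_left]; rfl
    · funext s; simp only [map_smul, (admissible_toFun Y).br_smul_left]; rfl
    · funext s; simp only [map_add, (admissible_toFun X).br_add_right]; rfl
    · funext s; simp only [map_smul, (admissible_toFun X).br_smul_right]; rfl
  obtain ⟨B, hB⟩ := hex
  refine ⟨B, fun X Y => ?_, fun X Y s => congrFun (hB X Y) s⟩
  obtain ⟨c, h1, h2⟩ := exists_lbr_apply X Y
  have : B X Y = c := evalLam_injective ((hB X Y).trans (funext fun s => (h2 s).symm))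
  rw [this]
  exact h1

end DiffFunctionAlgebra

/-! ## Gradings of direct sums -/

theorem degreeParity_isInternal (F : Type*) [Field F] (M : ℕ → Type*) [∀ n, AddCommGroup (M n)]
    [∀ n, Module F (M n)] (c : ZMod 2) : DirectSum.IsInternal (degreeParity F M c) := by
  classical
  have huniv : (Set.univ : Set (ZMod 2)) = {0, 1} := by
    have : ∀ i : ZMod 2, i = 0 ∨ i = 1 := by decide
    exact (Set.eq_univ_of_forall this).symm
  rw [DirectSum.isInternal_submodule_iff_isCompl _ (zero_ne_one (α := ZMod 2)) huniv]
  refine ⟨Submodule.disjoint_def.2 fun x h0 h1 => DFinsupp.ext fun n => ?_,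
    codisjoint_iff.2 (eq_top_iff.2 fun x _ => ?_)⟩
  · by_cases h : (n : ZMod 2) + c = 0
    · exact h1 n (by rw [h]; exact zero_ne_one)
    · exact h0 n h
  · refine Submodule.mem_sup.2 ⟨DFinsupp.filter (fun n : ℕ => (n : ZMod 2) + c = 0) x,
      fun n hn => if_neg hn,
      DFinsupp.filter (fun n : ℕ => ¬(n : ZMod 2) + c = 0) x, fun n hn => ?_,
      DFinsupp.filter_add_filter_not _ _⟩
    refine if_neg (not_not.2 ?_)
    have : ∀ i : ZMod 2, i ≠ 1 → i = 0 := by decide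
    exact this _ hn

theorem degreeParity_shift (F : Type*) [Field F] (M : ℕ → Type*) [∀ n, AddCommGroup (M n)]
    [∀ n, Module F (M n)] (c i : ZMod 2) :
    degreeParity F M c (i + 1) = degreeParity F M (c + 1) i := by
  have h : ∀ a b : ZMod 2, a ≠ b + 1 ↔ a + 1 ≠ b := by decide
  ext x
  change (∀ n : ℕ, _ → _) ↔ ∀ n : ℕ, _ → _
  simp only [h, add_assoc]

theorem isInternal_range_lof (F : Type*) [Field F] (M : ℕ → Type*) [∀ n, AddCommGroup (M n)]
    [∀ n, Module F (M n)] :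
    DirectSum.IsInternal fun n => LinearMap.range (DirectSum.lof F ℕ M n) := by
  rw [DirectSum.isInternal_submodule_iff_iSupIndep_and_iSup_eq_top]
  refine ⟨fun n => Submodule.disjoint_def.2 ?_, DFinsupp.iSup_range_lsingle⟩
  rintro _ ⟨y, rfl⟩ hy
  have hle : ⨆ (j) (_ : j ≠ n), LinearMap.range (DirectSum.lof F ℕ M j)
      ≤ LinearMap.ker (DirectSum.component F ℕ M n) := by
    refine iSup₂_le fun j hj => ?_
    rintro _ ⟨x, rfl⟩
    exact DirectSum.of_eq_of_ne _ _ _ hj.symm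
  have h0 := LinearMap.mem_ker.1 (hle hy)
  rw [DirectSum.component.lof_self] at h0
  rw [h0, map_zero]

namespace DiffFunctionAlgebra

open PolyFun MvPolynomial Filter

variable {F V I : Type*} [Field F] [CommRing V] [Algebra F V] [Infinite F]
  {A : DiffFunctionAlgebra F V I} [Fintype I]

/-! ## Evaluation of polynomials in `λ` -/

theorem evalLam_lamMul (z : ℕ →₀ A.TildeWvarTotal) (s : F) :
    A.evalLam (lamMul F _ z) s = s • A.evalLam z s := by
  induction z using Finsupp.induction_linear with
  | zero => simp
  | add z w hz hw => simp only [map_add, Pi.add_apply, hz, hw, smul_add]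
  | single n X =>
    rw [lamMul, Finsupp.lmapDomain_apply, Finsupp.mapDomain_single, evalLam_single, evalLam_single,
      smul_smul, Nat.succ_eq_add_one, pow_succ']

theorem evalLam_lamMap {D : A.TildeWvarTotal →ₗ[F] A.TildeWvarTotal}
    (hD : ∀ X, A.toFun (D X) = A.totalOp (A.toFun X)) (z : ℕ →₀ A.TildeWvarTotal) (s : F) :
    A.evalLam (lamMap D z) s = A.totalOp (A.evalLam z s) := by
  induction z using Finsupp.induction_linear with
  | zero => funext l; simp [totalOp]
  | add z w hz hw =>
    simp only [map_add, Pi.add_apply, hz, hw]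
    funext l; simp [totalOp]
  | single n X =>
    rw [lamMap, Finsupp.mapRange.linearMap_apply, Finsupp.mapRange_single, evalLam_single,
      evalLam_single, hD]
    funext l; simp [totalOp]

theorem evalLam_neg_pow {D : A.TildeWvarTotal →ₗ[F] A.TildeWvarTotal}
    (hD : ∀ X, A.toFun (D X) = A.totalOp (A.toFun X)) (n : ℕ) (z : ℕ →₀ A.TildeWvarTotal) (s : F)
    (l : List (V × F)) :
    A.evalLam (((-(lamMul F _ + lamMap D) : Module.End F (ℕ →₀ A.TildeWvarTotal)) ^ n) z) s l
      = (((-(s + lamSum l)) • 1 - A.dl : Module.End F V) ^ n) (A.evalLam z s l) := by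
  induction n with
  | zero => simp
  | succ n ih =>
    rw [pow_succ', pow_succ', Module.End.mul_apply, Module.End.mul_apply, ← ih, LinearMap.neg_apply,
      LinearMap.add_apply, map_neg, map_add, Pi.neg_apply, Pi.add_apply, evalLam_lamMul,
      evalLam_lamMap hD]
    simp only [Pi.neg_apply, Pi.add_apply, Pi.smul_apply, totalOp, opd, LinearMap.sub_apply,
      LinearMap.add_apply, LinearMap.smul_apply, Module.End.one_apply]
    module

theorem evalLam_skew {D : A.TildeWvarTotal →ₗ[F] A.TildeWvarTotal}
    (hD : ∀ X, A.toFun (D X) = A.totalOp (A.toFun X)) (z : ℕ →₀ A.TildeWvarTotal) (s : F)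
    (l : List (V × F)) :
    A.evalLam (z.sum fun n c =>
      ((-(lamMul F _ + lamMap D) : Module.End F (ℕ →₀ A.TildeWvarTotal)) ^ n) (Finsupp.single 0 c))
        s l = opEval A.dl (-(s + lamSum l)) fun r => A.evalLam z r l := by
  change _ = opEval A.dl _ (polyEval F V (A.evalPoly l z))
  induction z using Finsupp.induction_linear with
  | zero => simp
  | add z w hz hw =>
    rw [Finsupp.sum_add_index' (by simp) (by simp), map_add, map_add, map_add, map_add, ← hz, ← hw]
    rfl
  | single n X =>
    rw [Finsupp.sum_single_index (by simp), evalLam_neg_pow hD, evalPoly_single, opEval_polyEval,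
      Polynomial.sum_monomial_index _ _ (by simp), evalLam_single, pow_zero, one_smul]

/-- The polynomial `∑ₙ φ(zₙ) λⁿ`. -/
def mapPoly {R : Type*} [AddCommGroup R] [Module F R] (φ : R →ₗ[F] V) :
    (ℕ →₀ R) →ₗ[F] Polynomial V :=
  Finsupp.lsum F fun n => ((Polynomial.monomial n : V →ₗ[V] Polynomial V).restrictScalars F) ∘ₗ φ

theorem coeff_mapPoly {R : Type*} [AddCommGroup R] [Module F R] (φ : R →ₗ[F] V) (z : ℕ →₀ R)
    (n : ℕ) : (mapPoly φ z).coeff n = φ (z n) := by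
  induction z using Finsupp.induction_linear with
  | zero => simp
  | add z w hz hw => rw [map_add, Polynomial.coeff_add, hz, hw, Finsupp.add_apply, map_add]
  | single m X =>
    have : mapPoly φ (Finsupp.single m X) = Polynomial.monomial m (φ X) := by simp [mapPoly]
    rw [this, Polynomial.coeff_monomial, Finsupp.single_apply]
    split_ifs <;> simp

theorem polyEval_mapPoly {R : Type*} [AddCommGroup R] [Module F R] (φ : R →ₗ[F] V) (z : ℕ →₀ R)
    (s : F) : polyEval F V (mapPoly φ z) s = z.sum fun n X => s ^ n • φ X := by
  induction z using Finsupp.induction_linear with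
  | zero => simp
  | add z w hz hw =>
    rw [map_add, map_add, Pi.add_apply, hz, hw, Finsupp.sum_add_index' (by simp) (by simp)]
  | single m X =>
    have : mapPoly φ (Finsupp.single m X) = Polynomial.monomial m (φ X) := by simp [mapPoly]
    rw [this, polyEval_eq_sum, Polynomial.sum_monomial_index _ _ (by simp),
      Finsupp.sum_single_index (by simp)]

section jacobi

variable {lbr : A.TildeWvarTotal →ₗ[F] A.TildeWvarTotal →ₗ[F] (ℕ →₀ A.TildeWvarTotal)}
  (hlbr : ∀ X Y s, A.evalLam (lbr X Y) s = A.br s (A.toFun X) (A.toFun Y))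

include hlbr in
theorem br_evalLam_right (X : A.TildeWvarTotal) (z : ℕ →₀ A.TildeWvarTotal) (s t : F)
    (l : List (V × F)) : A.br s (A.toFun X) (A.evalLam z t) l
      = z.sum fun n Y => t ^ n • A.evalLam (lbr X Y) s l := by
  rw [evalLam_eq_sum]
  induction z using Finsupp.induction_linear with
  | zero => simpa using congrFun ((admissible_toFun X).br_smul_right s 0 0) l
  | add z w hz hw =>
    rw [Finsupp.sum_add_index' (by simp) (by simp [smul_add]),
      Finsupp.sum_add_index' (by simp) (by simp [smul_add]), (admissible_toFun X).br_add_right,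
      Pi.add_apply, hz, hw]
  | single n Y =>
    rw [Finsupp.sum_single_index (by simp), Finsupp.sum_single_index (by simp),
      (admissible_toFun X).br_smul_right, hlbr]
    rfl

include hlbr in
theorem br_evalLam_left (Y : A.TildeWvarTotal) (z : ℕ →₀ A.TildeWvarTotal) (s t : F)
    (l : List (V × F)) : A.br s (A.evalLam z t) (A.toFun Y) l
      = z.sum fun n X => t ^ n • A.evalLam (lbr X Y) s l := by
  rw [evalLam_eq_sum]
  induction z using Finsupp.induction_linear with
  | zero => simpa using congrFun ((admissible_toFun Y).br_smul_left s 0 0) l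
  | add z w hz hw =>
    rw [Finsupp.sum_add_index' (by simp) (by simp [smul_add]),
      Finsupp.sum_add_index' (by simp) (by simp [smul_add]), (admissible_toFun Y).br_add_left,
      Pi.add_apply, hz, hw]
  | single n X =>
    rw [Finsupp.sum_single_index (by simp), Finsupp.sum_single_index (by simp),
      (admissible_toFun Y).br_smul_left, hlbr]
    rfl

theorem sum_ite_le_eq_antidiagonal {M R : Type*} [AddCommMonoid M] [AddCommMonoid R] (z : ℕ →₀ R)
    (m : ℕ) (g : ℕ → ℕ → R → M) (hg : ∀ q r, g q r 0 = 0) :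
    (z.sum fun q w => if q ≤ m then g q (m - q) w else 0)
      = ∑ q ∈ Finset.HasAntidiagonal.antidiagonal m, g q.1 q.2 (z q.1) := by
  rw [Finset.Nat.sum_antidiagonal_eq_sum_range_succ (fun i j => g i j (z i)), Finsupp.sum,
    ← Finset.sum_filter]
  refine Finset.sum_subset (fun q hq => ?_) fun q hq h => ?_
  · exact Finset.mem_range_succ_iff.2 (Finset.mem_filter.1 hq).2
  · have : z q = 0 := by
      by_contra h0
      exact h (Finset.mem_filter.2 ⟨Finsupp.mem_support_iff.2 h0, Finset.mem_range_succ_iff.1 hq⟩)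
    rw [this, hg]

include hlbr in
/-- Extraction of coefficients in the Jacobi identity. -/
theorem jacobi_coeff {ε : F} {a b c : A.TildeWvarTotal}
    (h : ∀ s t l, A.br s (A.toFun a) (A.br t (A.toFun b) (A.toFun c)) l
      - ε • A.br t (A.toFun b) (A.br s (A.toFun a) (A.toFun c)) l
        = A.br (s + t) (A.br s (A.toFun a) (A.toFun b)) (A.toFun c) l) (m n : ℕ) :
    lbr a (lbr b c n) m - ε • lbr b (lbr a c m) n
      = ∑ q ∈ Finset.HasAntidiagonal.antidiagonal m,
        ((q.2 + n).choose n) • lbr (lbr a b q.1) c (q.2 + n) := by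
  refine toFun_injective (funext fun l => ?_)
  let φ : F → A.TildeWvarTotal →ₗ[F] V := fun s =>
    LinearMap.proj s ∘ₗ polyEval F V ∘ₗ A.evalPoly l ∘ₗ lbr a
  let ψ : ℕ → A.TildeWvarTotal →ₗ[F] V := fun n =>
    LinearMap.proj l ∘ₗ A.toFun ∘ₗ Finsupp.lapply n ∘ₗ lbr b
  -- For fixed s both sides are polynomials in t; the dependence on s + t is a Taylor shift.
  have h1 : ∀ s : F, mapPoly (φ s) (lbr b c)
      - ε • (lbr a c).sum (fun m w => s ^ m • A.evalPoly l (lbr b w))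
        = (lbr a b).sum fun q w =>
          s ^ q • Polynomial.taylor (algebraMap F V s) (A.evalPoly l (lbr w c)) := by
    intro s
    refine polyEval_injective (F := F) (funext fun t => ?_)
    have h2 := h s t l
    rw [← hlbr b c, ← hlbr a c, ← hlbr a b, br_evalLam_right hlbr, br_evalLam_right hlbr,
      br_evalLam_left hlbr] at h2
    rw [map_sub, map_smul, Pi.sub_apply, Pi.smul_apply, polyEval_mapPoly, Finsupp.sum, Finsupp.sum,
      map_sum, Finset.sum_apply, Finsupp.sum, map_sum, Finset.sum_apply]
    simp only [map_smul, Pi.smul_apply]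
    refine h2.trans (Finset.sum_congr rfl fun q _ => ?_)
    beta_reduce
    rw [evalLam_apply, polyEval_apply, polyEval_apply, Polynomial.taylor_eval, map_add, add_comm]
  -- The coefficient of t^n of a Taylor shift is a Hasse derivative evaluated at s, so the identity
  -- is again one of polynomials, now in s. Hasse derivatives supply the binomial coefficients.
  have h3 : A.evalPoly l (lbr a (lbr b c n)) - ε • mapPoly (ψ n) (lbr a c)
      = (lbr a b).sum fun q w =>
        Polynomial.X ^ q * Polynomial.hasseDeriv n (A.evalPoly l (lbr w c)) := by
    refine polyEval_injective (F := F) (funext fun s => ?_)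
    have h2 := congrArg (fun p => Polynomial.coeff p n) (h1 s)
    simp only [Finsupp.sum, Polynomial.coeff_sub, Polynomial.coeff_smul, coeff_mapPoly,
      Polynomial.finsetSum_coeff, Polynomial.taylor_coeff] at h2
    rw [map_sub, map_smul, Pi.sub_apply, Pi.smul_apply, polyEval_mapPoly, Finsupp.sum, Finsupp.sum,
      map_sum, Finset.sum_apply]
    refine Eq.trans ?_ (h2.trans (Finset.sum_congr rfl fun q _ => ?_))
    · congr 2
      refine Finset.sum_congr rfl fun q _ => ?_
      rw [coeff_evalPoly]
      rfl
    · rw [polyEval_apply, Polynomial.eval_mul, Polynomial.eval_pow, Polynomial.eval_X,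
        Algebra.smul_def, map_pow]
  have h4 := congrArg (fun p => Polynomial.coeff p m) h3
  simp only [Finsupp.sum, Polynomial.coeff_sub, Polynomial.coeff_smul, coeff_mapPoly,
    Polynomial.finsetSum_coeff, coeff_evalPoly, Polynomial.coeff_X_pow_mul',
    Polynomial.hasseDeriv_coeff] at h4
  rw [map_sub, map_smul, map_sum, Finset.sum_apply]
  refine h4.trans ((sum_ite_le_eq_antidiagonal (lbr a b) m
    (fun q r w => ((r + n).choose n : V) * A.toFun (lbr w c (r + n)) l) (by simp)).trans
    (Finset.sum_congr rfl fun q _ => ?_))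
  rw [map_nsmul, Pi.smul_apply, nsmul_eq_mul]

end jacobi

end DiffFunctionAlgebra

/-! ### The odd Poisson vertex algebra axioms and the grading. -/

namespace DiffFunctionAlgebra

open PolyFun MvPolynomial Filter

variable {F V I : Type*} [Field F] [CharZero F] [CommRing V] [Algebra F V] [Fintype I]

theorem suppIn_coeff {A : DiffFunctionAlgebra F V I} {S : Set ℕ} {z : ℕ →₀ A.TildeWvarTotal}
    (h : ∀ s, SuppIn S (A.evalLam z s)) (j : ℕ) : SuppIn S (A.toFun (z j)) := by
  intro l hl
  rw [← coeff_evalPoly]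
  have : A.evalPoly l z = 0 := polyEval_injective (F := F) (funext fun s => by
    rw [map_zero]; exact h s l hl)
  rw [this, Polynomial.coeff_zero]

theorem exists_natCast_eq (i : ZMod 2) : ∃ x : ℕ, (x : ZMod 2) = i := ⟨i.val, ZMod.natCast_zmod_val i⟩

/-- The odd Poisson vertex algebra `ΠW̃^var`. -/
theorem exists_oddPVA (A : DiffFunctionAlgebra F V I) : ∃ P : OddPVA F A.TildeWvarTotal,
    (∀ i, P.parity i = degreeParity F A.TildeWvar 0 i) ∧
    A.toFun P.one = scalarFun 1 ∧
    (∀ X Y, A.toFun (P.mul X Y) = cat (A.toFun X) (A.toFun Y)) ∧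
    (∀ X, A.toFun (P.D X) = A.totalOp (A.toFun X)) ∧
    (∀ X Y s, A.evalLam (P.lbr X Y) s = A.br s (A.toFun X) (A.toFun Y)) ∧
    ∀ X Y j n v, A.coch (P.lbr X Y j) n v
      = lamCoeff j (A.lamBracket (A.coch X) (A.coch Y) n v) := by
  obtain ⟨mul, hmul⟩ := exists_mul A
  obtain ⟨one, hone⟩ := exists_one A
  obtain ⟨D, hD⟩ := exists_D A
  obtain ⟨lbr, hcoch, hlbr⟩ := exists_lbr A
  have hpar : ∀ {X : A.TildeWvarTotal} {i : ZMod 2} {x : ℕ}, (x : ZMod 2) = i →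
      X ∈ degreeParity F A.TildeWvar 0 i → HasParity x (A.toFun X) := fun hx h =>
    hasParity_of_suppIn hx (mem_degreeParity_iff.1 h)
  have hpar' : ∀ {X : A.TildeWvarTotal} {i : ZMod 2} {x : ℕ}, (x : ZMod 2) = i + 1 →
      X ∈ degreeParity F A.TildeWvar 0 (i + 1) →
      HasParity x (A.toFun X) ∧ ((x + 1 : ℕ) : ZMod 2) = i := fun hx h =>
    ⟨hpar hx h, by rw [Nat.cast_add, hx, add_assoc]; exact add_zero _⟩
  have hone_mem : one ∈ degreeParity F A.TildeWvar 0 0 := by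
    rw [mem_degreeParity_iff, hone]
    intro l hl
    cases l with
    | nil => exact absurd Nat.cast_zero hl
    | cons a l => rfl
  have hmul_mem : ∀ i j, ∀ a ∈ degreeParity F A.TildeWvar 0 i,
      ∀ b ∈ degreeParity F A.TildeWvar 0 j, mul a b ∈ degreeParity F A.TildeWvar 0 (i + j) := by
    intro i j a ha b hb
    rw [mem_degreeParity_iff] at *
    rw [hmul]
    refine fun l hl => ha.cat_eq_zero hb l fun m hm n hn e => hl ?_
    rw [Set.mem_ofPred_eq] at hm hn ⊢
    rw [← e, Nat.cast_add, hm, hn]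
  refine ⟨{
    parity := degreeParity F A.TildeWvar 0
    one := one
    mul := mul
    D := D
    lbr := lbr
    one_mem := hone_mem
    mul_mem := hmul_mem
    one_mul := fun a => toFun_injective (by rw [hmul, hone, one_cat])
    mul_assoc := fun a b c => toFun_injective (by simp only [hmul, cat_assoc])
    mul_comm := ?_
    D_mul := fun a b => toFun_injective (by rw [map_add, hD, hmul, hmul, hmul, hD, hD, totalOp_cat])
    lieConformal := ?_
    leibniz := ?_ }, fun i => rfl, hone, hmul, hD, hlbr, hcoch⟩
  · intro i j a ha b hb
    obtain ⟨x, hx⟩ := exists_natCast_eq i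
    obtain ⟨y, hy⟩ := exists_natCast_eq j
    refine toFun_injective ?_
    rw [superSign_smul (F := F) hx hy, map_smul, hmul, hmul, cat_comm (hpar hx ha) (hpar hy hb)]
  · refine ⟨?_, ?_, ?_, ?_, ?_, ?_, ?_⟩
    · simp only [degreeParity_shift]
      exact degreeParity_isInternal _ _ _
    · intro i a ha
      rw [mem_degreeParity_iff, hD]
      exact (mem_degreeParity_iff.1 ha).totalOp
    · intro i j a ha b hb n
      rw [mem_degreeParity_iff] at *
      refine suppIn_coeff (fun s => ?_) n
      rw [hlbr]
      refine fun l hl => ha.br_eq_zero hb (admissible_toFun a) (admissible_toFun b) s l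
        fun m hm n hn e => hl ?_
      rw [Set.mem_ofPred_eq] at hm hn ⊢
      have e' : (m : ZMod 2) + n = l.length + 1 := by exact_mod_cast congrArg (Nat.cast : ℕ → ZMod 2) e
      rw [hm, hn] at e'
      linear_combination -e'
    · intro a b
      refine evalLam_injective (funext fun s => ?_)
      rw [map_neg, Pi.neg_apply, hlbr, hD, evalLam_lamMul, hlbr,
        Admissible.br_totalOp_left (admissible_toFun a) (admissible_toFun b)]
    · intro a b
      refine evalLam_injective (funext fun s => ?_)
      rw [map_add, Pi.add_apply, hlbr, hD, evalLam_lamMul, evalLam_lamMap hD, hlbr,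
        Admissible.br_totalOp_right (admissible_toFun a) (admissible_toFun b)]
    · intro i j a ha b hb
      obtain ⟨x, hx⟩ := exists_natCast_eq (i + 1)
      obtain ⟨y, hy⟩ := exists_natCast_eq (j + 1)
      obtain ⟨px, hx⟩ := hpar' hx ha
      obtain ⟨py, hy⟩ := hpar' hy hb
      refine evalLam_injective (funext fun s => funext fun l => ?_)
      rw [superSign_smul (F := F) hx hy, map_neg, map_smul, Pi.neg_apply, Pi.smul_apply,
        Pi.neg_apply, Pi.smul_apply, evalLam_skew hD, hlbr]
      simp only [hlbr]
      exact (admissible_toFun a).br_skew (admissible_toFun b) px py s l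
    · intro i j a ha b hb c m n
      obtain ⟨x, hx⟩ := exists_natCast_eq (i + 1)
      obtain ⟨y, hy⟩ := exists_natCast_eq (j + 1)
      obtain ⟨px, hx⟩ := hpar' hx ha
      obtain ⟨py, hy⟩ := hpar' hy hb
      rw [superSign_smul (F := F) hx hy]
      exact jacobi_coeff hlbr (fun s t l => Admissible.br_jacobi (admissible_toFun a) (admissible_toFun b)
        (admissible_toFun c) px py s t l) m n
  · intro i j a ha b hb c n
    obtain ⟨x, hx⟩ := exists_natCast_eq i
    obtain ⟨y, hy⟩ := exists_natCast_eq j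
    have px := hpar hx ha
    have py := hpar hy hb
    have hx' : ((x + 1 : ℕ) : ZMod 2) = i + 1 := by rw [Nat.cast_add, hx, Nat.cast_one]
    rw [superSign_smul (F := F) hx' hy]
    have hz1 : ∀ (z : ℕ →₀ A.TildeWvarTotal) s,
        A.evalLam (lamMap (mul.flip c) z) s = cat (A.evalLam z s) (A.toFun c) := by
      intro z s
      induction z using Finsupp.induction_linear with
      | zero => simpa using (cat_smul_left (0 : F) 0 (A.toFun c)).symm
      | add z w hz hw => simp only [map_add, Pi.add_apply, hz, hw, cat_add_left]
      | single n X =>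
        rw [lamMap, Finsupp.mapRange.linearMap_apply, Finsupp.mapRange_single, evalLam_single,
          evalLam_single, LinearMap.flip_apply, hmul, cat_smul_left]
    have hz2 : ∀ (z : ℕ →₀ A.TildeWvarTotal) s,
        A.evalLam (lamMap (mul b) z) s = cat (A.toFun b) (A.evalLam z s) := by
      intro z s
      induction z using Finsupp.induction_linear with
      | zero => simpa using (cat_smul_right (0 : F) (A.toFun b) 0).symm
      | add z w hz hw => simp only [map_add, Pi.add_apply, hz, hw, cat_add_right]
      | single n X =>
        rw [lamMap, Finsupp.mapRange.linearMap_apply, Finsupp.mapRange_single, evalLam_single,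
          evalLam_single, hmul, cat_smul_right]
    -- The Leibniz rule is proved as an identity of polynomials in λ, where evaluation at scalars
    -- applies; the coefficients are read off afterwards.
    have key : lbr a (mul b c) = lamMap (mul.flip c) (lbr a b)
        + (-1 : F) ^ ((x + 1) * y) • lamMap (mul b) (lbr a c) := by
      refine evalLam_injective (funext fun s => funext fun l => ?_)
      rw [map_add, map_smul, Pi.add_apply, Pi.add_apply, Pi.smul_apply, Pi.smul_apply, hz1, hz2,
        hlbr, hlbr, hlbr, hmul]
      exact Admissible.br_cat (admissible_toFun a) (admissible_toFun b) (admissible_toFun c) px py s l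
    rw [key]
    rfl

theorem isGraded {A : DiffFunctionAlgebra F V I} {P : OddPVA F A.TildeWvarTotal}
    (hone : A.toFun P.one = scalarFun 1)
    (hmul : ∀ X Y, A.toFun (P.mul X Y) = cat (A.toFun X) (A.toFun Y))
    (hD : ∀ X, A.toFun (P.D X) = A.totalOp (A.toFun X))
    (hlbr : ∀ X Y s, A.evalLam (P.lbr X Y) s = A.br s (A.toFun X) (A.toFun Y)) :
    P.IsGraded (fun n => LinearMap.range (DirectSum.lof F ℕ A.TildeWvar n)) := by
  refine ⟨isInternal_range_lof _ _, ?_, ?_, ?_, ?_, ?_⟩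
  · rw [mem_range_lof_iff, hone]
    intro l hl
    cases l with
    | nil => exact absurd rfl hl
    | cons a l => rfl
  · intro m n a ha b hb
    rw [mem_range_lof_iff] at *
    rw [hmul]
    exact fun l hl => ha.cat_eq_zero hb l fun i hi j hj e => hl (by
      rw [Set.mem_singleton_iff] at *; rw [← e, hi, hj])
  · intro n a ha
    rw [mem_range_lof_iff] at *
    rw [hD]
    exact ha.totalOp
  · intro m n k hk a ha b hb j
    rw [mem_range_lof_iff] at *
    refine suppIn_coeff (fun s => ?_) j
    rw [hlbr]
    exact fun l hl => ha.br_eq_zero hb (admissible_toFun a) (admissible_toFun b) s l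
      fun i hi j hj e => hl (by
        rw [Set.mem_singleton_iff] at *; omega)
  · intro a ha b hb
    rw [mem_range_lof_iff] at *
    refine evalLam_injective (funext fun s => funext fun l => ?_)
    rw [hlbr, map_zero]
    exact ha.br_eq_zero hb (admissible_toFun a) (admissible_toFun b) s l
      fun i hi j hj e => by rw [Set.mem_singleton_iff] at *; omega

end DiffFunctionAlgebra

/-! ## The reduced Lie superalgebra of an odd Poisson vertex algebra -/

theorem isInternal_zmod_two_iff {F L : Type*} [Field F] [AddCommGroup L] [Module F L]
    (S : ZMod 2 → Submodule F L) : DirectSum.IsInternal S ↔ IsCompl (S 0) (S 1) :=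
  DirectSum.isInternal_submodule_iff_isCompl _ zero_ne_one
    (Set.eq_univ_of_forall (by decide : ∀ i : ZMod 2, i = 0 ∨ i = 1)).symm

/-- Transport of a Lie superalgebra structure along a linear equivalence. -/
def LieSuperalgebra.comap {F L L' : Type*} [Field F] [AddCommGroup L] [Module F L]
    [AddCommGroup L'] [Module F L'] (S : LieSuperalgebra F L') (e : L ≃ₗ[F] L') :
    LieSuperalgebra F L where
  parity i := (S.parity i).comap e.toLinearMap
  isInternal := by
    rw [isInternal_zmod_two_iff]
    have h := (isInternal_zmod_two_iff _).1 S.isInternal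
    exact (Submodule.orderIsoMapComap e).symm.isCompl h
  bracket := ((S.bracket.compl₁₂ e.toLinearMap e.toLinearMap).compr₂ e.symm.toLinearMap)
  bracket_mem i j a ha b hb := by
    simpa using S.bracket_mem i j _ ha _ hb
  skew i j a ha b hb := by
    simpa using congrArg e.symm (S.skew i j _ ha _ hb)
  jacobi i j a ha b hb c := by
    simpa using congrArg e.symm (S.jacobi i j _ ha _ hb (e c))

theorem LieSuperalgebra.isLieSuperIso_comap {F L L' : Type*} [Field F] [AddCommGroup L] [Module F L]
    [AddCommGroup L'] [Module F L'] (S : LieSuperalgebra F L') (e : L ≃ₗ[F] L') :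
    IsLieSuperIso (S.comap e) S e where
  map_parity i := Submodule.map_comap_eq_of_surjective e.surjective _
  map_bracket a b := by simp [LieSuperalgebra.comap]

namespace OddPVA

variable {F R W : Type*} [Field F] [AddCommGroup R] [Module F R] [AddCommGroup W] [Module F W]

theorem lamMul_apply_zero (z : ℕ →₀ R) : lamMul F R z 0 = 0 :=
  Finsupp.mapDomain_of_notMem_range _ _ (by simp)

theorem lamMap_apply (D : R →ₗ[F] R) (z : ℕ →₀ R) (n : ℕ) : lamMap D z n = D (z n) := rfl

variable (P : OddPVA F R)

theorem lbr_D_left_zero (a b : R) : P.lbr (P.D a) b 0 = 0 := by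
  rw [P.lieConformal.sesq_left, Finsupp.neg_apply, lamMul_apply_zero, neg_zero]

theorem lbr_D_right_zero (a b : R) : P.lbr a (P.D b) 0 = P.D (P.lbr a b 0) := by
  rw [P.lieConformal.sesq_right, Finsupp.add_apply, lamMul_apply_zero, zero_add, lamMap_apply]

/-- At λ = 0 only one term of the right-hand side survives. This gives the Jacobi identity of the
quotient, the representation property and the derivation property of the λ-bracket. -/
theorem lbr_jacobi_zero {i j : ZMod 2} {a b : R} (ha : a ∈ P.parity (i + 1))
    (hb : b ∈ P.parity (j + 1)) (c : R) (n : ℕ) :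
    P.lbr a (P.lbr b c n) 0 - superSign i j • P.lbr b (P.lbr a c 0) n
      = P.lbr (P.lbr a b 0) c n := by
  simpa using P.lieConformal.jacobi i j a ha b hb c 0 n

/-- At λ = 0 each positive power of -λ - ∂ has its value in the image of ∂, so modulo ∂ only the
constant coefficient contributes. -/
theorem map_lbr_skew_zero {f : R →ₗ[F] W} (hf : ∀ a, f (P.D a) = 0) {i j : ZMod 2} {a b : R}
    (ha : a ∈ P.parity (i + 1)) (hb : b ∈ P.parity (j + 1)) :
    f (P.lbr b a 0) = -(superSign i j • f (P.lbr a b 0)) := by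
  rw [P.lieConformal.skew i j a ha b hb, Finsupp.neg_apply, Finsupp.smul_apply, map_neg, map_zsmul]
  congr 2
  rw [Finsupp.sum, Finsupp.finsetSum_apply, map_sum, Finset.sum_eq_single 0]
  · simp
  · intro n _ hn
    obtain ⟨n, rfl⟩ := Nat.exists_eq_succ_of_ne_zero hn
    rw [Nat.succ_eq_add_one, pow_succ', Module.End.mul_apply, LinearMap.neg_apply,
      LinearMap.add_apply, Finsupp.neg_apply, Finsupp.add_apply, lamMul_apply_zero, lamMap_apply,
      zero_add, map_neg, hf, neg_zero]
  · intro h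
    rw [Finsupp.notMem_support_iff.1 h]
    simp

/-- The Lie superalgebra `R/∂R` attached to an odd Poisson vertex algebra, for a given
realization `f : R → W` of the quotient map, and its representation on `R`. -/
theorem exists_reduced {f : R →ₗ[F] W} (hf : Function.Surjective f)
    (hker : LinearMap.ker f = LinearMap.range P.D) {S : ZMod 2 → Submodule F W}
    (hS : DirectSum.IsInternal S) (hpar : ∀ i, (P.parity (i + 1)).map f = S i) :
    ∃ (L : LieSuperalgebra F W) (ρ : W →ₗ[F] R →ₗ[F] R), (∀ i, L.parity i = S i) ∧
      (∀ a b, ρ (f a) b = P.lbr a b 0) ∧ (∀ x b, f (ρ x b) = L.bracket x (f b)) ∧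
      IsRepByDerivations L P ρ := by
  obtain ⟨sec, hsec⟩ := f.exists_rightInverse_of_surjective (LinearMap.range_eq_top.2 hf)
  have hsec' : ∀ x, f (sec x) = x := fun x => LinearMap.congr_fun hsec x
  have hD : ∀ a, f (P.D a) = 0 := fun a => by
    rw [← LinearMap.mem_ker, hker]; exact ⟨a, rfl⟩
  have hmem : ∀ a, ∃ c, sec (f a) = a + P.D c := fun a => by
    have : sec (f a) - a ∈ LinearMap.ker f := by rw [LinearMap.mem_ker, map_sub, hsec', sub_self]
    rw [hker] at this
    obtain ⟨c, hc⟩ := this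
    exact ⟨c, by rw [hc]; abel⟩
  -- A linear section chooses a lift of each class; since [∂a _λ b] vanishes at λ = 0, the action
  -- does not depend on it.
  let ρ : W →ₗ[F] R →ₗ[F] R := (P.lbr.compr₂ (Finsupp.lapply 0)) ∘ₗ sec
  have hρ : ∀ a b, ρ (f a) b = P.lbr a b 0 := by
    intro a b
    obtain ⟨c, hc⟩ := hmem a
    change P.lbr (sec (f a)) b 0 = _
    rw [hc, map_add, LinearMap.add_apply, Finsupp.add_apply, lbr_D_left_zero, add_zero]
  let br : W →ₗ[F] W →ₗ[F] W := (ρ.compr₂ f).compl₂ sec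
  have hρD : ∀ x a, ρ x (P.D a) = P.D (ρ x a) := fun x a => P.lbr_D_right_zero (sec x) a
  have hbr : ∀ x b, f (ρ x b) = br x (f b) := by
    intro x b
    obtain ⟨c, hc⟩ := hmem b
    change _ = f (ρ x (sec (f b)))
    rw [hc, map_add, map_add, hρD, hD, add_zero]
  have hbr' : ∀ a b, br (f a) (f b) = f (P.lbr a b 0) := fun a b => by rw [← hbr, hρ]
  have hlift : ∀ {i x}, x ∈ S i → ∃ a ∈ P.parity (i + 1), f a = x := fun {i x} hx => by
    rwa [← hpar] at hx
  have h2 : ∀ i : ZMod 2, i + 1 + 1 = i := by decide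
  refine ⟨{
    parity := S
    isInternal := hS
    bracket := br
    bracket_mem := ?_
    skew := ?_
    jacobi := ?_ }, ρ, fun i => rfl, hρ, hbr, ⟨?_, ?_, hρD, ?_, ?_⟩⟩
  · intro i j x hx y hy
    obtain ⟨a, ha, rfl⟩ := hlift hx
    obtain ⟨b, hb, rfl⟩ := hlift hy
    rw [hbr', ← hpar]
    exact Submodule.mem_map_of_mem (P.lieConformal.lbr_mem i j a ha b hb 0)
  · intro i j x hx y hy
    obtain ⟨a, ha, rfl⟩ := hlift hx
    obtain ⟨b, hb, rfl⟩ := hlift hy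
    rw [hbr', hbr', P.map_lbr_skew_zero hD ha hb]
  · intro i j x hx y hy z
    obtain ⟨a, ha, rfl⟩ := hlift hx
    obtain ⟨b, hb, rfl⟩ := hlift hy
    obtain ⟨c, rfl⟩ := hf z
    simp only [hbr', ← P.lbr_jacobi_zero ha hb c 0, map_sub, map_zsmul]
  · intro i j x hx b hb
    obtain ⟨a, ha, rfl⟩ := hlift hx
    rw [← h2 j] at hb
    have := P.lieConformal.lbr_mem i (j + 1) a ha b hb 0
    rw [hρ]
    rwa [← add_assoc, h2] at this
  · intro i j x hx y hy c
    obtain ⟨a, ha, rfl⟩ := hlift hx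
    obtain ⟨b, hb, rfl⟩ := hlift hy
    change ρ (br (f a) (f b)) c = _
    simp only [hbr', hρ, P.lbr_jacobi_zero ha hb c 0]
  · intro i j x hx b hb c
    obtain ⟨a, ha, rfl⟩ := hlift hx
    -- The lift has parity i + 1 in the odd algebra, and the Leibniz sign shifts parity once more,
    -- so the sign is that of i and j.
    have := P.leibniz (i + 1) j a ha b hb c 0
    rw [h2] at this
    simp only [hρ, this]
  · intro i j x hx b hb c n
    obtain ⟨a, ha, rfl⟩ := hlift hx
    rw [← h2 j] at hb
    have := P.lbr_jacobi_zero ha hb c n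
    rw [hρ, hρ, hρ, ← this, sub_add_cancel]

end OddPVA

theorem map_lmap_degreeParity {F : Type*} [Field F] {M N : ℕ → Type*} [∀ n, AddCommGroup (M n)]
    [∀ n, Module F (M n)] [∀ n, AddCommGroup (N n)] [∀ n, Module F (N n)]
    (f : ∀ n, M n →ₗ[F] N n) (hf : Function.Surjective (DirectSum.lmap f)) (c i : ZMod 2) :
    (degreeParity F M c i).map (DirectSum.lmap f) = degreeParity F N c i := by
  ext y
  constructor
  · rintro ⟨x, hx, rfl⟩ n hn
    rw [DirectSum.lmap_apply, hx n hn, map_zero]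
  · intro hy
    obtain ⟨x, rfl⟩ := hf y
    refine ⟨DFinsupp.filter (fun n : ℕ => (n : ZMod 2) + c = i) x, fun n hn => if_neg hn,
      DFinsupp.ext fun n => ?_⟩
    by_cases hn : (n : ZMod 2) + c = i
    · exact congrArg (f n) (if_pos hn)
    · exact ((congrArg (f n) (if_neg hn)).trans (map_zero _)).trans (hy n hn).symm

namespace DiffFunctionAlgebra

open PolyFun MvPolynomial Filter

variable {F V I : Type*} [Field F] [CharZero F] [CommRing V] [Algebra F V] [Fintype I]
  {A : DiffFunctionAlgebra F V I}

/-! ## The map `∫` -/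

/-- The master formula already holds for X before passing to the quotient, by
`Admissible.eq_masterPoly`. -/
theorem toQ_comp_mem {n : ℕ} {X : A.Coch n} (hX : X ∈ A.fullProlongation A.CVect n) :
    (fun f => A.toQ n (X f)) ∈ A.wvarSubmodule n := by
  have h := mem_fullProlongation_iff.1 hX
  obtain ⟨⟨T, hT⟩, h1, h2⟩ := h.mem_tildeWd
  refine ⟨⟨⟨(A.toQ n).compMultilinearMap T, fun v => by simp [hT]⟩, fun v i => ?_, fun σ v => ?_⟩,
    fun f => ?_⟩
  · beta_reduce
    rw [h1, map_neg]
    rfl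
  · beta_reduce
    rw [← map_zsmul, ← h2]
    rfl
  · beta_reduce
    nth_rewrite 1 [h.eq_masterPoly]
    exact toQ_masterPoly (fun i => rfl) f

/-- The values on generators are lifted arbitrarily, made skewsymmetric by averaging, and extended
by the master formula, which Y satisfies as well. -/
theorem exists_toQ_eq {n : ℕ} {Y : A.QCoch n} (hY : Y ∈ A.wvarSubmodule n) :
    ∃ X ∈ A.fullProlongation A.CVect n, ∀ f, A.toQ n (X f) = Y f := by
  have hS : ∀ i : Fin n → I, ∃ P, A.toQ n P = Y (A.u ∘ i) := fun i => Submodule.mkQ_surjective _ _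
  choose S hS using hS
  refine ⟨A.masterPoly (asym F S), mem_fullProlongation_iff.2 (isSkew_asym S).admissible,
    fun f => ?_⟩
  rw [hY.2 f]
  refine toQ_masterPoly (fun i => ?_) f
  refine map_asym (A.toQ n) (S := S) (W := fun i => Y (A.u ∘ i)) (fun σ i => ?_) i
  have : A.toQ n (rename σ (S (i ∘ σ))) = A.renameQ σ (A.toQ n (S (i ∘ σ))) := rfl
  rw [this, hS]
  exact hY.1.2.2 σ (A.u ∘ i)

theorem totalD_rename {n : ℕ} (σ : Equiv.Perm (Fin n)) (P : MvPolynomial (Fin n) V) :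
    A.totalD n (rename σ P) = rename σ (A.totalD n P) := by
  rw [totalD, LinearMap.add_apply, LinearMap.add_apply, LinearMap.mulLeft_apply,
    LinearMap.mulLeft_apply, coeffD_rename, map_add, map_mul, map_sum]
  simp only [rename_X]
  rw [Equiv.sum_comp σ (fun i => (X i : MvPolynomial (Fin n) V))]

/-- On generators X has preimages under the total operator. Their antisymmetrized extension Y is
admissible, and its image under the total operator agrees with X on generators, hence everywhere. -/
theorem exists_totalD_eq {n : ℕ} {X : A.Coch n} (hX : X ∈ A.fullProlongation A.CVect n)
    (h : ∀ f, A.toQ n (X f) = 0) :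
    ∃ Y ∈ A.fullProlongation A.CVect n, ∀ f, A.totalD n (Y f) = X f := by
  have hX' := mem_fullProlongation_iff.1 hX
  have hS : ∀ i : Fin n → I, ∃ P, A.totalD n P = X (A.u ∘ i) := fun i =>
    (Submodule.Quotient.mk_eq_zero _).1 (h (A.u ∘ i))
  choose S hS using hS
  have hY : A.Admissible (toList (Pi.single n (A.masterPoly (asym F S)))) :=
    (isSkew_asym S).admissible
  refine ⟨A.masterPoly (asym F S), mem_fullProlongation_iff.2 hY, fun f => ?_⟩
  let Y : A.Coch n := fun v => A.totalD n (A.masterPoly (asym F S) v)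
  have hDY : A.Admissible (toList (Pi.single n Y)) := by
    have := admissible_totalOp hY
    rw [← toList_totalD] at this
    have := admissible_toList_iff.1 this n
    simpa only [Pi.single_eq_same] using this
  refine congrFun (ext_of_single hDY hX' fun i => ?_) f
  change A.totalD n (A.masterPoly (asym F S) (A.u ∘ i)) = _
  rw [masterPoly_u]
  refine map_asym (A.totalD n) (S := S) (W := fun i => X (A.u ∘ i)) (fun σ i => ?_) i
  rw [totalD_rename, hS]
  exact hX'.isSkew σ i

variable (A) in
/-- The map `∫` in a given degree. -/
def intComponent (n : ℕ) : A.TildeWvar n →ₗ[F] A.Wvar n where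
  toFun X := (⟨fun f => A.toQ n (X.toCoch f), toQ_comp_mem X.2⟩ : ↥(A.wvarSubmodule n))
  map_add' X Y := Subtype.ext (funext fun f => map_add (A.toQ n) (X.toCoch f) (Y.toCoch f))
  map_smul' r X := Subtype.ext (funext fun f => map_smul (A.toQ n) r (X.toCoch f))

variable (A) in
/-- The map `∫`. -/
def int : A.TildeWvarTotal →ₗ[F] A.WvarTotal := DirectSum.lmap A.intComponent

theorem qcoch_int (X : A.TildeWvarTotal) (n : ℕ) (v : Fin n → V) :
    A.qcoch (A.int X) n v = A.toQ n (A.coch X n v) := rfl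

theorem intComponent_surjective (n : ℕ) : Function.Surjective (A.intComponent n) := by
  intro Y
  obtain ⟨X, hX, h⟩ := exists_toQ_eq Y.2
  exact ⟨(⟨X, hX⟩ : ↥(A.fullProlongation A.CVect n)), Subtype.ext (funext h)⟩

theorem int_surjective : Function.Surjective A.int :=
  DFinsupp.mapRange_surjective _ (fun _ => map_zero _) |>.2
    intComponent_surjective

theorem ker_int {D : A.TildeWvarTotal →ₗ[F] A.TildeWvarTotal}
    (hD : ∀ X n v, A.coch (D X) n v = A.totalD n (A.coch X n v)) :
    LinearMap.ker A.int = LinearMap.range D := by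
  classical
  ext X
  constructor
  · intro hX
    -- Taking Y = 0 wherever the component of X vanishes keeps the collection of preimages finitely
    -- supported.
    have h : ∀ n, ∃ Y : A.TildeWvar n, (∀ f, A.totalD n (Y.toCoch f) = A.coch X n f) ∧
        (X n = 0 → Y = 0) := by
      intro n
      by_cases h0 : X n = 0
      · exact ⟨0, fun f => by rw [coch, h0]; exact map_zero (A.totalD n), fun _ => rfl⟩
      · obtain ⟨Y, hY, h⟩ := exists_totalD_eq (X n).2 fun f => by
          have := congrArg (fun Z => A.qcoch Z n f) (LinearMap.mem_ker.1 hX)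
          exact this
        exact ⟨(⟨Y, hY⟩ : ↥(A.fullProlongation A.CVect n)), h, fun h => absurd h h0⟩
    choose Y hY hY0 using h
    refine ⟨DirectSum.mk A.TildeWvar (DFinsupp.support X) fun n => Y n,
      coch_injective (funext fun n => funext fun v => ?_)⟩
    rw [hD, ← hY]
    congr 2
    by_cases hn : n ∈ DFinsupp.support X
    · rw [coch, DirectSum.mk_apply_of_mem hn]
    · rw [coch, DirectSum.mk_apply_of_notMem hn, hY0 n (DFinsupp.notMem_support_iff.1 hn)]
  · rintro ⟨Y, rfl⟩
    refine LinearMap.mem_ker.2 (DFinsupp.ext fun n => Subtype.ext (funext fun v => ?_))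
    have : A.toQ n (A.coch (D Y) n v) = 0 := by
      rw [hD]
      exact (Submodule.Quotient.mk_eq_zero _).2 ⟨_, rfl⟩
    exact this

end DiffFunctionAlgebra

/-! ### Assembly of the structures on W̃^var and W^var. -/

theorem mainTheorem8 {F V I : Type*} [Field F] [CharZero F] [CommRing V] [Algebra F V] [Fintype I]
    (A : DiffFunctionAlgebra F V I) :
    ∃ (P : OddPVA F A.TildeWvarTotal) (L : LieSuperalgebra F A.WvarTotal)
      (ρ : A.WvarTotal →ₗ[F] A.TildeWvarTotal →ₗ[F] A.TildeWvarTotal)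
      (int : A.TildeWvarTotal →ₗ[F] A.WvarTotal)
      (Q : LieSuperalgebra F (A.TildeWvarTotal ⧸ LinearMap.range P.D))
      (e : (A.TildeWvarTotal ⧸ LinearMap.range P.D) ≃ₗ[F] A.WvarTotal),
      -- the operations of the odd PVA are the unit of `V`, the concatenation product,
      -- multiplication by `λ_0 + ⋯ + λ_k + ∂`, and the `λ`-bracket, which is thus polynomial
      (∀ i, P.parity i = degreeParity F A.TildeWvar 0 i) ∧
      (∀ n v, A.coch P.one n v = if n = 0 then 1 else 0) ∧
      (∀ X Y n v, A.coch (P.mul X Y) n v = A.wedge (A.coch X) (A.coch Y) n v) ∧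
      (∀ X n v, A.coch (P.D X) n v = A.totalD n (A.coch X n v)) ∧
      (∀ X Y j n v, A.coch (P.lbr X Y j) n v
        = DiffFunctionAlgebra.lamCoeff j (A.lamBracket (A.coch X) (A.coch Y) n v)) ∧
      P.IsGraded (fun n => LinearMap.range (DirectSum.lof F ℕ A.TildeWvar n)) ∧
      -- `W^var` is a Lie superalgebra under the bracket of `W^∂`
      (∀ i, L.parity i = degreeParity F A.Wvar 1 i) ∧
      (∀ X Y n v, A.qcoch (L.bracket X Y) n v = A.lieBracket (A.qcoch X) (A.qcoch Y) n v) ∧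
      -- its action
      (∀ X Y n v, A.coch (ρ X Y) n v = A.action (A.qcoch X) (A.coch Y) n v) ∧
      IsRepByDerivations L P ρ ∧
      -- the map `∫`
      (∀ X n v, A.qcoch (int X) n v = A.toQ n (A.coch X n v)) ∧
      (∀ X Y, int (ρ X Y) = L.bracket X (int Y)) ∧
      -- the induced isomorphism
      IsReducedLieSuperalgebra P Q ∧
      (∀ X, e (Submodule.Quotient.mk X) = int X) ∧
      IsLieSuperIso Q L e := by
  open DiffFunctionAlgebra in
  obtain ⟨P, hpar, hone, hmul, hD, hlbr, hcoch⟩ := exists_oddPVA A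
  have hDc : ∀ X n v, A.coch (P.D X) n v = A.totalD n (A.coch X n v) := fun X n v =>
    congrFun (congrFun (coch_eq_of_toFun (Z := fun n v => A.totalD n (A.coch X n v))
      (by rw [hD, toList_totalD, toFun_eq])) n) v
  have hker := ker_int hDc
  have hpar' : ∀ i, (P.parity (i + 1)).map A.int = degreeParity F A.Wvar 1 i := fun i => by
    rw [hpar, degreeParity_shift, zero_add]
    exact map_lmap_degreeParity _ int_surjective 1 i
  obtain ⟨L, ρ, hL, hρ, hint, hrep⟩ := P.exists_reduced int_surjective hker
    (degreeParity_isInternal F A.Wvar 1) hpar'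
  let e : (A.TildeWvarTotal ⧸ LinearMap.range P.D) ≃ₗ[F] A.WvarTotal :=
    (Submodule.quotEquivOfEq _ _ hker.symm).trans (A.int.quotKerEquivOfSurjective int_surjective)
  have he : ∀ X, e (Submodule.Quotient.mk X) = A.int X := fun X => rfl
  have hbr0 : ∀ X Y {n : ℕ} (v : Fin n → V) (t : Fin n → F),
      evalAt t (A.coch (P.lbr X Y 0) n v)
        = A.br 0 (toList (A.coch X)) (toList (A.coch Y)) (List.ofFn (zipFn v t)) :=
    fun X Y n v t => by
      rw [← toFun_zipFn, ← evalLam_zero_right, hlbr]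
      rfl
  -- The bracket on the quotient by ∂ is transported from W^var along `e`, so the isomorphism is
  -- automatic and only the formula with [X_λ Y] at λ = 0 has to be checked.
  refine ⟨P, L, ρ, A.int, L.comap e, e, hpar, fun n v => ?_, fun X Y n v => ?_, hDc, hcoch,
    isGraded hone hmul hD hlbr, hL, fun X Y n v => ?_, fun X Y n v => ?_, hrep, fun X n v => rfl,
    hint, ⟨fun i => ?_, fun a b => ?_⟩, he, L.isLieSuperIso_comap e⟩
  · refine congrFun (congrFun (coch_eq_of_toFun (Z := fun n v => if n = 0 then 1 else 0)
      (hone.trans (funext fun l => ?_))) n) v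
    cases l with
    | nil => exact (map_one (evalAt _)).symm
    | cons a l => exact (map_zero (evalAt _)).symm
  · refine eq_of_evalAt_eq (F := F) fun t => ?_
    rw [evalAt_wedge, ← toFun_zipFn, hmul]
    rfl
  -- Surjectivity of ∫ provides admissible representatives, with which the chosen `rep` is compared.
  · obtain ⟨X, rfl⟩ := int_surjective X
    obtain ⟨Y, rfl⟩ := int_surjective Y
    rw [← hint, hρ, qcoch_int]
    exact (lieBracket_eq (fun n v => rfl) (fun n v => rfl) (admissible_toFun X) (admissible_toFun Y)
      v (hbr0 X Y v)).symm
  · obtain ⟨X, rfl⟩ := int_surjective X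
    refine eq_of_evalAt_eq (F := F) fun t => ?_
    rw [hρ, hbr0]
    exact (action_eq (fun n v => rfl) (admissible_toFun X) (admissible_toFun Y) v t).symm
  · refine Submodule.map_injective_of_injective e.injective ?_
    rw [(L.isLieSuperIso_comap e).map_parity, hL, ← hpar', ← Submodule.map_comp]
    rfl
  · refine e.injective ?_
    rw [(L.isLieSuperIso_comap e).map_bracket, he, he, he, ← hint, hρ]
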